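/- Let $A=\{z\in\mathbb C : r\le |z|\le R\}$ with $0<r<R$ be an annulus, let $V=A\times[0,1]$ be the corresponding solid torus, and let $p\colon V\to A$, $(x,t)\mapsto x$, be the projection. A closed curve $\gamma\colon S^1\to A$ is \emph{regular} if it is piecewise smooth and has only finitely many multiple points, all of which are transverse double points. The \emph{wrapping number} of a regular curve $\gamma$ in $A$ is the minimum number of intersections of $\gamma(S^1)$ with a simple arc in $A$ that joins the two components of $\partial A$ and contains no multiple point of $\gamma$. The \emph{wrapping number} of a link $X$ in a solid torus $U$ is the minimum number of intersections of $X$ with a meridional disk of $U$, that is, with the image of $\{1\}\times D^2$ under a homeomorphism $S^1\times D^2\to U$. A \emph{knot} in $V$ is a piecewise smooth simple closed curve $N\colon S^1\to \operatorname{int} V$ (with nowhere vanishing velocity on the closed smooth pieces). Two knots in $V$ are \emph{equivalent} if an ambient isotopy of $V$ moves the image of one to the image of the other. A knot $N$ is in \emph{regular position} if $p\circ N$ is a regular curve, and in \emph{minimal position} if it is in regular position and the number of double points of $p\circ N$ is minimal among all knots in regular position that are equivalent to $N$. \textbf{Lemma.} Let $N$ be a knot in $V$ in minimal position. If the wrapping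 number of $p\circ N$ in $A$ equals $2$, then the wrapping number of $N$ in $V$ equals $2$. -/

import Mathlib

open Set
open scoped ContDiff

namespace KnotAnnulus

/-- A closed curve `c : S¹ = ℝ / ℤ → E` is piecewise smooth: it is continuous, and `[0, 1]` has a
finite subdivision such that `c` is `C^∞` (up to the end points) on each closed piece. -/
def IsPiecewiseSmooth {E : Type*} [NormedAddCommGroup E] [NormedSpace ℝ E]
    (c : UnitAddCircle → E) : Prop :=
  Continuous c ∧ ∃ (n : ℕ) (t : Fin (n + 1) → ℝ), StrictMono t ∧ t 0 = 0 ∧ t (Fin.last n) = 1 ∧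
    ∀ i : Fin n,
      ContDiffOn ℝ ∞ (fun s : ℝ => c (s : UnitAddCircle)) (Icc (t i.castSucc) (t i.succ))

/-- A piecewise smooth closed curve whose velocity vanishes nowhere on the closed smooth pieces
(one-sided velocities at their end points). Smooth immersed curves and nondegenerate polygons
are examples. -/
def IsPiecewiseSmoothImmersion {E : Type*} [NormedAddCommGroup E] [NormedSpace ℝ E]
    (c : UnitAddCircle → E) : Prop :=
  Continuous c ∧ ∃ (n : ℕ) (t : Fin (n + 1) → ℝ), StrictMono t ∧ t 0 = 0 ∧ t (Fin.last n) = 1 ∧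
    ∀ i : Fin n,
      ContDiffOn ℝ ∞ (fun s : ℝ => c (s : UnitAddCircle)) (Icc (t i.castSucc) (t i.succ)) ∧
      ∀ s ∈ Icc (t i.castSucc) (t i.succ),
        derivWithin (fun s : ℝ => c (s : UnitAddCircle)) (Icc (t i.castSucc) (t i.succ)) s ≠ 0

/-- The closed annulus `A` with radii `r < R`. Its boundary components are the circles
`‖z‖ = r` and `‖z‖ = R`. -/
def annulus (r R : ℝ) : Set ℂ := {z | r ≤ ‖z‖ ∧ ‖z‖ ≤ R}

/-- The solid torus `V = A × [0, 1]`. -/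
def solidTorus (r R : ℝ) : Set (ℂ × ℝ) := annulus r R ×ˢ Icc (0 : ℝ) 1

/-- The points of a closed curve that are attained at least twice. -/
def multiplePoints {E : Type*} (c : UnitAddCircle → E) : Set E :=
  {x | ∃ s t : UnitAddCircle, s ≠ t ∧ c s = x ∧ c t = x}

/-- A regular closed curve in the plane: piecewise smooth, with finitely many multiple points, all
of them transverse double points. -/
structure IsRegularCurve (c : UnitAddCircle → ℂ) : Prop where
  piecewiseSmooth : IsPiecewiseSmooth c
  finite_multiplePoints : (multiplePoints c).Finite
  double : ∀ x ∈ multiplePoints c, {s | c s = x}.encard = 2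
  /-- Linear independence forces both velocities to be nonzero, so the curve is in particular
  differentiable at both parameters. -/
  transverse : ∀ s t : ℝ, (s : UnitAddCircle) ≠ (t : UnitAddCircle) →
    c (s : UnitAddCircle) = c (t : UnitAddCircle) →
    LinearIndependent ℝ
      ![deriv (fun u : ℝ => c (u : UnitAddCircle)) s, deriv (fun u : ℝ => c (u : UnitAddCircle)) t]

/-- `a` is a (simple) arc in the annulus that joins the two boundary components. -/
def IsSpanningArc (r R : ℝ) (a : Set ℂ) : Prop :=
  ∃ f : unitInterval → ℂ, Continuous f ∧ Function.Injective f ∧ ‖f 0‖ = r ∧ ‖f 1‖ = R ∧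
    range f = a ∧ a ⊆ annulus r R

/-- The wrapping number of a closed curve `c` in the annulus: the minimum number of intersections
of `c` with an arc that joins the two boundary components of the annulus and contains no multiple
point of `c`. -/
noncomputable def curveWrappingNumber (r R : ℝ) (c : UnitAddCircle → ℂ) : ℕ∞ :=
  sInf {k | ∃ a : Set ℂ, IsSpanningArc r R a ∧ Disjoint a (multiplePoints c) ∧
    k = (a ∩ range c).encard}

/-- `D` is a meridional disk of the solid torus `U`: it is the image of `{1} × D²` under some
homeomorphism from `S¹ × D²` onto `U`. -/
def IsMeridionalDisk {M : Type*} [TopologicalSpace M] (U D : Set M) : Prop :=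
  ∃ h : (Circle × Metric.closedBall (0 : ℂ) 1) ≃ₜ U, D = range fun d => (h (1, d) : M)

/-- The wrapping number of a subset `X` of a solid torus `U`: the minimum number of intersections
of `X` with a meridional disk of `U`. -/
noncomputable def wrappingNumber {M : Type*} [TopologicalSpace M] (U X : Set M) : ℕ∞ :=
  sInf {k | ∃ D : Set M, IsMeridionalDisk U D ∧ k = (D ∩ X).encard}

/-- A knot in `V`: a piecewise smooth simple closed curve in the interior of `V`. -/
structure IsKnot (r R : ℝ) (N : UnitAddCircle → ℂ × ℝ) : Prop where
  piecewiseSmooth : IsPiecewiseSmoothImmersion N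
  injective : Function.Injective N
  mem_interior : ∀ s, N s ∈ interior (solidTorus r R)

/-- The projection of a curve in `V = A × [0, 1]` to the annulus `A`. -/
def proj (N : UnitAddCircle → ℂ × ℝ) : UnitAddCircle → ℂ := fun s => (N s).1

/-- Two knots in `V` are equivalent if an ambient isotopy of `V` moves (the image of) the first
to (the image of) the second. -/
def Equivalent (r R : ℝ) (N₁ N₂ : UnitAddCircle → ℂ × ℝ) : Prop :=
  ∃ H : unitInterval → (solidTorus r R ≃ₜ solidTorus r R),
    Continuous (fun q : unitInterval × solidTorus r R => H q.1 q.2) ∧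
    H 0 = Homeomorph.refl _ ∧
    (fun x => ((H 1 x : solidTorus r R) : ℂ × ℝ)) '' {x | (x : ℂ × ℝ) ∈ range N₁} = range N₂

/-- `N` is in a regular position with respect to the projection to the annulus. -/
def IsRegularPosition (N : UnitAddCircle → ℂ × ℝ) : Prop := IsRegularCurve (proj N)

/-- `N` is in a minimal position: it is in a regular position, and its projection has the least
number of double points among all knots in regular positions that are equivalent to `N`. -/
def IsMinimalPosition (r R : ℝ) (N : UnitAddCircle → ℂ × ℝ) : Prop :=
  IsRegularPosition N ∧ ∀ N' : UnitAddCircle → ℂ × ℝ, IsKnot r R N' → IsRegularPosition N' →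
    Equivalent r R N N' → (multiplePoints (proj N)).encard ≤ (multiplePoints (proj N')).encard

end KnotAnnulus

/-!
A curve `γ` in the annulus is studied through the components of its complement in the plane, where
the origin stands for the inner boundary component and a large point for the outer one. The basic
tool is a form of Borsuk's criterion: a compact planar set `K` does not separate the origin from
infinity if and only if the coordinate function has a continuous logarithm on `K`
(`conn_compl_of_log`, `exists_log_of_conn_compl`).

*A meridional disk that meets the knot twice.* Let the projection `γ` of the knot have wrapping
number two, so that an arc from the origin to infinity meets `γ` in two simple points. Comparing
logarithms along the curve shows that these points can be exchanged for nearby points where `γ` is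
smooth (`conn_compl_of_arcs`). Around such points there are gates, boxes in which the curve is a
horizontal axis. The curve does not separate the origin from infinity once both gates are opened,
but it does if only one of them is opened, since the wrapping number is greater than one. Hence the
gates separate a chain of three regions, from the origin to infinity. Compactly supported
diffeomorphisms of the plane pull the outer gate out through the unbounded region, then the inner
gate through the middle region until it is right behind the outer one, and finally the origin close
to the inner gate. After this motion a horizontal ray that starts at the image of the origin crosses
the curve twice (`crossesRayTwice_of_curveWrappingNumber`). Pulling back polar coordinates gives a
parametrization of the solid torus with a meridional disk that meets the knot exactly twice, and
transversally (`CrossesRayTwice.exists_parametrization`).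

*No meridional disk meets the knot fewer than two times.* The first disk shows that the knot winds
an even number of times around the solid torus. Suppose that another disk meets the knot at most
once. With respect to this disk the degree is a multiple of the first one, hence even, so the knot
does not pass from one side of the disk to the other, and some parallel disk misses the knot
(`exists_disjoint_meridian`). The complement of this disk can be squeezed into a small set by
isotopies, which requires that the knot avoids the boundary in the given topological parametrization
(`norm_lt_one_of_mem_interior`, a consequence of a theorem of Brouwer's type). So the knot has a
continuous angle `θ`. Lifting the isotopy to the `k`-fold cyclic covering, which is again a solid
torus, shows that the knot is equivalent to the knot whose angle is `θ / k` and whose other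
coordinates are the same (`ambientIsotopic_div`, `exists_angle_equivalent`). For large `k` the
double points of the projection at which `θ` takes two different values disappear, and no new ones
arise. If the knot is in minimal position, then there are no such double points, and `θ` is a
continuous function on the projection `γ`. Therefore the coordinate has a logarithm on `γ`, and `γ`
does not separate the origin from infinity (`IsMinimalPosition.conn_compl`), which contradicts
wrapping number two.
-/


namespace KnotAnnulus

open Filter Topology Metric

/-! ### Points connected in a set -/

/-- Two points are connected in `X` if some preconnected subset of `X` contains both. -/
def Conn {α : Type*} [TopologicalSpace α] (X : Set α) (a b : α) : Prop :=
  ∃ C ⊆ X, IsPreconnected C ∧ a ∈ C ∧ b ∈ C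

namespace Conn

variable {α β : Type*} [TopologicalSpace α] [TopologicalSpace β] {X Y : Set α} {a b c : α}

lemma symm (h : Conn X a b) : Conn X b a := by
  obtain ⟨C, h1, h2, h3, h4⟩ := h
  exact ⟨C, h1, h2, h4, h3⟩

lemma trans (h : Conn X a b) (h' : Conn X b c) : Conn X a c := by
  obtain ⟨C, h1, h2, h3, h4⟩ := h
  obtain ⟨D, k1, k2, k3, k4⟩ := h'
  exact ⟨C ∪ D, union_subset h1 k1, h2.union b h4 k3 k2, Or.inl h3, Or.inr k4⟩

lemma mono (h : Conn X a b) (hXY : X ⊆ Y) : Conn Y a b := by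
  obtain ⟨C, h1, h2, h3, h4⟩ := h
  exact ⟨C, h1.trans hXY, h2, h3, h4⟩

lemma left_mem (h : Conn X a b) : a ∈ X := by
  obtain ⟨C, h1, h2, h3, h4⟩ := h
  exact h1 h3

lemma right_mem (h : Conn X a b) : b ∈ X := h.symm.left_mem

lemma of_preconnected {C : Set α} (hC : IsPreconnected C) (hX : C ⊆ X) (ha : a ∈ C) (hb : b ∈ C) :
    Conn X a b := ⟨C, hX, hC, ha, hb⟩

lemma image (h : Conn X a b) {f : α → β} (hf : Continuous f) {Z : Set β}
    (hZ : f '' X ⊆ Z) : Conn Z (f a) (f b) := by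
  obtain ⟨C, h1, h2, h3, h4⟩ := h
  exact ⟨f '' C, (image_mono h1).trans hZ, h2.image f hf.continuousOn,
    mem_image_of_mem f h3, mem_image_of_mem f h4⟩

lemma mem_component (h : Conn X a b) : b ∈ connectedComponentIn X a := by
  obtain ⟨C, h1, h2, h3, h4⟩ := h
  exact h2.subset_connectedComponentIn h3 h1 h4

lemma of_mem_component (h : b ∈ connectedComponentIn X a) : Conn X a b := by
  have ha : a ∈ X := by
    by_contra h'
    rw [connectedComponentIn_eq_empty h'] at h
    exact h
  exact ⟨_, connectedComponentIn_subset X a, isPreconnected_connectedComponentIn,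
    mem_connectedComponentIn ha, h⟩

end Conn

lemma conn_segment {X : Set ℂ} {a b : ℂ} (h : segment ℝ a b ⊆ X) : Conn X a b :=
  Conn.of_preconnected (convex_segment a b).isPreconnected h (left_mem_segment ℝ a b)
    (right_mem_segment ℝ a b)

lemma isPreconnected_outside (ρ : ℝ) : IsPreconnected {z : ℂ | ρ ≤ ‖z‖} := by
  by_cases hρ : ρ ≤ 0
  · have : {z : ℂ | ρ ≤ ‖z‖} = univ := by
      ext z; simpa using hρ.trans (norm_nonneg z)
    rw [this]; exact isPreconnected_univ
  push Not at hρ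
  have : {z : ℂ | ρ ≤ ‖z‖} =
      (fun p : ℝ × ℝ => (p.1 : ℂ) * Complex.exp (p.2 * Complex.I)) '' (Ici ρ ×ˢ univ) := by
    ext z
    constructor
    · intro hz
      exact ⟨(‖z‖, z.arg), ⟨hz, trivial⟩, Complex.norm_mul_exp_arg_mul_I z⟩
    · rintro ⟨⟨a, b⟩, ⟨ha, -⟩, rfl⟩
      have ha' : ρ ≤ a := ha
      simp only [mem_ofPred_eq, norm_mul, Complex.norm_real, Complex.norm_exp_ofReal_mul_I, mul_one,
        Real.norm_eq_abs]
      exact ha'.trans (le_abs_self a)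
  rw [this]
  exact (isPreconnected_Ici.prod isPreconnected_univ).image _ (by fun_prop)

/-! ### Logarithms -/

/-- A continuous function with integer values is constant on preconnected sets. -/
lemma eq_of_forall_int {α : Type*} [TopologicalSpace α] {S : Set α} (hS : IsPreconnected S)
    {f : α → ℝ} (hf : ContinuousOn f S) (h : ∀ x ∈ S, ∃ n : ℤ, f x = n) {x y : α}
    (hx : x ∈ S) (hy : y ∈ S) : f x = f y := by
  have key : ∀ x ∈ S, ∀ y ∈ S, ¬ f x < f y := by
    intro x hx y hy hlt
    obtain ⟨n, hn⟩ := h x hx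
    obtain ⟨m, hm⟩ := h y hy
    rw [hn, hm] at hlt
    have h1 : n + 1 ≤ m := by exact_mod_cast hlt
    have h2 : (n : ℝ) + 1 ≤ m := by exact_mod_cast h1
    have := (hS.image f hf).ordConnected.out (mem_image_of_mem f hx) (mem_image_of_mem f hy)
    have h3 : (n : ℝ) + 1 / 2 ∈ Icc (f x) (f y) := by
      rw [hn, hm]; constructor <;> linarith
    obtain ⟨z, hz, hz'⟩ := this h3
    obtain ⟨k, hk⟩ := h z hz
    rw [hk] at hz'
    have h4 : (2 : ℝ) * k = 2 * n + 1 := by linarith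
    have h5 : (2 : ℤ) * k = 2 * n + 1 := by exact_mod_cast h4
    omega
  exact le_antisymm (not_lt.1 (key y hy x hx)) (not_lt.1 (key x hx y hy))

/-- Two continuous logarithms of the same function differ by a constant on preconnected sets. -/
lemma exists_int_sub_eq {α : Type*} [TopologicalSpace α] {S : Set α} (hS : IsPreconnected S)
    {f g : α → ℂ} (hf : ContinuousOn f S) (hg : ContinuousOn g S)
    (h : ∀ x ∈ S, Complex.exp (f x) = Complex.exp (g x)) :
    ∃ n : ℤ, ∀ x ∈ S, f x = g x + n * (2 * Real.pi * Complex.I) := by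
  rcases S.eq_empty_or_nonempty with rfl | ⟨x₀, hx₀⟩
  · exact ⟨0, by simp⟩
  have hn : ∀ x ∈ S, ∃ n : ℤ, f x = g x + n * (2 * Real.pi * Complex.I) := fun x hx =>
    Complex.exp_eq_exp_iff_exists_int.1 (h x hx)
  obtain ⟨n, hn0⟩ := hn x₀ hx₀
  refine ⟨n, fun x hx => ?_⟩
  have hpi : (2 * Real.pi : ℝ) ≠ 0 := by positivity
  have aux : ∀ x, ∀ n : ℤ, f x = g x + n * (2 * Real.pi * Complex.I) →
      ((f x - g x).im / (2 * Real.pi)) = n := by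
    intro x n hx
    rw [hx]
    field_simp
    simp
    ring
  have := eq_of_forall_int hS (f := fun x => ((f x - g x).im / (2 * Real.pi)))
    (by
      apply ContinuousOn.div_const
      exact Complex.continuous_im.comp_continuousOn (hf.sub hg))
    (fun x hx => by
      obtain ⟨n, hn⟩ := hn x hx
      exact ⟨n, aux x n hn⟩) hx hx₀
  obtain ⟨m, hm⟩ := hn x hx
  rw [aux x m hm, aux x₀ n hn0] at this
  have : m = n := by exact_mod_cast this
  rw [hm, this]

lemma exists_continuous_log {A : Type*} [TopologicalSpace A] [SimplyConnectedSpace A]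
    [LocallyPathConnectedSpace A] {f : A → ℂ} (hf : Continuous f) (h0 : ∀ x, f x ≠ 0) :
    ∃ g : A → ℂ, Continuous g ∧ ∀ x, Complex.exp (g x) = f x := by
  obtain ⟨a⟩ : Nonempty A := inferInstance
  obtain ⟨g, ⟨-, hg⟩, -⟩ := Complex.isCoveringMapOn_exp.existsUnique_continuousMap_lifts
    ⟨f, hf⟩ (a₀ := a) (e₀ := Complex.log (f a)) (Complex.exp_log (h0 a)) (fun x => h0 x)
  exact ⟨g, g.continuous, fun x => congrFun hg x⟩

/-- A compact planar set on which the coordinate has a continuous logarithm does not separate `0`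
from infinity. If it did, extending the logarithm over the component of `0` would produce a map
of the plane to `ℂ ∖ 0` that is the identity on a large circle. -/
theorem conn_compl_of_log {K : Set ℂ} (hK : IsCompact K) {l : ℂ → ℂ} (hl : ContinuousOn l K)
    (hexp : ∀ z ∈ K, Complex.exp (l z) = z) {w : ℂ} (hw : ∀ z ∈ K, ‖z‖ < ‖w‖) (hw0 : w ≠ 0) :
    Conn Kᶜ 0 w := by
  classical
  by_contra hcon
  have h0K : (0 : ℂ) ∈ Kᶜ := fun h => by
    have := hexp 0 h
    exact Complex.exp_ne_zero _ this
  set U := connectedComponentIn Kᶜ (0 : ℂ) with hU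
  have hUo : IsOpen U := hK.isClosed.isOpen_compl.connectedComponentIn
  have h0U : (0 : ℂ) ∈ U := mem_connectedComponentIn h0K
  have hout : ∀ z ∈ U, ‖z‖ < ‖w‖ := by
    intro z hz
    by_contra h
    push Not at h
    apply hcon
    refine (Conn.of_mem_component hz).trans
      (Conn.of_preconnected (isPreconnected_outside ‖w‖) ?_ h (le_refl ‖w‖))
    intro y hy hyK
    exact absurd (hw y hyK) (not_lt.2 hy)
  have hfr : frontier U ⊆ K := by
    intro z hz
    by_contra hzK
    have hopen : IsOpen (connectedComponentIn Kᶜ z) :=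
      hK.isClosed.isOpen_compl.connectedComponentIn
    have hzc : z ∈ closure U := frontier_subset_closure hz
    obtain ⟨y, hy1, hy2⟩ := mem_closure_iff.1 hzc _ hopen (mem_connectedComponentIn hzK)
    have : z ∈ U :=
      ((Conn.of_mem_component hy2).trans (Conn.of_mem_component hy1).symm).mem_component
    rw [hUo.frontier_eq] at hz
    exact hz.2 this
  obtain ⟨L, hL⟩ := ContinuousMap.exists_restrict_eq hK.isClosed
    (⟨K.domRestrict l, continuousOn_iff_continuous_domRestrict.1 hl⟩ : C(K, ℂ))
  have hLK : ∀ z ∈ K, L z = l z := fun z hz => by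
    have := congrArg (fun F => F ⟨z, hz⟩) hL
    exact this
  let f : ℂ → ℂ := fun z => if z ∈ U then Complex.exp (L z) else z
  have hf : Continuous f := by
    refine Continuous.if ?_ (by fun_prop) continuous_id
    intro z hz
    have hzK : z ∈ K := hfr hz
    rw [hLK z hzK, hexp z hzK]
  have hf0 : ∀ z, f z ≠ 0 := by
    intro z
    by_cases hz : z ∈ U
    · simp only [f, hz, if_true]; exact Complex.exp_ne_zero _
    · simp only [f, hz, if_false]; rintro rfl; exact hz h0U
  obtain ⟨g, hg, hgf⟩ := exists_continuous_log hf hf0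
  have hρ : 0 < ‖w‖ := norm_pos_iff.2 hw0
  obtain ⟨n, hn⟩ := exists_int_sub_eq (S := (univ : Set ℝ)) isPreconnected_univ
    (f := fun t : ℝ => g (‖w‖ * Complex.exp (t * Complex.I)))
    (g := fun t : ℝ => Real.log ‖w‖ + t * Complex.I)
    (by fun_prop) (by fun_prop) (by
      intro t _
      have hnU : (‖w‖ * Complex.exp (t * Complex.I) : ℂ) ∉ U := by
        intro h
        have := hout _ h
        simp [Complex.norm_exp_ofReal_mul_I] at this
      rw [hgf, Complex.exp_add, ← Complex.ofReal_exp, Real.exp_log hρ]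
      simp [f, hnU])
  have h1 := hn 0 trivial
  have h2 := hn (2 * Real.pi) trivial
  simp only [Complex.ofReal_mul, Complex.ofReal_ofNat, Complex.exp_two_pi_mul_I] at h2
  simp only [Complex.ofReal_zero, zero_mul, Complex.exp_zero] at h1
  rw [h1] at h2
  have h3 : (2 * Real.pi * Complex.I : ℂ) = 0 := by linear_combination -h2
  exact Complex.two_pi_I_ne_zero h3

/-- On a compact planar set that does not separate `0` from infinity, the coordinate has a
continuous logarithm: the points `a` for which `z - a` has one form an open and closed subset of
the complement. -/
theorem exists_log_of_conn_compl {K : Set ℂ} (hK : IsCompact K) {w : ℂ} (hw : ∀ z ∈ K, ‖z‖ < ‖w‖)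
    (hc : Conn Kᶜ 0 w) : ∃ l : ℂ → ℂ, ContinuousOn l K ∧ ∀ z ∈ K, Complex.exp (l z) = z := by
  let P : ℂ → Prop := fun a => ∃ l : ℂ → ℂ, ContinuousOn l K ∧ ∀ z ∈ K, Complex.exp (l z) = z - a
  suffices h : P 0 by simpa [P] using h
  obtain ⟨C, hC, hCp, h0, hwC⟩ := hc
  have step : ∀ a b : ℂ, (∀ z ∈ K, ‖b - a‖ < ‖z - b‖) → P b → P a := by
    rintro a b hab ⟨l, hl, hle⟩
    have hne : ∀ z ∈ K, z - b ≠ 0 := fun z hz h => by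
      have := hab z hz
      rw [h, norm_zero] at this
      exact absurd this (not_lt.2 (norm_nonneg _))
    have hsl : ∀ z ∈ K, (z - a) / (z - b) ∈ Complex.slitPlane := by
      intro z hz
      have h1 : (z - a) / (z - b) = 1 + (b - a) / (z - b) := by
        field_simp [hne z hz]; ring
      rw [h1]
      apply Complex.mem_slitPlane_of_norm_lt_one
      rw [norm_div, div_lt_one (norm_pos_iff.2 (hne z hz))]
      exact hab z hz
    refine ⟨fun z => l z + Complex.log ((z - a) / (z - b)), ?_, ?_⟩
    · refine hl.add (ContinuousOn.clog ?_ hsl)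
      exact ContinuousOn.div (by fun_prop) (by fun_prop) hne
    · intro z hz
      rw [Complex.exp_add, hle z hz, Complex.exp_log (Complex.slitPlane_ne_zero (hsl z hz))]
      field_simp [hne z hz]
  have hPw : P w := by
    have hw0 : ∀ z ∈ K, w ≠ 0 := by
      rintro z hz rfl
      have := hw z hz
      simp at this
      exact absurd this (not_lt.2 (norm_nonneg z))
    have hsl : ∀ z ∈ K, 1 - z / w ∈ Complex.slitPlane := by
      intro z hz
      rw [sub_eq_add_neg]
      apply Complex.mem_slitPlane_of_norm_lt_one
      rw [norm_neg, norm_div, div_lt_one (norm_pos_iff.2 (hw0 z hz))]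
      exact hw z hz
    refine ⟨fun z => Complex.log (-w) + Complex.log (1 - z / w), ?_, ?_⟩
    · exact continuousOn_const.add (ContinuousOn.clog (by fun_prop) hsl)
    · intro z hz
      have := hw0 z hz
      rw [Complex.exp_add, Complex.exp_log (neg_ne_zero.2 this),
        Complex.exp_log (Complex.slitPlane_ne_zero (hsl z hz))]
      field_simp
      ring
  refine (hCp.induction₂' (fun a b => P a → P b) ?_ (fun _ _ _ _ _ _ f g => g ∘ f) hwC h0) hPw
  intro a ha
  have haK : a ∉ K := hC ha
  obtain ⟨ε, hε, hball⟩ := Metric.mem_nhds_iff.1 (hK.isClosed.isOpen_compl.mem_nhds haK)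
  filter_upwards [mem_nhdsWithin_of_mem_nhds (Metric.ball_mem_nhds a (half_pos hε))] with b hb
  have hfar : ∀ z ∈ K, ε ≤ ‖z - a‖ := by
    intro z hz
    by_contra h
    push Not at h
    exact hball (by rwa [Metric.mem_ball, dist_eq_norm]) hz
  rw [Metric.mem_ball, dist_eq_norm] at hb
  constructor
  · refine step b a (fun z hz => ?_)
    have := hfar z hz
    rw [norm_sub_rev]; linarith
  · refine step a b (fun z hz => ?_)
    have h1 := hfar z hz
    have h2 : ‖z - a‖ ≤ ‖z - b‖ + ‖b - a‖ := by
      simpa using norm_add_le (z - b) (b - a)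
    linarith

/-! ### Simple arcs -/

/-- The points `a` and `b` are equal or are the end points of a simple arc contained in `X`. -/
def ArcIn {α : Type*} [TopologicalSpace α] (X : Set α) (a b : α) : Prop :=
  (a = b ∧ a ∈ X) ∨ ∃ f : unitInterval → α, Continuous f ∧ Function.Injective f ∧ f 0 = a ∧
    f 1 = b ∧ range f ⊆ X

namespace ArcIn

variable {α : Type*} [TopologicalSpace α] {X Y : Set α} {a b c : α}

lemma mono (h : ArcIn X a b) (hXY : X ⊆ Y) : ArcIn Y a b := by
  rcases h with ⟨h1, h2⟩ | ⟨f, h1, h2, h3, h4, h5⟩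
  · exact Or.inl ⟨h1, hXY h2⟩
  · exact Or.inr ⟨f, h1, h2, h3, h4, h5.trans hXY⟩

/-- A subarc between two parameters of a simple arc, in either direction. -/
lemma subarc {f : unitInterval → α} (hf : Continuous f) (hi : Function.Injective f)
    (s t : unitInterval) : ArcIn (f '' uIcc s t) (f s) (f t) := by
  by_cases hst : s = t
  · subst hst
    exact Or.inl ⟨rfl, mem_image_of_mem f (by simp)⟩
  have hst' : (t : ℝ) - s ≠ 0 := fun h => hst (Subtype.ext (by linarith))
  have hmem : ∀ u : unitInterval, (s : ℝ) + u * (t - s) ∈ uIcc (s : ℝ) t := by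
    intro u
    have h0 := u.2.1
    have h1 := u.2.2
    rcases le_total (s : ℝ) t with h | h
    · rw [uIcc_of_le h]; constructor <;> nlinarith
    · rw [uIcc_of_ge h]; constructor <;> nlinarith
  have hmem1 : ∀ u : unitInterval, (s : ℝ) + u * (t - s) ∈ Icc (0 : ℝ) 1 := fun u =>
    (ordConnected_Icc.uIcc_subset s.2 t.2) (hmem u)
  refine Or.inr ⟨fun u => f ⟨(s : ℝ) + u * (t - s), hmem1 u⟩, ?_, ?_, ?_, ?_, ?_⟩
  · exact hf.comp (by fun_prop)
  · intro u v huv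
    have := congrArg Subtype.val (hi huv)
    simp only at this
    apply Subtype.ext
    have h2 : ((u : ℝ) - v) * (t - s) = 0 := by linarith
    rcases mul_eq_zero.1 h2 with h | h
    · linarith
    · exact absurd h hst'
  · simp
  · simp
  · rintro _ ⟨u, rfl⟩
    refine mem_image_of_mem f ?_
    have := hmem u
    rcases le_total s t with h | h
    · have h' : (s : ℝ) ≤ t := h
      rw [uIcc_of_le h'] at this
      rw [uIcc_of_le h]; exact this
    · have h' : (t : ℝ) ≤ s := h
      rw [uIcc_of_ge h'] at this
      rw [uIcc_of_ge h]; exact this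

lemma symm (h : ArcIn X a b) : ArcIn X b a := by
  rcases h with ⟨rfl, h2⟩ | ⟨f, h1, h2, rfl, rfl, h5⟩
  · exact Or.inl ⟨rfl, h2⟩
  · exact (subarc h1 h2 1 0).mono ((image_subset_range _ _).trans h5)

/-- Two arcs with a common end point: follow the first one until it hits the second one. -/
lemma trans [T2Space α] (h : ArcIn X a b) (h' : ArcIn X b c) : ArcIn X a c := by
  rcases h with ⟨rfl, h2⟩ | ⟨f, hf, hfi, rfl, rfl, hfX⟩
  · exact h'
  rcases h' with ⟨rfl, h2⟩ | ⟨g, hg, hgi, hg0, rfl, hgX⟩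
  · exact Or.inr ⟨f, hf, hfi, rfl, rfl, hfX⟩
  -- `τ` is the first parameter at which `f` hits the second arc, so that following `f` up to `τ`
  -- and then `g` does not meet any point twice
  have hS : IsCompact {t : unitInterval | f t ∈ range g} :=
    ((isCompact_range hg).isClosed.preimage hf).isCompact
  obtain ⟨τ, hτ, hmin⟩ := hS.exists_isLeast ⟨1, ⟨0, hg0⟩⟩
  obtain ⟨σ, hσ⟩ := hτ
  by_cases hτ0 : τ = 0
  · rw [← hτ0, ← hσ]
    exact (subarc hg hgi σ 1).mono ((image_subset_range _ _).trans hgX)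
  by_cases hσ1 : σ = 1
  · rw [← hσ1, hσ]
    exact (subarc hf hfi 0 τ).mono ((image_subset_range _ _).trans hfX)
  have hτp : 0 < (τ : ℝ) := lt_of_le_of_ne τ.2.1 (fun h => hτ0 (Subtype.ext h.symm))
  have hσp : (σ : ℝ) < 1 := lt_of_le_of_ne σ.2.2 (fun h => hσ1 (Subtype.ext h))
  set h : unitInterval → α := fun t =>
    if (t : ℝ) ≤ 1 / 2 then f (projIcc 0 1 zero_le_one (2 * t * τ))
    else g (projIcc 0 1 zero_le_one (σ + (2 * t - 1) * (1 - σ))) with hh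
  have e1 : ∀ t : unitInterval, (t : ℝ) ≤ 1 / 2 → (2 * t * τ : ℝ) ∈ Icc (0 : ℝ) τ := by
    intro t ht
    have := t.2.1
    constructor
    · positivity
    · nlinarith
  have e1' : ∀ t : unitInterval, (t : ℝ) ≤ 1 / 2 → (2 * t * τ : ℝ) ∈ Icc (0 : ℝ) 1 := fun t ht =>
    ⟨(e1 t ht).1, (e1 t ht).2.trans τ.2.2⟩
  have e2 : ∀ t : unitInterval, 1 / 2 < (t : ℝ) →
      (σ + (2 * t - 1) * (1 - σ) : ℝ) ∈ Icc (0 : ℝ) 1 ∧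
      (σ : ℝ) < (σ + (2 * t - 1) * (1 - σ) : ℝ) := by
    intro t ht
    have h1 := t.2.2
    have h2 := σ.2.1
    have h3 : 0 < (2 * t - 1) * (1 - (σ : ℝ)) := mul_pos (by linarith) (by linarith)
    refine ⟨⟨by linarith, by nlinarith⟩, by linarith⟩
  have hcross : ∀ t u : unitInterval, (t : ℝ) ≤ 1 / 2 → 1 / 2 < (u : ℝ) → h t ≠ h u := by
    intro t u ht hu heq
    simp only [hh, if_pos ht, if_neg (not_le.2 hu)] at heq
    rw [projIcc_of_mem _ (e1' t ht), projIcc_of_mem _ (e2 u hu).1] at heq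
    have hle := hmin (show (⟨_, e1' t ht⟩ : unitInterval) ∈ {t : unitInterval | f t ∈ range g} from
      ⟨_, heq.symm⟩)
    have h1 : (2 * t * τ : ℝ) = τ := le_antisymm (e1 t ht).2 hle
    have h2 : (⟨_, e1' t ht⟩ : unitInterval) = τ := Subtype.ext h1
    rw [h2, ← hσ] at heq
    have h3 := congrArg Subtype.val (hgi heq)
    simp only at h3
    linarith [(e2 u hu).2]
  refine Or.inr ⟨h, ?_, ?_, ?_, ?_, ?_⟩
  · refine Continuous.if_le (hf.comp ?_) (hg.comp ?_) (by fun_prop) (by fun_prop) ?_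
    · exact continuous_projIcc.comp (by fun_prop)
    · exact continuous_projIcc.comp (by fun_prop)
    · intro t ht
      rw [ht]
      norm_num
      rw [hσ]
  · intro t u heq
    rcases le_or_gt (t : ℝ) (1 / 2) with ht | ht <;> rcases le_or_gt (u : ℝ) (1 / 2) with hu | hu
    · simp only [hh, if_pos ht, if_pos hu] at heq
      rw [projIcc_of_mem _ (e1' t ht), projIcc_of_mem _ (e1' u hu)] at heq
      have := congrArg Subtype.val (hfi heq)
      simp only at this
      have h2 : (t : ℝ) * τ = u * τ := by linarith
      exact Subtype.ext (mul_right_cancel₀ hτp.ne' h2)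
    · exact absurd heq (hcross t u ht hu)
    · exact absurd heq.symm (hcross u t hu ht)
    · simp only [hh, if_neg (not_le.2 ht), if_neg (not_le.2 hu)] at heq
      rw [projIcc_of_mem _ (e2 t ht).1, projIcc_of_mem _ (e2 u hu).1] at heq
      have := congrArg Subtype.val (hgi heq)
      simp only at this
      have h2 : (2 * t - 1 : ℝ) * (1 - σ) = (2 * u - 1) * (1 - σ) := by linarith
      have h3 := mul_right_cancel₀ (by linarith : (1 - σ : ℝ) ≠ 0) h2
      exact Subtype.ext (by linarith)
  · simp [hh]
  · have : ¬ ((1 : unitInterval) : ℝ) ≤ 1 / 2 := by norm_num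
    simp only [hh, if_neg this]
    norm_num
  · rintro _ ⟨t, rfl⟩
    simp only [hh]
    split_ifs
    · exact hfX ⟨_, rfl⟩
    · exact hgX ⟨_, rfl⟩

lemma of_segment {X : Set ℂ} {a b : ℂ} (h : segment ℝ a b ⊆ X) : ArcIn X a b := by
  by_cases hab : a = b
  · exact Or.inl ⟨hab, h (left_mem_segment ℝ a b)⟩
  refine Or.inr ⟨fun t => a + (t : ℝ) • (b - a), by fun_prop, ?_, by simp, by simp, ?_⟩
  · intro s t hst
    have h1 : ((s : ℝ) : ℂ) * (b - a) = (t : ℝ) * (b - a) := by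
      simpa using hst
    have h2 := mul_right_cancel₀ (sub_ne_zero.2 (Ne.symm hab)) h1
    exact Subtype.ext (by exact_mod_cast h2)
  · rintro _ ⟨t, rfl⟩
    apply h
    rw [segment_eq_image']
    exact ⟨t, t.2, rfl⟩

/-- Open connected planar sets are arcwise connected by simple arcs. -/
lemma of_conn {X : Set ℂ} (hX : IsOpen X) {a b : ℂ} (h : Conn X a b) : ArcIn X a b := by
  have ha : a ∈ X := h.left_mem
  have hopen : IsOpen (connectedComponentIn X a) := hX.connectedComponentIn
  refine ArcIn.mono (X := connectedComponentIn X a) ?_ (connectedComponentIn_subset X a)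
  refine (isPreconnected_connectedComponentIn (F := X) (x := a)).induction₂
    (ArcIn (connectedComponentIn X a)) ?_ (fun _ _ _ _ _ _ => trans) (fun _ _ _ _ => symm)
    (mem_connectedComponentIn ha) h.mem_component
  intro x hx
  obtain ⟨ε, hε, hb⟩ := Metric.mem_nhds_iff.1 (hopen.mem_nhds hx)
  filter_upwards [mem_nhdsWithin_of_mem_nhds (Metric.ball_mem_nhds x hε)] with y hy
  exact of_segment (((convex_ball x ε).segment_subset (mem_ball_self hε) hy).trans hb)

/-- An arc from the center to the outside of an annulus contains a spanning arc. -/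
lemma exists_spanningArc {r R : ℝ} (hr : 0 < r) (hrR : r < R) {X : Set ℂ} {w : ℂ} (hw : R ≤ ‖w‖)
    (h : ArcIn X 0 w) : ∃ a, IsSpanningArc r R a ∧ a ⊆ X := by
  rcases h with ⟨rfl, -⟩ | ⟨f, hf, hfi, hf0, hf1, hfX⟩
  · rw [norm_zero] at hw; linarith
  have hn : Continuous fun t => ‖f t‖ := by fun_prop
  have hS : IsCompact {t : unitInterval | ‖f t‖ ≤ r} := (isClosed_le hn continuous_const).isCompact
  obtain ⟨s, hs, hsmax⟩ := hS.exists_isGreatest ⟨0, by simp [hf0, hr.le]⟩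
  have hT : IsCompact {t : unitInterval | s ≤ t ∧ R ≤ ‖f t‖} :=
    ((isClosed_le continuous_const continuous_id).inter
      (isClosed_le continuous_const hn)).isCompact
  obtain ⟨t, ht, htmin⟩ := hT.exists_isLeast ⟨1, ⟨unitInterval.le_one s, by simpa [hf1] using hw⟩⟩
  have hst : s ≤ t := ht.1
  have hs' : ‖f s‖ ≤ r := hs
  have hlt : s < t := lt_of_le_of_ne hst (by rintro rfl; linarith [ht.2])
  have hsr : ‖f s‖ = r := by
    refine le_antisymm hs' ?_
    by_contra hlt'
    push Not at hlt'
    obtain ⟨u, hu, hur⟩ := intermediate_value_Icc hst hn.continuousOn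
      (show r ∈ Icc ‖f s‖ ‖f t‖ from ⟨hs', by linarith [ht.2]⟩)
    have : u ≤ s := hsmax (show ‖f u‖ ≤ r from le_of_eq hur)
    have hus : u = s := le_antisymm this hu.1
    subst hus
    simp only at hur
    linarith
  have htR : ‖f t‖ = R := by
    refine le_antisymm ?_ ht.2
    by_contra hlt'
    push Not at hlt'
    obtain ⟨u, hu, hur⟩ := intermediate_value_Icc hst hn.continuousOn
      (show R ∈ Icc ‖f s‖ ‖f t‖ from ⟨by linarith, hlt'.le⟩)
    have : t ≤ u := htmin ⟨hu.1, le_of_eq hur.symm⟩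
    have hus : u = t := le_antisymm hu.2 this
    subst hus
    simp only at hur
    linarith
  rcases subarc hf hfi s t with ⟨he, -⟩ | ⟨g, hg, hgi, hg0, hg1, hgX⟩
  · exact absurd (hfi he) hlt.ne
  refine ⟨range g, ⟨g, hg, hgi, by rw [hg0, hsr], by rw [hg1, htR], rfl, ?_⟩,
    hgX.trans ((image_subset_range _ _).trans hfX)⟩
  refine hgX.trans ?_
  rintro _ ⟨u, hu, rfl⟩
  rw [uIcc_of_le hst] at hu
  constructor
  · rcases eq_or_lt_of_le hu.1 with h | h
    · rw [← h, hsr]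
    · by_contra h'
      push Not at h'
      exact absurd (hsmax (show ‖f u‖ ≤ r from h'.le)) (not_le.2 h)
  · rcases eq_or_lt_of_le hu.2 with h | h
    · rw [h, htR]
    · by_contra h'
      push Not at h'
      exact absurd (htmin ⟨hu.1, h'.le⟩) (not_le.2 h)

end ArcIn

/-- Any arc from the center of the annulus to its outside bounds the wrapping number. -/
lemma curveWrappingNumber_le {r R : ℝ} (hr : 0 < r) (hrR : r < R) {c : UnitAddCircle → ℂ}
    {X : Set ℂ} {w : ℂ} (hw : R ≤ ‖w‖) (h : ArcIn X 0 w) (hX : Disjoint X (multiplePoints c)) :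
    curveWrappingNumber r R c ≤ (X ∩ range c).encard := by
  obtain ⟨a, ha, haX⟩ := h.exists_spanningArc hr hrR hw
  have h1 : curveWrappingNumber r R c ≤ (a ∩ range c).encard :=
    sInf_le ⟨a, ha, hX.mono_left haX, rfl⟩
  exact h1.trans <| encard_le_encard (inter_subset_inter_left _ haX)

/-! ### Homeomorphisms of the plane that move points -/

/-- A small multiple of a Lipschitz bump, added to the identity, is a homeomorphism. -/
lemma exists_homeomorph_add_smul {lam : ℂ → ℝ} {k : NNReal} (hl : LipschitzWith k lam) {v : ℂ}
    (hv : k * ‖v‖ < 1) : ∃ φ : ℂ ≃ₜ ℂ, ∀ x, φ x = x + lam x • v := by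
  have happ : ApproximatesLinearOn (fun x => x + lam x • v)
      ((ContinuousLinearEquiv.refl ℝ ℂ : ℂ ≃L[ℝ] ℂ) : ℂ →L[ℝ] ℂ) univ (k * ‖v‖₊) := by
    intro x _ y _
    have : x + lam x • v - (y + lam y • v) -
        ((ContinuousLinearEquiv.refl ℝ ℂ : ℂ ≃L[ℝ] ℂ) : ℂ →L[ℝ] ℂ) (x - y) =
        (lam x - lam y) • v := by
      simp [sub_mul]; ring
    rw [this, norm_smul]
    have h1 := hl.dist_le_mul x y
    rw [dist_eq_norm, dist_eq_norm] at h1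
    calc ‖lam x - lam y‖ * ‖v‖ ≤ (k * ‖x - y‖) * ‖v‖ := by gcongr
      _ = _ := by push_cast; ring
  refine ⟨happ.toHomeomorph _ (Or.inr ?_), fun x => rfl⟩
  have h1 : ‖((ContinuousLinearEquiv.refl ℝ ℂ : ℂ ≃L[ℝ] ℂ).symm : ℂ →L[ℝ] ℂ)‖₊ = 1 := by
    apply NNReal.eq
    simp
  rw [h1, inv_one, ← NNReal.coe_lt_coe]
  simpa using hv

/-- A homeomorphism of the plane that is strictly differentiable with invertible derivatives. -/
def IsStrictDiffeo (φ : ℂ ≃ₜ ℂ) : Prop :=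
  ∀ x, ∃ e : ℂ ≃L[ℝ] ℂ, HasStrictFDerivAt φ (e : ℂ →L[ℝ] ℂ) x

lemma IsStrictDiffeo.trans {φ₁ φ₂ : ℂ ≃ₜ ℂ} (h₁ : IsStrictDiffeo φ₁) (h₂ : IsStrictDiffeo φ₂) :
    IsStrictDiffeo (φ₁.trans φ₂) := fun x => by
  obtain ⟨e₁, he₁⟩ := h₁ x
  obtain ⟨e₂, he₂⟩ := h₂ (φ₁ x)
  exact ⟨e₁.trans e₂, he₂.comp x he₁⟩

lemma IsStrictDiffeo.symm {φ : ℂ ≃ₜ ℂ} (h : IsStrictDiffeo φ) : IsStrictDiffeo φ.symm := fun x => by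
  obtain ⟨e, he⟩ := h (φ.symm x)
  exact ⟨e.symm, he.of_local_left_inverse φ.symm.continuous.continuousAt
    (Eventually.of_forall fun y => φ.apply_symm_apply y)⟩

/-- The homeomorphism `φ` is the identity outside a compact subset of `W`. -/
def IsSupportedIn (φ : ℂ ≃ₜ ℂ) (W : Set ℂ) : Prop :=
  ∃ C, IsCompact C ∧ C ⊆ W ∧ ∀ x ∉ C, φ x = x

namespace IsSupportedIn

variable {φ φ₁ φ₂ : ℂ ≃ₜ ℂ} {W W' : Set ℂ}

lemma apply_eq (h : IsSupportedIn φ W) {x : ℂ} (hx : x ∉ W) : φ x = x := by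
  obtain ⟨C, -, hC, hφ⟩ := h
  exact hφ x (fun h => hx (hC h))

lemma mem_iff (h : IsSupportedIn φ W) {x : ℂ} : φ x ∈ W ↔ x ∈ W := by
  constructor
  · intro hx
    by_contra hxW
    rw [h.apply_eq hxW] at hx
    exact hxW hx
  · intro hx
    by_contra hxW
    have h1 := h.apply_eq hxW
    have h2 := φ.injective h1
    rw [h2] at hxW
    exact hxW hx

lemma trans (h₁ : IsSupportedIn φ₁ W) (h₂ : IsSupportedIn φ₂ W) :
    IsSupportedIn (φ₁.trans φ₂) W := by
  obtain ⟨C, hC, hCW, hφ⟩ := h₁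
  obtain ⟨D, hD, hDW, hφ'⟩ := h₂
  refine ⟨C ∪ D, hC.union hD, union_subset hCW hDW, fun x hx => ?_⟩
  rw [mem_union, not_or] at hx
  simp [hφ x hx.1, hφ' x hx.2]

lemma symm (h : IsSupportedIn φ W) : IsSupportedIn φ.symm W := by
  obtain ⟨C, hC, hCW, hφ⟩ := h
  exact ⟨C, hC, hCW, fun x hx => by rw [φ.symm_apply_eq, hφ x hx]⟩

lemma mono (h : IsSupportedIn φ W) (hW : W ⊆ W') : IsSupportedIn φ W' := by
  obtain ⟨C, hC, hCW, hφ⟩ := h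
  exact ⟨C, hC, hCW.trans hW, hφ⟩

/-- A supported homeomorphism is the identity near every point outside the support region. -/
lemma eventually_eq (h : IsSupportedIn φ W) {x : ℂ} (hx : x ∉ W) : ∀ᶠ y in 𝓝 x, φ y = y := by
  obtain ⟨C, hC, hCW, hφ⟩ := h
  filter_upwards [hC.isClosed.isOpen_compl.mem_nhds (fun h => hx (hCW h))] with y hy
  exact hφ y hy

end IsSupportedIn

/-- The point `p` can be moved to `q` by a strict diffeomorphism of the plane that is supported in
`W` and is a translation near `p`. -/
def Movable (W : Set ℂ) (p q : ℂ) : Prop :=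
  ∃ φ : ℂ ≃ₜ ℂ, IsStrictDiffeo φ ∧ IsSupportedIn φ W ∧ ∃ ε > 0, ∀ v, ‖v‖ < ε → φ (p + v) = q + v

lemma Movable.symm {W : Set ℂ} {p q : ℂ} (h : Movable W p q) : Movable W q p := by
  obtain ⟨φ, h1, h2, ε, hε, h3⟩ := h
  exact ⟨φ.symm, h1.symm, h2.symm, ε, hε, fun v hv => by rw [φ.symm_apply_eq, h3 v hv]⟩

lemma Movable.trans {W : Set ℂ} {p q u : ℂ} (h : Movable W p q) (h' : Movable W q u) :
    Movable W p u := by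
  obtain ⟨φ, h1, h2, ε, hε, h3⟩ := h
  obtain ⟨φ', h1', h2', ε', hε', h3'⟩ := h'
  refine ⟨φ.trans φ', h1.trans h1', h2.trans h2', min ε ε', lt_min hε hε', fun v hv => ?_⟩
  rw [lt_min_iff] at hv
  simp [h3 v hv.1, h3' v hv.2]

lemma Movable.eventually {W : Set ℂ} (hW : IsOpen W) {p : ℂ} (hp : p ∈ W) :
    ∀ᶠ q in 𝓝 p, Movable W p q := by
  obtain ⟨ε, hε, hb⟩ := Metric.nhds_basis_closedBall.mem_iff.1 (hW.mem_nhds hp)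
  let f : ContDiffBump p := ⟨ε / 2, ε, half_pos hε, half_lt_self hε⟩
  have hfc : ContDiff ℝ 1 f := f.contDiff
  obtain ⟨k, hk⟩ := hfc.lipschitzWith_of_hasCompactSupport f.hasCompactSupport one_ne_zero
  have hev : ∀ᶠ q in 𝓝 p, (k : ℝ) * ‖q - p‖ < 1 := by
    have : ContinuousAt (fun q : ℂ => (k : ℝ) * ‖q - p‖) p := by fun_prop
    exact this.eventually_lt continuousAt_const (by simp)
  filter_upwards [hev] with q hq
  obtain ⟨φ, hφ⟩ := exists_homeomorph_add_smul hk hq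
  refine ⟨φ, fun x => ?_, ⟨closedBall p ε, isCompact_closedBall p ε, hb, fun x hx => ?_⟩,
    ε / 2, half_pos hε, fun v hv => ?_⟩
  · set t : ℂ →L[ℝ] ℂ := -((fderiv ℝ f x).smulRight (q - p)) with ht
    have hnt : ‖t‖ < 1 := by
      rw [ht, norm_neg, ContinuousLinearMap.norm_smulRight_apply]
      refine lt_of_le_of_lt ?_ hq
      gcongr
      exact norm_fderiv_le_of_lipschitz ℝ hk
    refine ⟨ContinuousLinearEquiv.unitsEquiv ℝ ℂ (Units.oneSub t hnt), ?_⟩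
    have h1 : HasStrictFDerivAt (fun x => x + f x • (q - p))
        (ContinuousLinearMap.id ℝ ℂ + (fderiv ℝ f x).smulRight (q - p)) x := by
      refine (hasStrictFDerivAt_id x).add ?_
      exact (hfc.contDiffAt.hasStrictFDerivAt one_ne_zero).smul_const (q - p)
    have h2 : (φ : ℂ → ℂ) = fun x => x + f x • (q - p) := funext hφ
    rw [h2]
    convert h1 using 1
    ext y; simp [ht, Units.oneSub]
  · rw [hφ, f.zero_of_le_dist (by
      rw [mem_closedBall, not_le] at hx
      exact hx.le)]
    simp
  · rw [hφ, f.one_of_mem_closedBall (by simpa [f] using hv.le), one_smul]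
    ring

/-- Any two points of an open connected region can be moved into each other. -/
lemma Movable.of_conn {W : Set ℂ} (hW : IsOpen W) {p q : ℂ} (h : Conn W p q) : Movable W p q := by
  obtain ⟨C, hC, hCp, hp, hq⟩ := h
  refine hCp.induction₂ (Movable W) (fun x hx => ?_) (fun _ _ _ _ _ _ => Movable.trans)
    (fun _ _ _ _ => Movable.symm) hp hq
  exact mem_nhdsWithin_of_mem_nhds (Movable.eventually hW (hC hx))

/-! ### Gates: charts around simple regular points of a curve -/

lemma exists_frame_equiv {d a : ℂ} (hd : d ≠ 0) (h : (a / d).re ≠ 0) :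
    ∃ e : (ℝ × ℝ) ≃L[ℝ] ℂ, (e : ℝ × ℝ →L[ℝ] ℂ) = (ContinuousLinearMap.fst ℝ ℝ ℝ).smulRight a +
      (ContinuousLinearMap.snd ℝ ℝ ℝ).smulRight (Complex.I * d) := by
  set L : ℝ × ℝ →L[ℝ] ℂ := (ContinuousLinearMap.fst ℝ ℝ ℝ).smulRight a +
      (ContinuousLinearMap.snd ℝ ℝ ℝ).smulRight (Complex.I * d) with hL
  have hinj : Function.Injective (L : ℝ × ℝ →ₗ[ℝ] ℂ) := by
    rw [← LinearMap.ker_eq_bot, LinearMap.ker_eq_bot']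
    rintro ⟨x, y⟩ hxy
    have h1 : (x : ℂ) * a + y * (Complex.I * d) = 0 := by simpa [hL] using hxy
    have h2 : (x : ℂ) * (a / d) + y * Complex.I = 0 := by
      field_simp
      linear_combination h1
    have h3 := congrArg Complex.re h2
    have h4 := congrArg Complex.im h2
    simp only [Complex.add_re, Complex.re_ofReal_mul, Complex.I_re, mul_zero, add_zero,
      Complex.zero_re, mul_eq_zero, h, or_false] at h3
    subst h3
    simp at h4
    simp [h4]
  refine ⟨(LinearEquiv.ofInjectiveOfFinrankEq (L : ℝ × ℝ →ₗ[ℝ] ℂ) hinj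
    (by simp)).toContinuousLinearEquiv, ?_⟩
  ext <;> rfl

/-- The open box of half width `δ` around `(s₀, 0)`, in the chart `Γ`. -/
def gateBox (Γ : OpenPartialHomeomorph (ℝ × ℝ) ℂ) (s₀ δ : ℝ) : Set ℂ :=
  Γ '' (Ioo (s₀ - δ) (s₀ + δ) ×ˢ Ioo (-δ) δ)

/-- The part of the box on the side of the curve that is selected by the sign of `σ`. -/
def gateSide (Γ : OpenPartialHomeomorph (ℝ × ℝ) ℂ) (s₀ δ σ : ℝ) : Set ℂ :=
  Γ '' (Ioo (s₀ - δ) (s₀ + δ) ×ˢ {y | y ∈ Ioo (-δ) δ ∧ 0 < σ * y})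

/-- A gate of a closed curve `c` at the parameter `s₀`: a chart `Γ` of the plane, defined on a box
around `(s₀, 0)`, in which `c` is the horizontal axis, traversed once and without double points. -/
structure IsGate (c : UnitAddCircle → ℂ) (s₀ δ : ℝ) (Γ : OpenPartialHomeomorph (ℝ × ℝ) ℂ) :
    Prop where
  pos : 0 < δ
  box : Ioo (s₀ - δ) (s₀ + δ) ×ˢ Ioo (-δ) δ ⊆ Γ.source
  curve : ∀ s ∈ Ioo (s₀ - δ) (s₀ + δ), Γ (s, 0) = c s
  only : ∀ t : UnitAddCircle, c t ∈ gateBox Γ s₀ δ →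
    ∃ s ∈ Ioo (s₀ - δ) (s₀ + δ), (s : UnitAddCircle) = t
  strict : ∀ s ∈ Ioo (s₀ - δ) (s₀ + δ), ∃ e : (ℝ × ℝ) ≃L[ℝ] ℂ,
    HasStrictFDerivAt Γ (e : ℝ × ℝ →L[ℝ] ℂ) (s, 0)
  simple : ∀ s ∈ Ioo (s₀ - δ) (s₀ + δ), c s ∉ multiplePoints c

lemma multiplePoints_comp {c : UnitAddCircle → ℂ} (φ : ℂ ≃ₜ ℂ) :
    multiplePoints (φ ∘ c) = φ '' multiplePoints c := by
  ext x
  constructor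
  · rintro ⟨s, t, hst, h1, h2⟩
    refine ⟨c s, ⟨s, t, hst, rfl, ?_⟩, h1⟩
    exact φ.injective (h2.trans h1.symm)
  · rintro ⟨_, ⟨s, t, hst, rfl, h2⟩, rfl⟩
    exact ⟨s, t, hst, rfl, by simp [h2]⟩

namespace IsGate

variable {c : UnitAddCircle → ℂ} {s₀ δ : ℝ} {Γ : OpenPartialHomeomorph (ℝ × ℝ) ℂ}

lemma zero_mem (G : IsGate c s₀ δ Γ) : (0 : ℝ) ∈ Ioo (-δ) δ := by
  have := G.pos
  constructor <;> linarith

lemma center_mem (G : IsGate c s₀ δ Γ) : s₀ ∈ Ioo (s₀ - δ) (s₀ + δ) := by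
  have := G.pos
  constructor <;> linarith

lemma curve_mem_box (G : IsGate c s₀ δ Γ) {s : ℝ} (hs : s ∈ Ioo (s₀ - δ) (s₀ + δ)) :
    c s ∈ gateBox Γ s₀ δ := ⟨(s, 0), ⟨hs, G.zero_mem⟩, G.curve s hs⟩

lemma isOpen_box (G : IsGate c s₀ δ Γ) : IsOpen (gateBox Γ s₀ δ) :=
  Γ.isOpen_image_of_subset_source (isOpen_Ioo.prod isOpen_Ioo) G.box

lemma isPreconnected_box (G : IsGate c s₀ δ Γ) : IsPreconnected (gateBox Γ s₀ δ) :=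
  (isPreconnected_Ioo.prod isPreconnected_Ioo).image _ (Γ.continuousOn.mono G.box)

lemma side_subset_box (Γ : OpenPartialHomeomorph (ℝ × ℝ) ℂ) (s₀ δ σ : ℝ) :
    gateSide Γ s₀ δ σ ⊆ gateBox Γ s₀ δ :=
  image_mono (prod_mono_right fun _ h => h.1)

lemma isPreconnected_side (G : IsGate c s₀ δ Γ) (σ : ℝ) : IsPreconnected (gateSide Γ s₀ δ σ) := by
  have hconv : Convex ℝ {y : ℝ | y ∈ Ioo (-δ) δ ∧ 0 < σ * y} := by
    refine (convex_Ioo (-δ) δ).inter ?_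
    exact convex_halfSpace_gt (f := fun y : ℝ => σ * y)
      (IsLinearMap.mk (by intro x y; ring) (by intro k x; simp only [smul_eq_mul]; ring)) 0
  refine (isPreconnected_Ioo.prod hconv.isPreconnected).image _ (Γ.continuousOn.mono ?_)
  exact (prod_mono_right fun _ h => h.1).trans G.box

lemma side_disjoint (G : IsGate c s₀ δ Γ) (σ : ℝ) : gateSide Γ s₀ δ σ ⊆ (range c)ᶜ := by
  rintro _ ⟨⟨s, y⟩, ⟨hs, hy, hσ⟩, rfl⟩ ⟨t, ht⟩
  obtain ⟨s', hs', rfl⟩ := G.only t (ht ▸ ⟨(s, y), ⟨hs, hy⟩, rfl⟩)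
  rw [← G.curve s' hs'] at ht
  have h1 := Γ.injOn (G.box ⟨hs', G.zero_mem⟩) (G.box ⟨hs, hy⟩) ht
  have h2 : (0 : ℝ) = y := congrArg Prod.snd h1
  rw [← h2, mul_zero] at hσ
  exact lt_irrefl _ hσ

lemma box_subset (G : IsGate c s₀ δ Γ) :
    gateBox Γ s₀ δ ⊆ gateSide Γ s₀ δ 1 ∪ gateSide Γ s₀ δ (-1) ∪ range c := by
  rintro _ ⟨⟨s, y⟩, ⟨hs, hy⟩, rfl⟩
  rcases lt_trichotomy y 0 with h | h | h
  · exact Or.inl (Or.inr ⟨(s, y), ⟨hs, hy, by simpa using h⟩, rfl⟩)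
  · subst h
    exact Or.inr ⟨s, (G.curve s hs).symm⟩
  · exact Or.inl (Or.inl ⟨(s, y), ⟨hs, hy, by simpa using h⟩, rfl⟩)

/-- Points on the same side of a gate are connected in the complement of the curve. -/
lemma conn_side (G : IsGate c s₀ δ Γ) {σ : ℝ} {p q : ℂ} (hp : p ∈ gateSide Γ s₀ δ σ)
    (hq : q ∈ gateSide Γ s₀ δ σ) : Conn (range c)ᶜ p q :=
  Conn.of_preconnected (G.isPreconnected_side σ) (G.side_disjoint σ) hp hq

lemma gateBox_trans (Γ : OpenPartialHomeomorph (ℝ × ℝ) ℂ) (s₀ δ : ℝ) (φ : ℂ ≃ₜ ℂ) :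
    gateBox (Γ.transHomeomorph φ) s₀ δ = φ '' gateBox Γ s₀ δ := by
  simp [gateBox, image_image]

lemma gateSide_trans (Γ : OpenPartialHomeomorph (ℝ × ℝ) ℂ) (s₀ δ σ : ℝ) (φ : ℂ ≃ₜ ℂ) :
    gateSide (Γ.transHomeomorph φ) s₀ δ σ = φ '' gateSide Γ s₀ δ σ := by
  simp [gateSide, image_image]

/-- Strict diffeomorphisms of the plane carry gates to gates. -/
lemma comp (G : IsGate c s₀ δ Γ) {φ : ℂ ≃ₜ ℂ} (hφ : IsStrictDiffeo φ) :
    IsGate (φ ∘ c) s₀ δ (Γ.transHomeomorph φ) where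
  pos := G.pos
  box := G.box
  curve s hs := by simp [G.curve s hs]
  only t ht := by
    rw [gateBox_trans] at ht
    obtain ⟨z, hz, hzt⟩ := ht
    exact G.only t (φ.injective hzt ▸ hz)
  strict s hs := by
    obtain ⟨e, he⟩ := G.strict s hs
    obtain ⟨e', he'⟩ := hφ (Γ (s, 0))
    exact ⟨e.trans e', he'.comp _ he⟩
  simple s hs h := by
    rw [multiplePoints_comp] at h
    obtain ⟨z, hz, hzt⟩ := h
    exact G.simple s hs (φ.injective hzt ▸ hz)

lemma hasStrictDerivAt (G : IsGate c s₀ δ Γ) {s : ℝ} (hs : s ∈ Ioo (s₀ - δ) (s₀ + δ)) :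
    ∃ v : ℂ, v ≠ 0 ∧ HasStrictDerivAt (fun u : ℝ => c u) v s := by
  obtain ⟨e, he⟩ := G.strict s hs
  refine ⟨e (1, 0), fun h => ?_, ?_⟩
  · have := e.map_eq_zero_iff.1 h
    simp at this
  · have h1 : HasStrictDerivAt (fun u : ℝ => ((u, 0) : ℝ × ℝ)) (1, 0) s :=
      (hasStrictDerivAt_id s).prodMk (hasStrictDerivAt_const s 0)
    have h2 : HasStrictDerivAt (fun u : ℝ => Γ (u, 0)) (e (1, 0)) s :=
      HasStrictFDerivAt.comp_hasStrictDerivAt (f := fun u : ℝ => ((u, 0) : ℝ × ℝ)) s he h1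
    refine h2.congr_of_eventuallyEq ?_
    filter_upwards [isOpen_Ioo.mem_nhds hs] with u hu
    exact G.curve u hu

/-- At a point of the gate where the curve is not horizontal, the two horizontal directions point
to the two sides. -/
lemma exists_sides (G : IsGate c s₀ δ Γ) {s : ℝ} (hs : s ∈ Ioo (s₀ - δ) (s₀ + δ)) {v : ℂ}
    (hv : HasStrictDerivAt (fun u : ℝ => c u) v s) (hvim : v.im ≠ 0) :
    ∃ σ : ℝ, (σ = 1 ∨ σ = -1) ∧ ∀ᶠ ε : ℝ in 𝓝[>] 0,
      c s - ε ∈ gateSide Γ s₀ δ σ ∧ c s + ε ∈ gateSide Γ s₀ δ (-σ) := by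
  obtain ⟨e, he⟩ := G.strict s hs
  have hsrc : (s, (0 : ℝ)) ∈ Γ.source := G.box ⟨hs, G.zero_mem⟩
  have hve : v = e (1, 0) := by
    have h1 : HasStrictDerivAt (fun u : ℝ => ((u, 0) : ℝ × ℝ)) (1, 0) s :=
      (hasStrictDerivAt_id s).prodMk (hasStrictDerivAt_const s 0)
    have h2 : HasStrictDerivAt (fun u : ℝ => Γ (u, 0)) (e (1, 0)) s :=
      HasStrictFDerivAt.comp_hasStrictDerivAt (f := fun u : ℝ => ((u, 0) : ℝ × ℝ)) s he h1
    refine hv.hasDerivAt.unique (h2.hasDerivAt.congr_of_eventuallyEq ?_)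
    filter_upwards [isOpen_Ioo.mem_nhds hs] with u hu
    exact (G.curve u hu).symm
  have hcs : Γ (s, 0) = c s := G.curve s hs
  have htgt : c s ∈ Γ.target := hcs ▸ Γ.map_source hsrc
  have hsymm : Γ.symm (c s) = (s, 0) := by rw [← hcs, Γ.left_inv hsrc]
  have hinv : HasStrictFDerivAt Γ.symm (e.symm : ℂ →L[ℝ] ℝ × ℝ) (c s) :=
    Γ.hasStrictFDerivAt_symm htgt (by rw [hsymm]; exact he)
  set α : ℝ := (e.symm 1).2 with hα
  have hα0 : α ≠ 0 := by
    intro h0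
    have h1 : e.symm 1 = (e.symm 1).1 • ((1, 0) : ℝ × ℝ) := by
      ext <;> simp [← hα, h0]
    have h2 := congrArg e h1
    rw [e.apply_symm_apply, map_smul, ← hve] at h2
    have h3 := congrArg Complex.im h2
    simp only [Complex.one_im, Complex.real_smul, Complex.im_ofReal_mul] at h3
    rcases mul_eq_zero.1 h3.symm with h | h
    · rw [h] at h2; simp at h2
    · exact hvim h
  let k : ℝ → ℝ := fun ε => (Γ.symm (c s + ε)).2
  have hk : HasDerivAt k α 0 := by
    have h1 : HasDerivAt (fun ε : ℝ => c s + (ε : ℂ)) 1 0 := by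
      simpa using (Complex.ofRealCLM.hasDerivAt (x := (0 : ℝ))).const_add (c s)
    have h2 : HasFDerivAt Γ.symm (e.symm : ℂ →L[ℝ] ℝ × ℝ) (c s + ((0 : ℝ) : ℂ)) := by
      simpa using hinv.hasFDerivAt
    have h3 := h2.comp_hasDerivAt (0 : ℝ) h1
    exact h3.snd
  have hk0 : k 0 = 0 := by simp [k, hsymm]
  have hsl := hasDerivAt_iff_tendsto_slope.1 hk
  have hpos : ∀ᶠ ε in 𝓝[≠] (0 : ℝ), 0 < α * (k ε / ε) := by
    have : Tendsto (fun ε => α * slope k 0 ε) (𝓝[≠] 0) (𝓝 (α * α)) := hsl.const_mul α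
    filter_upwards [this.eventually_const_lt (mul_self_pos.2 hα0)] with ε hε
    rw [slope_def_field, hk0, sub_zero, sub_zero] at hε
    exact hε
  have hev : ∀ᶠ ε : ℝ in 𝓝 (0 : ℝ), c s + (ε : ℂ) ∈ Γ.target ∧
      Γ.symm (c s + ε) ∈ Ioo (s₀ - δ) (s₀ + δ) ×ˢ Ioo (-δ) δ := by
    have hcont : ContinuousAt (fun ε : ℝ => c s + (ε : ℂ)) 0 := by fun_prop
    have h0 : c s + ((0 : ℝ) : ℂ) = c s := by simp
    refine (hcont.eventually_mem ?_).and
      (ContinuousAt.eventually_mem (f := fun ε : ℝ => Γ.symm (c s + ε)) ?_ ?_)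
    · rw [h0]; exact Γ.open_target.mem_nhds htgt
    · exact ContinuousAt.comp (by rw [h0]; exact Γ.continuousAt_symm htgt) hcont
    · simp only [h0, hsymm]
      exact (isOpen_Ioo.prod isOpen_Ioo).mem_nhds ⟨hs, G.zero_mem⟩
  have hmem : ∀ ε : ℝ, ∀ τ : ℝ, (c s + (ε : ℂ) ∈ Γ.target ∧
      Γ.symm (c s + ε) ∈ Ioo (s₀ - δ) (s₀ + δ) ×ˢ Ioo (-δ) δ) → 0 < τ * k ε →
      c s + (ε : ℂ) ∈ gateSide Γ s₀ δ τ := by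
    intro ε τ h1 h2
    exact ⟨Γ.symm (c s + ε), ⟨h1.2.1, h1.2.2, h2⟩, Γ.right_inv h1.1⟩
  have hpos' : ∀ᶠ ε in 𝓝[>] (0 : ℝ), 0 < α * k ε ∧ α * k (-ε) < 0 := by
    have h1 : ∀ᶠ ε in 𝓝[>] (0 : ℝ), 0 < α * (k ε / ε) :=
      hpos.filter_mono (nhdsWithin_mono _ fun x hx => ne_of_gt hx)
    have hneg : Tendsto (fun ε : ℝ => -ε) (𝓝[>] 0) (𝓝[≠] 0) := by
      refine tendsto_nhdsWithin_iff.2 ⟨?_, ?_⟩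
      · have : Tendsto (fun ε : ℝ => -ε) (𝓝 0) (𝓝 0) := by
          simpa using (continuous_neg (G := ℝ)).tendsto 0
        exact this.mono_left nhdsWithin_le_nhds
      · filter_upwards [self_mem_nhdsWithin] with ε hε
        have : (0 : ℝ) < ε := hε
        simpa using this.ne'
    filter_upwards [h1, hneg.eventually hpos, self_mem_nhdsWithin] with ε ha hb hε
    have hε' : (0 : ℝ) < ε := hε
    constructor
    · have : α * k ε = (α * (k ε / ε)) * ε := by field_simp
      rw [this]; positivity
    · have : α * k (-ε) = -((α * (k (-ε) / -ε)) * ε) := by field_simp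
      rw [this]
      have := mul_pos hb hε'
      linarith
  have hev1 := hev.filter_mono (nhdsWithin_le_nhds (s := Ioi 0))
  have hev2 : ∀ᶠ ε : ℝ in 𝓝[>] (0 : ℝ), c s + ((-ε : ℝ) : ℂ) ∈ Γ.target ∧
      Γ.symm (c s + ((-ε : ℝ) : ℂ)) ∈ Ioo (s₀ - δ) (s₀ + δ) ×ˢ Ioo (-δ) δ := by
    have : Tendsto (fun ε : ℝ => -ε) (𝓝 0) (𝓝 0) := by
      simpa using (continuous_neg (G := ℝ)).tendsto 0
    exact (this.eventually hev).filter_mono nhdsWithin_le_nhds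
  rcases lt_or_gt_of_ne hα0 with hαn | hαp
  · refine ⟨1, Or.inl rfl, ?_⟩
    filter_upwards [hpos', hev1, hev2] with ε h1 h2 h3
    constructor
    · have := hmem (-ε) 1 h3 (by nlinarith [h1.2])
      simpa [sub_eq_add_neg] using this
    · exact hmem ε (-1) h2 (by nlinarith [h1.1])
  · refine ⟨-1, Or.inr rfl, ?_⟩
    filter_upwards [hpos', hev1, hev2] with ε h1 h2 h3
    constructor
    · have := hmem (-ε) (-1) h3 (by nlinarith [h1.2])
      simpa [sub_eq_add_neg] using this
    · exact hmem ε (- -1) h2 (by nlinarith [h1.1])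

end IsGate

/-- The real function `g` is strictly increasing or strictly decreasing on `I`, which is a small
interval around a point in the applications. -/
def MonotoneNear (g : ℝ → ℝ) (I : Set ℝ) : Prop := StrictMonoOn g I ∨ StrictAntiOn g I

lemma exists_strictMono_near {g : ℝ → ℝ} {v s : ℝ} (hg : HasStrictDerivAt g v s) (hv : v ≠ 0) :
    ∃ ε > 0, MonotoneNear g (Ioo (s - ε) (s + ε)) := by
  have h1 : ∀ᶠ p : ℝ × ℝ in 𝓝 (s, s), ‖g p.1 - g p.2 - (p.1 - p.2) • v‖ ≤ |v| / 2 * ‖p.1 - p.2‖ :=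
    hg.hasStrictFDerivAt.isLittleO.def (by positivity)
  obtain ⟨ε, hε, hb⟩ := Metric.eventually_nhds_iff_ball.1 h1
  have key : ∀ x ∈ Ioo (s - ε) (s + ε), ∀ y ∈ Ioo (s - ε) (s + ε), x < y →
      |g y - g x - (y - x) * v| ≤ |v| / 2 * (y - x) := by
    intro x hx y hy hxy
    have := hb (y, x) (by
      rw [← ball_prod_same, Real.ball_eq_Ioo]; exact ⟨hy, hx⟩)
    simp only [smul_eq_mul, Real.norm_eq_abs] at this
    rwa [abs_of_pos (sub_pos.2 hxy)] at this
  refine ⟨ε, hε, ?_⟩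
  rcases lt_or_gt_of_ne hv with hvn | hvp
  · right
    intro x hx y hy hxy
    have h2 := (abs_le.1 (key x hx y hy hxy)).2
    rw [abs_of_neg hvn] at h2
    have : 0 < (y - x) * (-v) := mul_pos (sub_pos.2 hxy) (by linarith)
    nlinarith
  · left
    intro x hx y hy hxy
    have h2 := (abs_le.1 (key x hx y hy hxy)).1
    rw [abs_of_pos hvp] at h2
    have : 0 < (y - x) * v := mul_pos (sub_pos.2 hxy) hvp
    nlinarith

/-- Near a point of a gate where the curve is not horizontal, every horizontal line meets the
curve at most once. -/
lemma IsGate.exists_ball {c : UnitAddCircle → ℂ} {s₀ δ : ℝ} {Γ : OpenPartialHomeomorph (ℝ × ℝ) ℂ}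
    (G : IsGate c s₀ δ Γ) {s : ℝ} (hs : s ∈ Ioo (s₀ - δ) (s₀ + δ)) {v : ℂ}
    (hv : HasStrictDerivAt (fun u : ℝ => c u) v s) (hvim : v.im ≠ 0) :
    ∃ ρ > 0, ∃ ε > 0, MonotoneNear (fun u : ℝ => (c u).im) (Ioo (s - ε) (s + ε)) ∧
      ∀ t : UnitAddCircle, c t ∈ ball (c s) ρ →
        ∃ u ∈ Ioo (s - ε) (s + ε), (u : UnitAddCircle) = t := by
  have him : HasStrictDerivAt (fun u : ℝ => (c u).im) v.im s :=
    Complex.imCLM.hasStrictFDerivAt.comp_hasStrictDerivAt s hv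
  obtain ⟨ε, hε, hmono⟩ := exists_strictMono_near him hvim
  have hsrc : (s, (0 : ℝ)) ∈ Γ.source := G.box ⟨hs, G.zero_mem⟩
  have hcs : Γ (s, 0) = c s := G.curve s hs
  have htgt : c s ∈ Γ.target := hcs ▸ Γ.map_source hsrc
  have hsymm : Γ.symm (c s) = (s, 0) := by rw [← hcs, Γ.left_inv hsrc]
  have h1 : ∀ᶠ z in 𝓝 (c s), (Γ.symm z).1 ∈ Ioo (s - ε) (s + ε) := by
    have : ContinuousAt (fun z => (Γ.symm z).1) (c s) :=
      (Γ.continuousAt_symm htgt).fst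
    refine this.eventually_mem (isOpen_Ioo.mem_nhds ?_)
    rw [hsymm]; constructor <;> simp [hε]
  have h2 : ∀ᶠ z in 𝓝 (c s), z ∈ gateBox Γ s₀ δ := G.isOpen_box.mem_nhds (G.curve_mem_box hs)
  obtain ⟨ρ, hρ, hb⟩ := Metric.eventually_nhds_iff_ball.1 (h1.and h2)
  refine ⟨ρ, hρ, ε, hε, hmono, fun t ht => ?_⟩
  obtain ⟨h3, h4⟩ := hb _ ht
  obtain ⟨u, hu, rfl⟩ := G.only t h4
  rw [← G.curve u hu, Γ.left_inv (G.box ⟨hu, G.zero_mem⟩)] at h3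
  exact ⟨u, h3, rfl⟩

/-- If two points are connected through an open gate but not without it, then they lie in front of
opposite sides of the gate. -/
lemma conn_or_split {W Q A B : Set ℂ} (hW : IsOpen W) (hQ : IsOpen Q) (hA : IsPreconnected A)
    (hAW : A ⊆ W) (hB : IsPreconnected B) (hBW : B ⊆ W) (hQs : Q ⊆ A ∪ B ∪ Wᶜ) {a b : ℂ}
    (ha : a ∈ W) (hb : b ∈ W) (h : Conn (W ∪ Q) a b) :
    Conn W a b ∨ (∃ p ∈ A, ∃ q ∈ B, Conn W a p ∧ Conn W q b) ∨
      (∃ p ∈ B, ∃ q ∈ A, Conn W a p ∧ Conn W q b) := by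
  by_cases hab : Conn W a b
  · exact Or.inl hab
  right
  have key : ∀ a b : ℂ, a ∈ W → b ∈ W → ¬ Conn W a b → Conn (W ∪ Q) a b →
      (∃ p ∈ A, Conn W a p) ∨ ∃ p ∈ B, Conn W a p := by
    intro a b ha hb hab h
    by_contra hno
    push Not at hno
    obtain ⟨C, hC, hCp, haC, hbC⟩ := h
    set U := connectedComponentIn W a with hU
    have hUo : IsOpen U := hW.connectedComponentIn
    have hUQ : Disjoint U Q := by
      rw [Set.disjoint_left]
      intro z hz hzQ
      rcases hQs hzQ with (h | h) | h
      · exact hno.1 z h (Conn.of_mem_component hz)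
      · exact hno.2 z h (Conn.of_mem_component hz)
      · exact h (connectedComponentIn_subset W a hz)
    have hV : IsOpen (W \ U) := by
      rw [isOpen_iff_mem_nhds]
      rintro z ⟨hzW, hzU⟩
      refine mem_of_superset ((hW.connectedComponentIn (x := z)).mem_nhds
        (mem_connectedComponentIn hzW)) ?_
      intro y hy
      refine ⟨connectedComponentIn_subset W z hy, fun hyU => hzU ?_⟩
      exact ((Conn.of_mem_component hyU).trans (Conn.of_mem_component hy).symm).mem_component
    obtain ⟨z, -, hz1, hz2⟩ := hCp U ((W \ U) ∪ Q) hUo (hV.union hQ)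
      (by
        intro z hz
        rcases hC hz with h | h
        · by_cases hzU : z ∈ U
          · exact Or.inl hzU
          · exact Or.inr (Or.inl ⟨h, hzU⟩)
        · exact Or.inr (Or.inr h))
      ⟨a, haC, mem_connectedComponentIn ha⟩
      ⟨b, hbC, Or.inl ⟨hb, fun hbU => hab (Conn.of_mem_component hbU)⟩⟩
    rcases hz2 with h | h
    · exact h.2 hz1
    · exact Set.disjoint_left.1 hUQ hz1 h
  have h1 := key a b ha hb hab h
  have h2 := key b a hb ha (fun h => hab h.symm) h.symm
  rcases h1 with ⟨p, hp, hap⟩ | ⟨p, hp, hap⟩ <;> rcases h2 with ⟨q, hq, hbq⟩ | ⟨q, hq, hbq⟩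
  · exact absurd ((hap.trans (Conn.of_preconnected hA hAW hp hq)).trans hbq.symm) hab
  · exact Or.inl ⟨p, hp, q, hq, hap, hbq.symm⟩
  · exact Or.inr ⟨p, hp, q, hq, hap, hbq.symm⟩
  · exact absurd ((hap.trans (Conn.of_preconnected hB hBW hp hq)).trans hbq.symm) hab

/-- Arbitrarily small gates exist at simple points where the curve is smooth with nonzero
velocity. -/
lemma exists_gate {c : UnitAddCircle → ℂ} (hc : Continuous c) {s₀ : ℝ}
    (hsm : ContDiffAt ℝ 1 (fun u : ℝ => c u) s₀) (hd : deriv (fun u : ℝ => c u) s₀ ≠ 0)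
    (hfin : (multiplePoints c).Finite) (hs₀ : c s₀ ∉ multiplePoints c) {O : Set ℂ}
    (hO : O ∈ 𝓝 (c s₀)) {η : ℝ} (hη : 0 < η) :
    ∃ δ Γ, δ ≤ η ∧ IsGate c s₀ δ Γ ∧ gateBox Γ s₀ δ ⊆ O := by
  set g : ℝ → ℂ := fun u => c u with hg
  have hgc : Continuous g := hc.comp (AddCircle.continuous_mk' 1)
  set d := deriv g s₀ with hdd
  let F : ℝ × ℝ → ℂ := fun p => g p.1 + p.2 • (Complex.I * d)
  have hFc : Continuous F := by fun_prop
  have hstr : ∀ s y : ℝ, ContDiffAt ℝ 1 g s → (deriv g s / d).re ≠ 0 →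
      ∃ e : (ℝ × ℝ) ≃L[ℝ] ℂ, HasStrictFDerivAt F (e : ℝ × ℝ →L[ℝ] ℂ) (s, y) := by
    intro s y hs hre
    obtain ⟨e, he⟩ := exists_frame_equiv hd hre
    refine ⟨e, ?_⟩
    rw [he]
    have h1 : HasStrictFDerivAt g (ContinuousLinearMap.toSpanSingleton ℝ (deriv g s)) s :=
      (hs.hasStrictDerivAt one_ne_zero).hasStrictFDerivAt
    have h2 : HasStrictFDerivAt (fun p : ℝ × ℝ => g p.1)
        ((ContinuousLinearMap.toSpanSingleton ℝ (deriv g s)).comp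
          (ContinuousLinearMap.fst ℝ ℝ ℝ)) (s, y) :=
      HasStrictFDerivAt.comp (f := fun p : ℝ × ℝ => p.1) (s, y) h1 hasStrictFDerivAt_fst
    have h3 : HasStrictFDerivAt (fun p : ℝ × ℝ => p.2 • (Complex.I * d))
        ((ContinuousLinearMap.snd ℝ ℝ ℝ).smulRight (Complex.I * d)) (s, y) :=
      (hasStrictFDerivAt_snd (𝕜 := ℝ) (p := ((s, y) : ℝ × ℝ))).smul_const (Complex.I * d)
    refine (h2.add h3).congr_fderiv ?_
    ext <;> simp
  have hdd1 : (deriv g s₀ / d).re ≠ 0 := by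
    rw [← hdd, div_self hd]; simp
  obtain ⟨e, he⟩ := hstr s₀ 0 hsm hdd1
  let Γ := he.toOpenPartialHomeomorph F
  have hΓ : ∀ p, Γ p = F p := fun p => rfl
  have hsrc : ((s₀, 0) : ℝ × ℝ) ∈ Γ.source := he.mem_toOpenPartialHomeomorph_source
  have hΓ0 : ∀ s, Γ (s, 0) = c s := by intro s; simp [hΓ, F, hg]
  have hev : ∀ᶠ s in 𝓝 s₀, ContDiffAt ℝ 1 g s ∧ (deriv g s / d).re ≠ 0 ∧
      c s ∉ multiplePoints c := by
    refine (hsm.eventually (by simp)).and (Filter.Eventually.and ?_ ?_)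
    · have h1 : ContinuousAt (fun s => (deriv g s / d).re) s₀ := by
        have h2 : ContinuousAt (fun s => deriv g s) s₀ :=
          (hsm.continuousAt_fderiv one_ne_zero).clm_apply continuousAt_const
        exact Complex.continuous_re.continuousAt.comp (h2.div_const d)
      exact h1.eventually_ne hdd1
    · exact hgc.continuousAt.eventually_mem (hfin.isClosed.isOpen_compl.mem_nhds hs₀)
  obtain ⟨η₁, hη₁, hb₁⟩ := Metric.eventually_nhds_iff_ball.1 hev
  obtain ⟨η₂, hη₂, hb₂⟩ := Metric.mem_nhds_iff.1 (Γ.open_source.mem_nhds hsrc)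
  set η₃ := min η (min η₁ η₂) with hη₃
  have hη₃p : 0 < η₃ := lt_min hη (lt_min hη₁ hη₂)
  have hbox₃ : Ioo (s₀ - η₃) (s₀ + η₃) ×ˢ Ioo (-η₃) η₃ ⊆ Γ.source := by
    rintro ⟨s, y⟩ ⟨hs, hy⟩
    apply hb₂
    rw [← ball_prod_same, Real.ball_eq_Ioo, Real.ball_eq_Ioo]
    have : η₃ ≤ η₂ := (min_le_right _ _).trans (min_le_right _ _)
    simp only [mem_Ioo] at hs hy
    refine ⟨⟨?_, ?_⟩, ⟨?_, ?_⟩⟩ <;> simp only <;> linarith [hs.1, hs.2, hy.1, hy.2]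
  -- the rest of the curve stays away from the center of the gate
  set J : Set UnitAddCircle := (fun s : ℝ => (s : UnitAddCircle)) '' Ioo (s₀ - η₃) (s₀ + η₃) with hJ
  have hJo : IsOpen J := QuotientAddGroup.isOpenMap_coe _ isOpen_Ioo
  have hfar : (c '' Jᶜ)ᶜ ∈ 𝓝 (c s₀) := by
    refine (hJo.isClosed_compl.isCompact.image hc).isClosed.isOpen_compl.mem_nhds ?_
    rintro ⟨t, ht, hts⟩
    refine hs₀ ⟨t, s₀, ?_, hts, rfl⟩
    rintro rfl
    exact ht ⟨s₀, ⟨by linarith, by linarith⟩, rfl⟩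
  have hFO : ∀ᶠ p in 𝓝 ((s₀, 0) : ℝ × ℝ), F p ∈ O ∩ (c '' Jᶜ)ᶜ := by
    refine hFc.continuousAt.eventually_mem ?_
    have : F (s₀, 0) = c s₀ := hΓ0 s₀
    rw [this]
    exact inter_mem hO hfar
  obtain ⟨η₄, hη₄, hb₄⟩ := Metric.eventually_nhds_iff_ball.1 hFO
  set δ := min η₃ η₄ with hδ
  have hδp : 0 < δ := lt_min hη₃p hη₄
  have hsub : Ioo (s₀ - δ) (s₀ + δ) ⊆ Ioo (s₀ - η₃) (s₀ + η₃) :=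
    Ioo_subset_Ioo (by linarith [min_le_left η₃ η₄]) (by linarith [min_le_left η₃ η₄])
  have hsub' : Ioo (-δ) δ ⊆ Ioo (-η₃) η₃ :=
    Ioo_subset_Ioo (by linarith [min_le_left η₃ η₄]) (by linarith [min_le_left η₃ η₄])
  have hbox : Ioo (s₀ - δ) (s₀ + δ) ×ˢ Ioo (-δ) δ ⊆ Γ.source :=
    (prod_mono hsub hsub').trans hbox₃
  have hη₃₁ : η₃ ≤ η₁ := (min_le_right _ _).trans (min_le_left _ _)
  have hb₁' : ∀ s ∈ Ioo (s₀ - δ) (s₀ + δ), _ := fun s hs => hb₁ s (by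
    rw [Real.ball_eq_Ioo]
    have := hsub hs
    exact ⟨by linarith [this.1], by linarith [this.2]⟩)
  have hin : gateBox Γ s₀ δ ⊆ O ∩ (c '' Jᶜ)ᶜ := by
    rintro _ ⟨⟨s, y⟩, ⟨hs, hy⟩, rfl⟩
    rw [hΓ]
    apply hb₄
    rw [← ball_prod_same, Real.ball_eq_Ioo, Real.ball_eq_Ioo]
    have : δ ≤ η₄ := min_le_right _ _
    simp only [mem_Ioo] at hs hy
    refine ⟨⟨?_, ?_⟩, ⟨?_, ?_⟩⟩ <;> simp only <;> linarith [hs.1, hs.2, hy.1, hy.2]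
  refine ⟨δ, Γ, (min_le_left _ _).trans (min_le_left _ _),
    ⟨hδp, hbox, fun s _ => hΓ0 s, ?_, ?_, ?_⟩,
    fun z hz => (hin hz).1⟩
  · intro t ht
    have h1 : t ∈ J := by
      by_contra h
      exact (hin ht).2 ⟨t, h, rfl⟩
    obtain ⟨u, hu, rfl⟩ := h1
    obtain ⟨⟨s, y⟩, hsy, hsy'⟩ := ht
    rw [← hΓ0 u] at hsy'
    have h0 : (0 : ℝ) ∈ Ioo (-η₃) η₃ := ⟨by linarith, hη₃p⟩
    have h2 := Γ.injOn (hbox hsy) (hbox₃ ⟨hu, h0⟩) hsy'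
    have h3 : s = u := congrArg Prod.fst h2
    exact ⟨u, h3 ▸ hsy.1, rfl⟩
  · intro s hs
    exact hstr s 0 (hb₁' s hs).1 (hb₁' s hs).2.1
  · intro s hs
    exact (hb₁' s hs).2.2

/-! ### Pulling a gate in front of a half strip -/

/-- Let `p = a + i η` be the tip of the half strip `T = {a ≤ re, |im - η| ≤ h}`, which is disjoint
from the open region `W`, and suppose that within `W` a point of a gate is connected to points
close to `p`. Then a diffeomorphism supported in `W` pulls the gate so close to `p` that some
horizontal line meets the moved curve for the first time, when coming from `T`, at a point of the
gate where the curve is not horizontal. Such a point is found by maximizing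
`re z - (im z - η) ^ 2` over the moved curve near the tip. -/
lemma exists_pull_gate {c : UnitAddCircle → ℂ} (hc : Continuous c) {s₀ δ : ℝ}
    {Γ : OpenPartialHomeomorph (ℝ × ℝ) ℂ} (G : IsGate c s₀ δ Γ) {a η h : ℝ} (hh : 0 < h)
    {W : Set ℂ} (hW : IsOpen W) (hWT : ∀ z ∈ W, a ≤ z.re → |z.im - η| ≤ h → False)
    (hWK : ∀ t, c t ∈ W → c t ∈ gateBox Γ s₀ δ) {κ₀ : ℝ} (hκ₀ : 0 < κ₀)
    (hconn : ∀ κ ∈ Ioo 0 κ₀, Conn W (c s₀) ⟨a - κ, η⟩) (htip : (⟨a, η⟩ : ℂ) ∉ range c) :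
    ∃ φ : ℂ ≃ₜ ℂ, IsStrictDiffeo φ ∧ IsSupportedIn φ W ∧ ∃ s ∈ Ioo (s₀ - δ) (s₀ + δ),
      (φ (c s)).re < a ∧ |(φ (c s)).im - η| < h ∧
      (∀ t, (φ (c t)).im = (φ (c s)).im → (φ (c s)).re < (φ (c t)).re → a < (φ (c t)).re) ∧
      ∃ v : ℂ, HasStrictDerivAt (fun u : ℝ => φ (c u)) v s ∧ v.im ≠ 0 := by
  set p : ℂ := ⟨a, η⟩ with hp
  obtain ⟨ρ, hρ, hball⟩ := Metric.mem_nhds_iff.1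
    ((isCompact_range hc).isClosed.isOpen_compl.mem_nhds htip)
  obtain ⟨κ, hκ, hκ1⟩ : ∃ κ : ℝ, 0 < κ ∧ κ < min κ₀ (min (ρ / 2) (min (h ^ 2) ((ρ / 2) ^ 2))) :=
    exists_between (by positivity)
  simp only [lt_min_iff] at hκ1
  obtain ⟨hκa, hκb, hκc, hκd⟩ := hκ1
  obtain ⟨φ, hφ, hsupp, ε, hε, htr⟩ := Movable.of_conn hW (hconn κ ⟨hκ, hκa⟩)
  set f : ℂ → ℝ := fun z => z.re - (z.im - η) ^ 2 with hf
  have hfc : Continuous f := by fun_prop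
  have hφc : Continuous fun t => φ (c t) := φ.continuous.comp hc
  set E : Set UnitAddCircle := {t | (φ (c t)).re ≤ a ∧ a - κ ≤ f (φ (c t))} with hE
  have hEc : IsCompact E := by
    refine IsClosed.isCompact ?_
    exact (isClosed_le (Complex.continuous_re.comp hφc) continuous_const).inter
      (isClosed_le continuous_const (hfc.comp hφc))
  have hpull : φ (c s₀) = ⟨a - κ, η⟩ := by
    have := htr 0 (by simpa using hε)
    simpa using this
  have hEne : (s₀ : UnitAddCircle) ∈ E := by
    rw [hE, mem_ofPred_eq, hpull]
    simp [hf, hκ.le]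
  obtain ⟨t, htE, htmax⟩ := hEc.exists_isMaxOn ⟨_, hEne⟩
    (f := fun t => f (φ (c t))) (hfc.comp hφc).continuousOn
  set x := φ (c t) with hx
  -- `κ` is so small that the region between the parabola `f = a - κ` and the tip avoids the curve
  -- and the lines that bound the strip
  have hest : ∀ z : ℂ, z.re ≤ a → a - κ ≤ f z → |z.im - η| < h ∧ z ∈ ball p ρ := by
    intro z hz1 hz2
    simp only [hf] at hz2
    have h1 : (z.im - η) ^ 2 ≤ κ := by linarith
    have h2 : |z.im - η| < h := abs_lt_of_sq_lt_sq (by linarith) hh.le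
    have h3 : |z.im - η| < ρ / 2 := abs_lt_of_sq_lt_sq (by linarith) (by positivity)
    refine ⟨h2, ?_⟩
    rw [mem_ball, dist_eq_norm]
    refine (Complex.norm_le_abs_re_add_abs_im _).trans_lt ?_
    have h4 : |z.re - a| ≤ κ := by
      rw [abs_le]; constructor <;> nlinarith [sq_nonneg (z.im - η)]
    have h5 : (z - p).re = z.re - a := rfl
    have h6 : (z - p).im = z.im - η := rfl
    rw [h5, h6]
    linarith
  obtain ⟨hxim, hxball⟩ := hest x htE.1 htE.2
  have hxK : x ∉ range c := hball hxball
  have hctW : c t ∈ W := by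
    by_contra h
    exact hxK ⟨t, (hsupp.apply_eq h).symm⟩
  have hxW : x ∈ W := hsupp.mem_iff.2 hctW
  obtain ⟨s, hs, rfl⟩ := G.only t (hWK t hctW)
  have hxa : x.re < a := by
    rcases lt_or_eq_of_le htE.1 with h | h
    · exact h
    · exact absurd hxim.le (fun h' => hWT x hxW h.ge h')
  refine ⟨φ, hφ, hsupp, s, hs, hxa, hxim, ?_, ?_⟩
  · intro t' him hre
    by_contra hle
    push Not at hle
    have hlt : f x < f (φ (c t')) := by
      simp only [hf, him]
      linarith
    have : t' ∈ E := ⟨hle, htE.2.trans hlt.le⟩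
    exact absurd (htmax this) (not_le.2 hlt)
  · obtain ⟨v, hv0, hv⟩ := (G.comp hφ).hasStrictDerivAt hs
    -- at the maximum of `f` the real part of the velocity is a multiple of its imaginary part
    refine ⟨v, hv, fun him => hv0 ?_⟩
    have hgd : HasDerivAt (fun u : ℝ => φ (c u)) v s := hv.hasDerivAt
    have hre : HasDerivAt (fun u : ℝ => (φ (c u)).re) v.re s :=
      Complex.reCLM.hasFDerivAt.comp_hasDerivAt s hgd
    have him' : HasDerivAt (fun u : ℝ => (φ (c u)).im) v.im s :=
      Complex.imCLM.hasFDerivAt.comp_hasDerivAt s hgd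
    have hfd := hre.sub ((him'.sub_const η).pow 2)
    have hcont : Continuous (fun u : ℝ => φ (c u)) :=
      φ.continuous.comp (hc.comp (AddCircle.continuous_mk' 1))
    have hmax : IsLocalMax
        ((fun u : ℝ => (φ (c u)).re) - (fun u : ℝ => (φ (c u)).im - η) ^ 2) s := by
      have h1 : ∀ᶠ u : ℝ in 𝓝 s, (φ (c u)).re < a :=
        (Complex.continuous_re.comp hcont).continuousAt.eventually_lt continuousAt_const hxa
      filter_upwards [h1] with u hu
      change f (φ (c u)) ≤ f x
      by_cases hu2 : a - κ ≤ f (φ (c u))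
      · exact htmax (show (u : UnitAddCircle) ∈ E from ⟨hu.le, hu2⟩)
      · push Not at hu2
        exact hu2.le.trans htE.2
    have h0 := hmax.hasDerivAt_eq_zero hfd
    rw [him, mul_zero, sub_zero] at h0
    exact Complex.ext h0 him

/-! ### Making a ray cross the curve at most twice -/

lemma Conn.of_real {α : Type*} [TopologicalSpace α] {X : Set α} {f : ℝ → α} (hf : Continuous f)
    {a b : ℝ} (h : ∀ u ∈ uIcc a b, f u ∈ X) : Conn X (f a) (f b) :=
  Conn.of_preconnected (isPreconnected_uIcc.image f hf.continuousOn)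
    (by rintro _ ⟨u, hu, rfl⟩; exact h u hu)
    (mem_image_of_mem f left_mem_uIcc) (mem_image_of_mem f right_mem_uIcc)

lemma continuous_mk_re (y : ℝ) : Continuous fun x : ℝ => (⟨x, y⟩ : ℂ) := by
  have : (fun x : ℝ => (⟨x, y⟩ : ℂ)) = fun x : ℝ => (x : ℂ) + y * Complex.I := by
    funext x; apply Complex.ext <;> simp
  rw [this]; fun_prop

lemma continuous_mk_im (x : ℝ) : Continuous fun y : ℝ => (⟨x, y⟩ : ℂ) := by
  have : (fun y : ℝ => (⟨x, y⟩ : ℂ)) = fun y : ℝ => (x : ℂ) + y * Complex.I := by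
    funext y; apply Complex.ext <;> simp
  rw [this]; fun_prop

lemma Conn.exists_compact {X : Set ℂ} (hX : IsOpen X) {a b : ℂ} (h : Conn X a b) :
    ∃ P ⊆ X, IsCompact P ∧ IsPreconnected P ∧ a ∈ P ∧ b ∈ P := by
  rcases ArcIn.of_conn hX h with ⟨rfl, h2⟩ | ⟨f, hf, -, rfl, rfl, hfX⟩
  · exact ⟨{a}, by simpa using h2, isCompact_singleton, isPreconnected_singleton, rfl, rfl⟩
  · exact ⟨range f, hfX, isCompact_range hf, isPreconnected_range hf, ⟨0, rfl⟩, ⟨1, rfl⟩⟩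

lemma conn_comp_iff {c : UnitAddCircle → ℂ} (φ : ℂ ≃ₜ ℂ) {a b : ℂ} :
    Conn (range (φ ∘ c))ᶜ (φ a) (φ b) ↔ Conn (range c)ᶜ a b := by
  constructor
  · intro h
    have := h.image φ.symm.continuous (Z := (range c)ᶜ) (by
      rintro _ ⟨z, hz, rfl⟩ ⟨t, ht⟩
      exact hz ⟨t, by simp [ht]⟩)
    simpa using this
  · intro h
    refine h.image φ.continuous ?_
    rintro _ ⟨z, hz, rfl⟩ ⟨t, ht⟩
    exact hz ⟨t, φ.injective ht⟩

/-- Far away points remain connected to each other when the curve is moved. -/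
lemma conn_far {c : UnitAddCircle → ℂ} {R : ℝ} (hcR : ∀ t, ‖c t‖ < R) {φ : ℂ ≃ₜ ℂ} {W : Set ℂ}
    (hφ : IsSupportedIn φ W) : ∃ B, ∀ z : ℂ, B ≤ ‖z‖ → Conn (range (φ ∘ c))ᶜ z (φ R) := by
  obtain ⟨C, hC, -, hid⟩ := hφ
  obtain ⟨B, hB⟩ := hC.isBounded.exists_norm_le
  refine ⟨max R (B + 1), fun z hz => ?_⟩
  have h1 : φ z = z := hid z fun hzC => by
    have := hB z hzC
    linarith [(le_max_right R (B + 1)).trans hz]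
  rw [← h1, conn_comp_iff]
  refine Conn.of_preconnected (isPreconnected_outside R) ?_ ((le_max_left _ _).trans hz) ?_
  · rintro y hy ⟨t, rfl⟩
    exact absurd (hcR t) (not_lt.2 hy)
  · have := (norm_nonneg _).trans_lt (hcR 0)
    simp [abs_of_pos this]

/-- The end point of a horizontal ray that misses the moved curve is connected to infinity. -/
lemma conn_of_ray {c : UnitAddCircle → ℂ} {R : ℝ} (hcR : ∀ t, ‖c t‖ < R) {φ : ℂ ≃ₜ ℂ} {W : Set ℂ}
    (hφ : IsSupportedIn φ W) {z : ℂ} (hz : ∀ x, z.re ≤ x → (⟨x, z.im⟩ : ℂ) ∉ range (φ ∘ c)) :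
    Conn (range (φ ∘ c))ᶜ z (φ R) := by
  obtain ⟨B, hB⟩ := conn_far hcR hφ
  have h1 := Conn.of_real (X := (range (φ ∘ c))ᶜ) (continuous_mk_re z.im) (a := z.re)
    (b := max z.re B) (fun u hu => hz u (by
      rw [uIcc_of_le (le_max_left _ _)] at hu; exact hu.1))
  refine h1.trans (hB _ ?_)
  exact (le_max_right z.re B).trans
    ((le_abs_self _).trans (Complex.abs_re_le_norm ⟨max z.re B, z.im⟩))

/-- A gate that faces the unbounded region can be pulled out, so that some rightmost point of a
horizontal line on the moved curve lies in the gate. -/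
lemma exists_pull_outer {c : UnitAddCircle → ℂ} (hc : Continuous c) {R : ℝ}
    (hcR : ∀ t, ‖c t‖ < R) {s₀ δ : ℝ} {Γ : OpenPartialHomeomorph (ℝ × ℝ) ℂ} (G : IsGate c s₀ δ Γ)
    {σ : ℝ} (hσ : σ = 1 ∨ σ = -1) {p q : ℂ} (hp : p ∈ gateSide Γ s₀ δ σ)
    (hpR : Conn (range c)ᶜ p R) (hq : q ∈ gateSide Γ s₀ δ (-σ))
    (hqR : ¬ Conn (range c)ᶜ q R) :
    ∃ φ : ℂ ≃ₜ ℂ, IsStrictDiffeo φ ∧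
      IsSupportedIn φ (connectedComponentIn (range c)ᶜ R ∪ gateBox Γ s₀ δ) ∧
      ∃ s ∈ Ioo (s₀ - δ) (s₀ + δ),
        (∀ t, (φ (c t)).im = (φ (c s)).im → (φ (c t)).re ≤ (φ (c s)).re) ∧
        (∃ v : ℂ, HasStrictDerivAt (fun u : ℝ => φ (c u)) v s ∧ v.im ≠ 0) ∧
        ∀ᶠ ε : ℝ in 𝓝[>] 0, φ (c s) - ε ∈ φ '' gateSide Γ s₀ δ (-σ) := by
  have hR0 : 0 < R := (norm_nonneg _).trans_lt (hcR 0)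
  have hKo : IsOpen (range c)ᶜ := (isCompact_range hc).isClosed.isOpen_compl
  set V := connectedComponentIn (range c)ᶜ (R : ℂ) ∪ gateBox Γ s₀ δ with hV
  have hVo : IsOpen V := hKo.connectedComponentIn.union G.isOpen_box
  have hcV : c s₀ ∈ gateBox Γ s₀ δ := G.curve_mem_box G.center_mem
  have hfar : ∀ z : ℂ, R ≤ ‖z‖ → Conn (range c)ᶜ z R := fun z hz => by
    refine Conn.of_preconnected (isPreconnected_outside R) ?_ hz (by simp [abs_of_pos hR0])
    rintro y hy ⟨t, rfl⟩
    exact absurd (hcR t) (not_lt.2 hy)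
  have hpC : p ∈ connectedComponentIn (range c)ᶜ (R : ℂ) := hpR.symm.mem_component
  have hVc : Conn V (c s₀) R := by
    have h1 : IsPreconnected V := IsPreconnected.union p hpC
      (IsGate.side_subset_box Γ s₀ δ σ hp) isPreconnected_connectedComponentIn G.isPreconnected_box
    exact Conn.of_preconnected h1 subset_rfl (Or.inr hcV)
      (Or.inl (mem_connectedComponentIn hpR.right_mem))
  -- the motion takes place in the half plane `re < a`, which contains the curve and a compact
  -- connected set that joins the gate to `R`
  obtain ⟨P, hPV, hPc, hPp, h0P, hRP⟩ := hVc.exists_compact hVo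
  obtain ⟨B, hB⟩ := hPc.isBounded.exists_norm_le
  set a := max R B + 1 with ha
  have haR : R + 1 ≤ a := by have := le_max_left R B; linarith
  set W := V ∩ {z | z.re < a} with hW
  have hWo : IsOpen W := hVo.inter (isOpen_lt Complex.continuous_re continuous_const)
  have hK0 : ∀ t, c t ∈ V → c t ∈ gateBox Γ s₀ δ := by
    rintro t (h | h)
    · exact absurd (mem_range_self t) (connectedComponentIn_subset _ _ h)
    · exact h
  obtain ⟨φ, hφ, hsupp, s, hs, hsa, -, hfree, v, hv, hvim⟩ :=
    exists_pull_gate hc G (a := a) (η := 0) one_pos hWo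
      (fun z hz hza _ => absurd hz.2 (not_lt.2 hza))
      (fun t ht => hK0 t ht.1) one_pos
      (by
        intro κ hκ
        have h0 : Conn W (c s₀) R := by
          refine Conn.of_preconnected hPp (fun z hz => ⟨hPV hz, ?_⟩) h0P hRP
          have h1 := (le_abs_self _).trans ((Complex.abs_re_le_norm z).trans (hB z hz))
          have := le_max_right R B
          change z.re < a
          linarith
        refine h0.trans ?_
        · have h1 := Conn.of_real (X := W) (continuous_mk_re 0) (a := R) (b := a - κ) (by
            intro u hu
            rw [uIcc_of_le (by linarith [hκ.2])] at hu
            refine ⟨Or.inl ((hfar _ ?_).symm.mem_component), ?_⟩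
            · exact hu.1.trans ((le_abs_self _).trans (Complex.abs_re_le_norm ⟨u, 0⟩))
            · change u < a
              linarith [hu.2, hκ.1])
          exact h1)
      (by
        rintro ⟨t, ht⟩
        have h1 := (le_abs_self _).trans ((Complex.abs_re_le_norm (c t)).trans (hcR t).le)
        rw [ht] at h1
        change a ≤ R at h1
        linarith)
  have hsuppV : IsSupportedIn φ V := hsupp.mono inter_subset_left
  have hre : ∀ t, (φ (c t)).re < a := by
    intro t
    by_cases h : c t ∈ W
    · exact (hsupp.mem_iff.2 h).2
    · rw [hsupp.apply_eq h]
      have h1 := (le_abs_self _).trans ((Complex.abs_re_le_norm (c t)).trans (hcR t).le)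
      linarith
  have hright : ∀ t, (φ (c t)).im = (φ (c s)).im → (φ (c t)).re ≤ (φ (c s)).re := by
    intro t ht
    by_contra h
    exact absurd (hfree t ht (not_le.1 h)) (not_lt.2 (hre t).le)
  refine ⟨φ, hφ, hsuppV, s, hs, hright, ⟨v, hv, hvim⟩, ?_⟩
  obtain ⟨τ, hτ, hev⟩ := (G.comp hφ).exists_sides hs hv hvim
  -- otherwise the side `-σ` would lie on the right, where a ray connects it to infinity
  have hτσ : τ = -σ := by
    by_contra hne
    have hτ' : -τ = -σ := by
      rcases hσ with rfl | rfl <;> rcases hτ with rfl | rfl <;> first | rfl | norm_num at hne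
    obtain ⟨ε, hε, hε0⟩ := (hev.and self_mem_nhdsWithin).exists
    have hε0' : (0 : ℝ) < ε := hε0
    have h1 := hε.2
    rw [IsGate.gateSide_trans, hτ'] at h1
    obtain ⟨q', hq', hqe⟩ := h1
    refine hqR ((G.conn_side hq hq').trans ((conn_comp_iff φ).1 ?_))
    rw [hqe]
    refine conn_of_ray hcR hsupp ?_
    rintro x hx ⟨t, ht⟩
    have ht' : φ (c t) = ⟨x, ((φ ∘ c) s + ε).im⟩ := ht
    have h2 := hright t (by rw [ht']; simp)
    rw [ht'] at h2
    simp at hx h2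
    linarith
  subst hτσ
  filter_upwards [hev] with ε hε
  have := hε.1
  rwa [IsGate.gateSide_trans] at this

/-- A second gate, which faces the region to the left of a point `x` of the curve, is pulled so
close to `x` that a horizontal ray that starts next to the gate meets the moved curve only near
the gate and near `x`. -/
lemma exists_pull_inner {c : UnitAddCircle → ℂ} (hc : Continuous c) {w x : ℂ} (hx : x ∈ range c)
    (hfree : ∀ t, (c t).im = x.im → (c t).re ≤ x.re)
    (hray : ∀ z : ℂ, (∀ u, z.re ≤ u → (⟨u, z.im⟩ : ℂ) ∉ range c) → Conn (range c)ᶜ z w)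
    {ρ₁ : ℝ} (hρ₁ : 0 < ρ₁)
    {s₀ δ : ℝ} {Γ : OpenPartialHomeomorph (ℝ × ℝ) ℂ} (G : IsGate c s₀ δ Γ)
    {σ : ℝ} (hσ : σ = 1 ∨ σ = -1) {p q : ℂ} (hp : p ∈ gateSide Γ s₀ δ σ)
    (hxp : ∀ᶠ ε : ℝ in 𝓝[>] 0, Conn (range c)ᶜ (x - ε) p) (hpw : ¬ Conn (range c)ᶜ p w)
    (hq : q ∈ gateSide Γ s₀ δ (-σ)) (hqp : ¬ Conn (range c)ᶜ q p) (hqw : ¬ Conn (range c)ᶜ q w)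
    (hxQ : x ∉ gateBox Γ s₀ δ) :
    ∃ φ : ℂ ≃ₜ ℂ, IsStrictDiffeo φ ∧
      ∃ W ⊆ connectedComponentIn (range c)ᶜ p ∪ gateBox Γ s₀ δ, IsSupportedIn φ W ∧
      ∃ s ∈ Ioo (s₀ - δ) (s₀ + δ),
        (∀ t, (φ (c t)).im = (φ (c s)).im → (φ (c s)).re < (φ (c t)).re →
          c t ∉ W ∧ c t ∈ ball x ρ₁) ∧
        (∃ v : ℂ, HasStrictDerivAt (fun u : ℝ => φ (c u)) v s ∧ v.im ≠ 0) ∧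
        ∀ᶠ ε : ℝ in 𝓝[>] 0, φ (c s) - ε ∈ φ '' gateSide Γ s₀ δ (-σ) := by
  have hKc : IsCompact (range c) := isCompact_range hc
  have hKo : IsOpen (range c)ᶜ := hKc.isClosed.isOpen_compl
  set V := connectedComponentIn (range c)ᶜ p ∪ gateBox Γ s₀ δ with hV
  have hVo : IsOpen V := hKo.connectedComponentIn.union G.isOpen_box
  have hpK : p ∈ (range c)ᶜ := G.side_disjoint σ hp
  have hVp : IsPreconnected V := IsPreconnected.union p (mem_connectedComponentIn hpK)
      (IsGate.side_subset_box Γ s₀ δ σ hp) isPreconnected_connectedComponentIn G.isPreconnected_box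
  have hcV : c s₀ ∈ V := Or.inr (G.curve_mem_box G.center_mem)
  have hK0 : ∀ t, c t ∈ V → c t ∈ gateBox Γ s₀ δ := by
    rintro t (h | h)
    · exact absurd (mem_range_self t) (connectedComponentIn_subset _ _ h)
    · exact h
  have hxV : x ∉ V := by
    rintro (h | h)
    · exact connectedComponentIn_subset _ _ h hx
    · exact hxQ h
  have hVw : ∀ z ∈ V, z ∉ range c → ¬ Conn (range c)ᶜ z w := by
    have hside : ∀ τ : ℝ, (τ = 1 ∨ τ = -1) → ∀ z ∈ gateSide Γ s₀ δ τ, ¬ Conn (range c)ᶜ z w := by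
      intro τ hτ z hz h
      have : τ = σ ∨ τ = -σ := by
        rcases hσ with rfl | rfl <;> rcases hτ with rfl | rfl <;> norm_num
      rcases this with rfl | rfl
      · exact hpw ((G.conn_side hp hz).trans h)
      · exact hqw ((G.conn_side hq hz).trans h)
    rintro z (h | h) hzK hzw
    · exact hpw ((Conn.of_mem_component h).trans hzw)
    · rcases G.box_subset h with (h | h) | h
      · exact hside 1 (Or.inl rfl) z h hzw
      · exact hside (-1) (Or.inr rfl) z h hzw
      · exact hzK h
  obtain ⟨ε₀', hε₀', hb₀⟩ := Metric.nhdsWithin_basis_ball.mem_iff.1 hxp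
  set ε₀ := ε₀' / 2 with hε₀d
  have hε₀ : 0 < ε₀ := half_pos hε₀'
  have hε₀x : ∀ ε ∈ Ioc 0 ε₀, Conn (range c)ᶜ (x - (ε : ℝ)) p := by
    intro ε hε
    refine hb₀ ⟨?_, hε.1⟩
    rw [Real.ball_eq_Ioo]
    constructor <;> linarith [hε.1, hε.2]
  -- a compact path from the gate to the left of `x`
  obtain ⟨P, hPV, hPc, hPp, hsP, hxP⟩ := (Conn.of_preconnected hVp subset_rfl hcV
    (Or.inl (hε₀x ε₀ ⟨hε₀, le_rfl⟩).symm.mem_component)).exists_compact hVo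
  obtain ⟨ρ₂, hρ₂, hPball⟩ := Metric.mem_nhds_iff.1
    (hPc.isClosed.isOpen_compl.mem_nhds (fun h => hxV (hPV h) : x ∉ P))
  set ρ := min ρ₁ ρ₂ with hρd
  have hρ : 0 < ρ := lt_min hρ₁ hρ₂
  set μ := min (ρ / 4) (ε₀ / 2) with hμd
  have hμ : 0 < μ := lt_min (by positivity) (by positivity)
  have hμρ : μ ≤ ρ / 4 := min_le_left _ _
  have hμε : μ ≤ ε₀ / 2 := min_le_right _ _
  set a := x.re - μ with had
  -- the strip to the right of `a` misses the curve outside the small ball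
  set E : Set ℂ := (range c ∩ {z | a ≤ z.re}) \ ball x ρ with hE
  have hEc : IsCompact E := by
    refine (hKc.inter_right ?_).diff isOpen_ball
    exact isClosed_le continuous_const Complex.continuous_re
  have hxim : ∀ z ∈ E, z.im ≠ x.im := by
    rintro z ⟨⟨⟨t, rfl⟩, hz⟩, hzb⟩ him
    have h1 := hfree t him
    have h2 : a ≤ (c t).re := hz
    apply hzb
    rw [mem_ball, dist_eq_norm]
    have h3 : c t - x = (((c t).re - x.re : ℝ) : ℂ) := by
      apply Complex.ext <;> simp [him]
    rw [h3, Complex.norm_real, Real.norm_eq_abs, abs_lt]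
    constructor <;> linarith
  obtain ⟨h₁, hh₁, hEh⟩ : ∃ h₁ > 0, ∀ z ∈ E, h₁ < |z.im - x.im| := by
    rcases E.eq_empty_or_nonempty with he | hne
    · exact ⟨1, one_pos, by simp [he]⟩
    · obtain ⟨z, hz, hmin⟩ := hEc.exists_isMinOn hne
        (f := fun z => |z.im - x.im|) (by fun_prop)
      have h0 : 0 < |z.im - x.im| := abs_pos.2 (sub_ne_zero.2 (hxim z hz))
      refine ⟨|z.im - x.im| / 2, half_pos h0, fun y hy => ?_⟩
      have := hmin hy
      exact (half_lt_self h0).trans_le this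
  have haK : (⟨a, x.im⟩ : ℂ) ∈ (range c)ᶜ := by
    have h1 := (hε₀x μ ⟨hμ, by linarith⟩).left_mem
    have h2 : x - (μ : ℂ) = ⟨a, x.im⟩ := by apply Complex.ext <;> simp [had]
    rwa [h2] at h1
  obtain ⟨h₂, hh₂, hb₂⟩ := Metric.mem_nhds_iff.1
    ((continuous_mk_im a).continuousAt.preimage_mem_nhds (hKo.mem_nhds haK))
  set h := min h₁ (min (h₂ / 2) (ρ / 4)) with hhd
  have hh : 0 < h := lt_min hh₁ (lt_min (half_pos hh₂) (by positivity))
  have hhh₁ : h ≤ h₁ := min_le_left _ _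
  have hhh₂ : h ≤ h₂ / 2 := (min_le_right _ _).trans (min_le_left _ _)
  have hhρ : h ≤ ρ / 4 := (min_le_right _ _).trans (min_le_right _ _)
  set T : Set ℂ := {z | a ≤ z.re ∧ |z.im - x.im| ≤ h} with hT
  have hTcl : IsClosed T := by
    refine (isClosed_le continuous_const Complex.continuous_re).inter ?_
    exact isClosed_le (f := fun z : ℂ => |z.im - x.im|) (by fun_prop) continuous_const
  have hTK : ∀ z ∈ T, z ∈ range c → z ∈ ball x ρ := by
    intro z hz hzK
    by_contra hzb
    exact absurd (hEh z ⟨⟨hzK, hz.1⟩, hzb⟩) (not_lt.2 (hz.2.trans hhh₁))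
  have hball : ∀ z ∈ T, z ∉ ball x ρ → x.re + ρ / 2 ≤ z.re := by
    intro z hz hzb
    by_contra hlt
    push Not at hlt
    apply hzb
    rw [mem_ball, dist_eq_norm]
    refine (Complex.norm_le_abs_re_add_abs_im _).trans_lt ?_
    have h1 : |(z - x).re| ≤ ρ / 2 := by
      rw [Complex.sub_re, abs_le]
      constructor
      · have := hz.1; linarith
      · linarith
    have h2 : |(z - x).im| ≤ ρ / 4 := hz.2.trans hhρ
    linarith
  have hTw : ∀ z ∈ T, z ∉ ball x ρ → z ∉ range c ∧ Conn (range c)ᶜ z w := by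
    intro z hz hzb
    refine ⟨fun h => hzb (hTK z hz h), hray z fun u hu hK => ?_⟩
    have h1 := hball z hz hzb
    have h2 := hTK ⟨u, z.im⟩ ⟨hz.1.trans hu, hz.2⟩ hK
    rw [mem_ball, dist_eq_norm] at h2
    apply hzb
    rw [mem_ball, dist_eq_norm]
    refine lt_of_le_of_lt ?_ h2
    rw [Complex.norm_def, Complex.norm_def]
    apply Real.sqrt_le_sqrt
    simp only [Complex.normSq_apply, Complex.sub_re, Complex.sub_im]
    nlinarith
  have hPT : ∀ z ∈ P, z ∉ T := by
    intro z hzP hzT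
    have h1 : z ∉ ball x ρ := fun hb => hPball (ball_subset_ball (min_le_right _ _) hb) hzP
    obtain ⟨h2, h3⟩ := hTw z hzT h1
    exact hVw z (hPV hzP) h2 h3
  set W := V \ T with hW
  have hWo : IsOpen W := hVo.sdiff hTcl
  obtain ⟨φ, hφ, hsupp, s, hs, hsa, hsim, hsfree, v, hv, hvim⟩ :=
    exists_pull_gate hc G (a := a) (η := x.im) hh hWo (fun z hz hza hzi => hz.2 ⟨hza, hzi⟩)
      (fun t ht => hK0 t ht.1) (κ₀ := ε₀ - μ) (by linarith)
      (by
        intro κ hκ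
        have h0 : Conn W (c s₀) (x - ε₀) :=
          Conn.of_preconnected hPp (fun z hz => ⟨hPV hz, hPT z hz⟩) hsP hxP
        have h1 := Conn.of_real (X := W) (continuous_mk_re x.im) (a := x.re - ε₀) (b := a - κ) (by
            intro u hu
            rw [uIcc_of_le (by linarith [hκ.2])] at hu
            have h2 := hε₀x (x.re - u) ⟨by linarith [hu.2, hκ.1], by linarith [hu.1]⟩
            have h3 : x - ((x.re - u : ℝ) : ℂ) = ⟨u, x.im⟩ := by apply Complex.ext <;> simp
            rw [h3] at h2
            refine ⟨Or.inl h2.symm.mem_component, fun h => ?_⟩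
            have h4 : a ≤ u := h.1
            linarith [hu.2, hκ.1])
        have h3 : x - ((ε₀ : ℝ) : ℂ) = ⟨x.re - ε₀, x.im⟩ := by apply Complex.ext <;> simp
        rw [← h3] at h1
        exact h0.trans h1)
      haK
  have hfix : ∀ z, φ z ∈ T → z ∉ W := fun z hz h => (hsupp.mem_iff.2 h).2 hz
  refine ⟨φ, hφ, W, sdiff_subset, hsupp, s, hs, ?_, ⟨v, hv, hvim⟩, ?_⟩
  · intro t him hre
    have h1 := hsfree t him hre
    have h2 : φ (c t) ∈ T := ⟨h1.le, by rw [him]; exact hsim.le⟩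
    have h3 := hfix _ h2
    refine ⟨h3, ?_⟩
    rw [hsupp.apply_eq h3] at h2
    exact ball_subset_ball (min_le_left _ _) (hTK _ h2 (mem_range_self t))
  obtain ⟨τ, hτ, hev⟩ := (G.comp hφ).exists_sides hs hv hvim
  have hτσ : τ = -σ := by
    by_contra hne
    have hτ' : -τ = -σ := by
      rcases hσ with rfl | rfl <;> rcases hτ with rfl | rfl <;> first | rfl | norm_num at hne
    obtain ⟨ε, ⟨hε, hε0⟩, hεa⟩ := ((hev.and self_mem_nhdsWithin).and
      (Filter.Eventually.filter_mono nhdsWithin_le_nhds (gt_mem_nhds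
        (show (0 : ℝ) < a - (φ (c s)).re by linarith)))).exists
    have hε0' : (0 : ℝ) < ε := hε0
    have h1 := hε.2
    rw [IsGate.gateSide_trans, hτ'] at h1
    obtain ⟨q', hq', hqe⟩ := h1
    -- from the right of the gate, go right to the left edge of the strip, and along this edge
    have e1 : Conn (range (φ ∘ c))ᶜ (φ (c s) + ε) ⟨a, (φ (c s)).im⟩ := by
      have h2 := Conn.of_real (X := (range (φ ∘ c))ᶜ) (continuous_mk_re (φ (c s)).im)
        (a := (φ (c s)).re + ε) (b := a) (by
          intro u hu
          rw [uIcc_of_le (by linarith)] at hu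
          rintro ⟨t, ht⟩
          have ht' : φ (c t) = ⟨u, (φ (c s)).im⟩ := ht
          have h3 := hsfree t (by rw [ht']) (by rw [ht']; change _ < u; linarith [hu.1])
          rw [ht'] at h3
          change a < u at h3
          linarith [hu.2])
      have h3 : φ (c s) + (ε : ℂ) = ⟨(φ (c s)).re + ε, (φ (c s)).im⟩ := by
        apply Complex.ext <;> simp
      rwa [← h3] at h2
    have e2 : Conn (range c)ᶜ ⟨a, (φ (c s)).im⟩ p := by
      have h2 := Conn.of_real (X := (range c)ᶜ) (continuous_mk_im a)
        (a := (φ (c s)).im) (b := x.im) (by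
          intro u hu
          apply hb₂
          rw [Real.ball_eq_Ioo]
          have h3 := abs_lt.1 hsim
          rcases le_total (φ (c s)).im x.im with hle | hle
          · rw [uIcc_of_le hle] at hu
            constructor <;> linarith [hu.1, hu.2]
          · rw [uIcc_of_ge hle] at hu
            constructor <;> linarith [hu.1, hu.2])
      have h4 := hε₀x μ ⟨hμ, by linarith⟩
      have h5 : x - (μ : ℂ) = ⟨a, x.im⟩ := by apply Complex.ext <;> simp [had]
      rw [h5] at h4
      exact h2.trans h4
    have e3 : φ ⟨a, (φ (c s)).im⟩ = ⟨a, (φ (c s)).im⟩ :=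
      hsupp.apply_eq fun h => h.2 ⟨le_rfl, hsim.le⟩
    have e4 : (φ ∘ c) s + (ε : ℂ) = φ (c s) + ε := rfl
    rw [e4] at hqe
    rw [← e3, ← hqe, conn_comp_iff] at e1
    exact hqp ((G.conn_side hq hq').trans (e1.trans e2))
  subst hτσ
  filter_upwards [hev] with ε hε
  have := hε.1
  rwa [IsGate.gateSide_trans] at this

/-- After some compactly supported motion of the plane, which is a translation near `0`, the
horizontal ray to the right of the image `e` of `0` crosses the curve at most twice, and each time
from one side of the ray to the other. -/
def CrossesRayTwice (c : UnitAddCircle → ℂ) : Prop :=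
    ∃ (Ω : ℂ ≃ₜ ℂ) (e : ℂ) (ρ : ℝ), 0 < ρ ∧ (∀ v, ‖v‖ < ρ → Ω v = e + v) ∧
      IsSupportedIn Ω univ ∧
      {t | (Ω (c t)).im = e.im ∧ e.re < (Ω (c t)).re}.encard ≤ 2 ∧
      (∀ t, (Ω (c t)).im = e.im → e.re < (Ω (c t)).re →
        ∃ s : ℝ, (s : UnitAddCircle) = t ∧
          ∃ ε > 0, MonotoneNear (fun u : ℝ => (Ω (c u)).im) (Ioo (s - ε) (s + ε)))

/-- Two gates that separate the unbounded region from a middle region, and the middle region from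
the region of `0`, can be pulled in front of each other. -/
theorem crossesRayTwice_of_chain {c : UnitAddCircle → ℂ} (hc : Continuous c) {R : ℝ}
    (hcR : ∀ t, ‖c t‖ < R) {s₁ δ₁ s₂ δ₂ : ℝ} {Γ₁ Γ₂ : OpenPartialHomeomorph (ℝ × ℝ) ℂ}
    (G₁ : IsGate c s₁ δ₁ Γ₁) (G₂ : IsGate c s₂ δ₂ Γ₂)
    (hdisj : Disjoint (gateBox Γ₁ s₁ δ₁) (gateBox Γ₂ s₂ δ₂))
    (h01 : (0 : ℂ) ∉ gateBox Γ₁ s₁ δ₁) (h02 : (0 : ℂ) ∉ gateBox Γ₂ s₂ δ₂)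
    {σ₁ σ₂ : ℝ} (hσ₁ : σ₁ = 1 ∨ σ₁ = -1) (hσ₂ : σ₂ = 1 ∨ σ₂ = -1) {p₁ q₁ p₂ q₂ : ℂ}
    (hp₁ : p₁ ∈ gateSide Γ₁ s₁ δ₁ σ₁) (hq₁ : q₁ ∈ gateSide Γ₁ s₁ δ₁ (-σ₁))
    (hp₂ : p₂ ∈ gateSide Γ₂ s₂ δ₂ σ₂) (hq₂ : q₂ ∈ gateSide Γ₂ s₂ δ₂ (-σ₂))
    (hp₁R : Conn (range c)ᶜ p₁ R) (hq₁p₂ : Conn (range c)ᶜ q₁ p₂) (hq₂0 : Conn (range c)ᶜ q₂ 0)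
    (hq₁R : ¬ Conn (range c)ᶜ q₁ R) (hq₂p₂ : ¬ Conn (range c)ᶜ q₂ p₂)
    (h0R : ¬ Conn (range c)ᶜ 0 R) :
    CrossesRayTwice c := by
  -- `φ₁` pulls the outer gate to the right, `φ₂` pulls the inner gate close behind it, and `φ₃`
  -- moves `0` in the complement of the moved curve to the point `e` just behind the inner gate
  obtain ⟨φ₁, hφ₁, hsupp₁, s, hs, hfree, ⟨v, hv, hvim⟩, hleft⟩ :=
    exists_pull_outer hc hcR G₁ hσ₁ hp₁ hp₁R hq₁ hq₁R
  have h0V₁ : (0 : ℂ) ∉ connectedComponentIn (range c)ᶜ R ∪ gateBox Γ₁ s₁ δ₁ := by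
    rintro (h | h)
    · exact h0R (Conn.of_mem_component h).symm
    · exact h01 h
  have hφ₁0 : φ₁ 0 = 0 := hsupp₁.apply_eq h0V₁
  set c₁ := φ₁ ∘ c with hc₁d
  have hc₁ : Continuous c₁ := φ₁.continuous.comp hc
  have G₁' := G₁.comp hφ₁
  have G₂' := G₂.comp hφ₁
  obtain ⟨ρ₁, hρ₁, ε₁, hε₁, hmono₁, huniq₁⟩ := G₁'.exists_ball hs hv hvim
  have himg : ∀ {σ : ℝ} {z : ℂ}, z ∈ gateSide Γ₂ s₂ δ₂ σ →
      φ₁ z ∈ gateSide (Γ₂.transHomeomorph φ₁) s₂ δ₂ σ := fun h => by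
    rw [IsGate.gateSide_trans]; exact mem_image_of_mem _ h
  have hxQ : c₁ s ∉ gateBox (Γ₂.transHomeomorph φ₁) s₂ δ₂ := by
    rw [IsGate.gateBox_trans]
    rintro ⟨z, hz, hzs⟩
    have : z = c s := φ₁.injective hzs
    exact Set.disjoint_left.1 hdisj (G₁.curve_mem_box hs) (this ▸ hz)
  have hp₂R : ¬ Conn (range c)ᶜ p₂ R := fun h => hq₁R (hq₁p₂.trans h)
  have hq₂R : ¬ Conn (range c)ᶜ q₂ R := fun h => h0R (hq₂0.symm.trans h)
  have hxp : ∀ᶠ ε : ℝ in 𝓝[>] 0, Conn (range c₁)ᶜ (c₁ s - ε) (φ₁ p₂) := by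
    filter_upwards [hleft] with ε hε
    obtain ⟨z, hz, hze⟩ := hε
    have h1 : c₁ s - (ε : ℂ) = φ₁ z := hze.symm
    rw [h1, conn_comp_iff]
    exact (G₁.conn_side hz hq₁).trans hq₁p₂
  obtain ⟨φ₂, hφ₂, W₂, hW₂, hsupp₂, s', hs', hnear, ⟨v', hv', hvim'⟩, hleft'⟩ :=
    exists_pull_inner hc₁ (w := φ₁ R) (mem_range_self _) hfree
      (fun z hz => conn_of_ray hcR hsupp₁ hz) hρ₁ G₂' hσ₂ (himg hp₂) hxp
      (by rwa [conn_comp_iff]) (himg hq₂) (by rwa [conn_comp_iff]) (by rwa [conn_comp_iff]) hxQ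
  have h0V₂ : (0 : ℂ) ∉ W₂ := fun h => by
    rcases hW₂ h with h | h
    · have h1 := Conn.of_mem_component h
      rw [← hφ₁0, conn_comp_iff] at h1
      exact hq₂p₂ (hq₂0.trans h1.symm)
    · rw [IsGate.gateBox_trans] at h
      obtain ⟨z, hz, hz0⟩ := h
      rw [← hφ₁0] at hz0
      exact h02 (φ₁.injective hz0 ▸ hz)
  have hφ₂0 : φ₂ 0 = 0 := hsupp₂.apply_eq h0V₂
  set c₂ := φ₂ ∘ c₁ with hc₂d
  have hc₂ : Continuous c₂ := φ₂.continuous.comp hc₁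
  obtain ⟨ρ₂, hρ₂, ε₂, hε₂, hmono₂, huniq₂⟩ := (G₂'.comp hφ₂).exists_ball hs' hv' hvim'
  obtain ⟨ε, ⟨hε, hε0⟩, hερ⟩ := ((hleft'.and self_mem_nhdsWithin).and
      (Filter.Eventually.filter_mono nhdsWithin_le_nhds (gt_mem_nhds hρ₂))).exists
  have hε0' : (0 : ℝ) < ε := hε0
  set e : ℂ := φ₂ (c₁ s') - ε with hed
  have heim : e.im = (c₂ s').im := by simp [hed, hc₂d]
  have here : e.re = (c₂ s').re - ε := by simp [hed, hc₂d]
  have h0e : Conn (range c₂)ᶜ 0 e := by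
    obtain ⟨z, hz, hze⟩ := hε
    rw [IsGate.gateSide_trans] at hz
    obtain ⟨y, hy, rfl⟩ := hz
    rw [← hze]
    have : (0 : ℂ) = φ₂ (φ₁ 0) := by rw [hφ₁0, hφ₂0]
    rw [this, conn_comp_iff, conn_comp_iff]
    exact hq₂0.symm.trans (G₂.conn_side hq₂ hy)
  obtain ⟨φ₃, hφ₃, hsupp₃, ε₃, hε₃, htr⟩ :=
    Movable.of_conn (isCompact_range hc₂).isClosed.isOpen_compl h0e
  have hΩ : ∀ t, φ₃ (c₂ t) = c₂ t := fun t => hsupp₃.apply_eq fun h => h (mem_range_self t)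
  have hloc : ∀ᶠ y in 𝓝 (0 : ℂ), φ₁ y = y ∧ φ₂ y = y :=
    (hsupp₁.eventually_eq h0V₁).and (hsupp₂.eventually_eq h0V₂)
  obtain ⟨ε₄, hε₄, hb₄⟩ := Metric.eventually_nhds_iff_ball.1 hloc
  have hcase : ∀ t, (c₂ t).im = e.im → e.re < (c₂ t).re →
      (∃ u ∈ Ioo (s' - ε₂) (s' + ε₂), (u : UnitAddCircle) = t) ∨
      (c₁ t ∉ W₂ ∧ ∃ u ∈ Ioo (s - ε₁) (s + ε₁), (u : UnitAddCircle) = t) := by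
    intro t him hre
    rw [heim] at him
    rcases le_or_gt (c₂ t).re (c₂ s').re with hle | hlt
    · left
      refine huniq₂ t ?_
      rw [mem_ball, dist_eq_norm]
      have h3 : c₂ t - c₂ s' = (((c₂ t).re - (c₂ s').re : ℝ) : ℂ) := by
        apply Complex.ext <;> simp [him]
      change ‖c₂ t - c₂ s'‖ < ρ₂
      rw [h3, Complex.norm_real, Real.norm_eq_abs, abs_lt]
      constructor <;> linarith
    · right
      obtain ⟨h1, h2⟩ := hnear t him hlt
      exact ⟨h1, huniq₁ t h2⟩
  have hinj : ∀ {g : ℝ → ℝ} {I : Set ℝ}, MonotoneNear g I → InjOn g I := by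
    rintro g I (h | h)
    · exact h.injOn
    · exact h.injOn
  refine ⟨φ₁.trans (φ₂.trans φ₃), e, min ε₃ ε₄, lt_min hε₃ hε₄, ?_, ?_, ?_, ?_⟩
  · intro v hv
    rw [lt_min_iff] at hv
    obtain ⟨h1, h2⟩ := hb₄ v (by simpa using hv.2)
    have h3 := htr v hv.1
    rw [zero_add] at h3
    simp [h1, h2, h3]
  · exact (hsupp₁.mono (subset_univ _)).trans
      ((hsupp₂.mono (subset_univ _)).trans (hsupp₃.mono (subset_univ _)))
  · change {t | (φ₃ (c₂ t)).im = e.im ∧ e.re < (φ₃ (c₂ t)).re}.encard ≤ 2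
    simp only [hΩ]
    set S₁ : Set UnitAddCircle := {t | (c₂ t).im = e.im ∧
      ∃ u ∈ Ioo (s' - ε₂) (s' + ε₂), (u : UnitAddCircle) = t} with hS₁
    set S₂ : Set UnitAddCircle := {t | (c₂ t).im = e.im ∧ c₁ t ∉ W₂ ∧
      ∃ u ∈ Ioo (s - ε₁) (s + ε₁), (u : UnitAddCircle) = t} with hS₂
    have hsub : {t | (c₂ t).im = e.im ∧ e.re < (c₂ t).re} ⊆ S₁ ∪ S₂ := by
      rintro t ⟨h1, h2⟩
      rcases hcase t h1 h2 with h | ⟨h, h'⟩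
      · exact Or.inl ⟨h1, h⟩
      · exact Or.inr ⟨h1, h, h'⟩
    -- the imaginary part is injective on each of the two arcs
    have e1 : S₁.encard ≤ 1 := by
      rw [encard_le_one_iff]
      rintro _ _ ⟨h1, u, hu, rfl⟩ ⟨h2, u', hu', rfl⟩
      have h3 := hinj hmono₂ hu hu' (h1.trans h2.symm)
      rw [h3]
    have e2 : S₂.encard ≤ 1 := by
      rw [encard_le_one_iff]
      rintro _ _ ⟨h1, hW, u, hu, rfl⟩ ⟨h2, hW', u', hu', rfl⟩
      have k1 : c₂ u = c₁ u := hsupp₂.apply_eq hW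
      have k2 : c₂ u' = c₁ u' := hsupp₂.apply_eq hW'
      rw [k1] at h1
      rw [k2] at h2
      have h3 := hinj hmono₁ hu hu' (h1.trans h2.symm)
      rw [h3]
    calc _ ≤ (S₁ ∪ S₂).encard := encard_le_encard hsub
      _ ≤ S₁.encard + S₂.encard := encard_union_le _ _
      _ ≤ 1 + 1 := add_le_add e1 e2
      _ = 2 := by norm_num
  · intro t
    change (φ₃ (c₂ t)).im = e.im → e.re < (φ₃ (c₂ t)).re → ∃ s : ℝ, (s : UnitAddCircle) = t ∧
      ∃ ε > 0, MonotoneNear (fun u : ℝ => (φ₃ (c₂ u)).im) (Ioo (s - ε) (s + ε))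
    simp only [hΩ]
    have hshrink : ∀ {g g' : ℝ → ℝ} {u : ℝ} {I : Set ℝ}, MonotoneNear g I → IsOpen I → u ∈ I →
        (∀ᶠ y in 𝓝 u, g' y = g y) → ∃ ε > 0, MonotoneNear g' (Ioo (u - ε) (u + ε)) := by
      intro g g' u I hg hI hu hev
      obtain ⟨ε, hε, hb⟩ := Metric.eventually_nhds_iff_ball.1 (hev.and (hI.mem_nhds hu))
      rw [Real.ball_eq_Ioo] at hb
      refine ⟨ε, hε, ?_⟩
      have hEq : EqOn g g' (Ioo (u - ε) (u + ε)) := fun y hy => (hb y hy).1.symm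
      rcases hg with hg | hg
      · exact Or.inl ((hg.mono fun y hy => (hb y hy).2).congr hEq)
      · exact Or.inr ((hg.mono fun y hy => (hb y hy).2).congr hEq)
    intro him hre
    rcases hcase t him hre with ⟨u, hu, rfl⟩ | ⟨hW, u, hu, rfl⟩
    · exact ⟨u, rfl, hshrink hmono₂ isOpen_Ioo hu (Eventually.of_forall fun y => rfl)⟩
    · refine ⟨u, rfl, hshrink hmono₁ isOpen_Ioo hu ?_⟩
      have hcont : Continuous fun y : ℝ => c₁ y := hc₁.comp (AddCircle.continuous_mk' 1)
      filter_upwards [hcont.continuousAt.eventually (hsupp₂.eventually_eq hW)] with y hy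
      change (φ₂ (c₁ y)).im = (c₁ y).im
      rw [hy]

/-! ### Curves of wrapping number two -/

lemma ArcIn.of_conn_compl {c : UnitAddCircle → ℂ} (hc : Continuous c) {a b : ℂ}
    (h : Conn (range c)ᶜ a b) : ArcIn (range c)ᶜ a b :=
  ArcIn.of_conn (isCompact_range hc).isClosed.isOpen_compl h

/-- A curve that does not separate `0` from infinity has wrapping number zero. -/
lemma not_conn_of_one_lt {c : UnitAddCircle → ℂ} (hc : Continuous c) {r R : ℝ} (hr : 0 < r)
    (hrR : r < R) (hwrap : 1 < curveWrappingNumber r R c) : ¬ Conn (range c)ᶜ 0 R := by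
  intro h
  have h1 := curveWrappingNumber_le (c := c) hr hrR (by simpa using le_abs_self R)
    (ArcIn.of_conn_compl hc h) (by
      rw [Set.disjoint_left]
      rintro z hz ⟨s, t, -, hs, -⟩
      exact hz ⟨s, hs⟩)
  rw [compl_inter_self, encard_empty] at h1
  exact absurd (hwrap.trans_le h1) (by simp)

/-- If the wrapping number exceeds one, a path from `0` to infinity cannot cross the curve only
through one gate. -/
lemma IsGate.not_conn {c : UnitAddCircle → ℂ} (hc : Continuous c) {r R : ℝ} (hr : 0 < r)
    (hrR : r < R) (hwrap : 1 < curveWrappingNumber r R c) (h0K : (0 : ℂ) ∉ range c)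
    (hRK : (R : ℂ) ∉ range c) {s₀ δ : ℝ} {Γ : OpenPartialHomeomorph (ℝ × ℝ) ℂ}
    (G : IsGate c s₀ δ Γ) : ¬ Conn ((range c)ᶜ ∪ gateBox Γ s₀ δ) 0 R := by
  intro h
  have hKo : IsOpen (range c)ᶜ := (isCompact_range hc).isClosed.isOpen_compl
  -- cross the gate along a vertical segment of the chart, which meets the curve in `c s₀` only
  have hcross : ∀ p ∈ gateSide Γ s₀ δ 1, ∀ q ∈ gateSide Γ s₀ δ (-1),
      ArcIn ((range c)ᶜ ∪ {c s₀}) p q := by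
    intro p hp q hq
    have hmem : ∀ u : unitInterval,
        (s₀, δ * (1 / 2 - u)) ∈ Ioo (s₀ - δ) (s₀ + δ) ×ˢ Ioo (-δ) δ := by
      intro u
      have h1 := u.2.1
      have h2 := u.2.2
      have := G.pos
      refine ⟨G.center_mem, ?_, ?_⟩ <;> simp only <;> nlinarith
    have hδ := G.pos
    have harc : ArcIn ((range c)ᶜ ∪ {c s₀}) (Γ (s₀, δ * (1 / 2))) (Γ (s₀, δ * (-1 / 2))) := by
      refine Or.inr ⟨fun u => Γ (s₀, δ * (1 / 2 - u)), ?_, ?_, by simp, ?_, ?_⟩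
      · refine Γ.continuousOn.comp_continuous (by fun_prop) fun u => G.box (hmem u)
      · intro u v huv
        have h1 := Γ.injOn (G.box (hmem u)) (G.box (hmem v)) huv
        have h2 : δ * (1 / 2 - (u : ℝ)) = δ * (1 / 2 - v) := congrArg Prod.snd h1
        have h3 := mul_left_cancel₀ hδ.ne' h2
        exact Subtype.ext (by linarith)
      · norm_num
      · rintro _ ⟨u, rfl⟩
        by_cases hu : δ * (1 / 2 - (u : ℝ)) = 0
        · right
          change Γ (s₀, δ * (1 / 2 - (u : ℝ))) = _
          rw [hu]
          exact G.curve s₀ G.center_mem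
        · left
          rcases lt_or_gt_of_ne hu with hu | hu
          · exact G.side_disjoint (-1) ⟨_, ⟨(hmem u).1, (hmem u).2, by simpa using hu⟩, rfl⟩
          · exact G.side_disjoint 1 ⟨_, ⟨(hmem u).1, (hmem u).2, by simpa using hu⟩, rfl⟩
    have hp' : Γ (s₀, δ * (1 / 2)) ∈ gateSide Γ s₀ δ 1 := by
      refine ⟨_, ⟨G.center_mem, ⟨?_, ?_⟩, ?_⟩, rfl⟩ <;> simp only <;> linarith
    have hq' : Γ (s₀, δ * (-1 / 2)) ∈ gateSide Γ s₀ δ (-1) := by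
      refine ⟨_, ⟨G.center_mem, ⟨?_, ?_⟩, ?_⟩, rfl⟩ <;> simp only <;> linarith
    exact (((ArcIn.of_conn_compl hc (G.conn_side hp hp')).mono subset_union_left).trans harc).trans
      ((ArcIn.of_conn_compl hc (G.conn_side hq' hq)).mono subset_union_left)
  have hno : ¬ ArcIn ((range c)ᶜ ∪ {c s₀}) 0 R := by
    intro harc
    have h1 := curveWrappingNumber_le (c := c) hr hrR (by simpa using le_abs_self R) harc (by
        rw [Set.disjoint_left]
        rintro z hz ⟨s, t, hst, hs, ht⟩
        rcases hz with hz | hz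
        · exact hz ⟨s, hs⟩
        · rw [mem_singleton_iff] at hz
          exact G.simple s₀ G.center_mem ⟨s, t, hst, hs.trans hz, ht.trans hz⟩)
    have h2 : (((range c)ᶜ ∪ {c s₀}) ∩ range c).encard ≤ 1 := by
      rw [union_inter_distrib_right, compl_inter_self, empty_union]
      exact (encard_le_encard inter_subset_left).trans (by simp)
    exact absurd (hwrap.trans_le (h1.trans h2)) (lt_irrefl _)
  rcases conn_or_split hKo G.isOpen_box (G.isPreconnected_side 1) (G.side_disjoint 1)
    (G.isPreconnected_side (-1)) (G.side_disjoint (-1))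
    (by rw [compl_compl]; exact G.box_subset) h0K hRK h with h | ⟨p, hp, q, hq, h1, h2⟩ |
      ⟨p, hp, q, hq, h1, h2⟩
  · exact not_conn_of_one_lt hc hr hrR hwrap h
  · exact hno ((((ArcIn.of_conn_compl hc h1).mono subset_union_left).trans (hcross p hp q hq)).trans
      ((ArcIn.of_conn_compl hc h2).mono subset_union_left))
  · exact hno ((((ArcIn.of_conn_compl hc h1).mono subset_union_left).trans
      (hcross q hq p hp).symm).trans ((ArcIn.of_conn_compl hc h2).mono subset_union_left))

lemma IsGate.conn_box {c : UnitAddCircle → ℂ} {s₀ δ : ℝ} {Γ : OpenPartialHomeomorph (ℝ × ℝ) ℂ}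
    (G : IsGate c s₀ δ Γ) {p q : ℂ} {σ τ : ℝ} (hp : p ∈ gateSide Γ s₀ δ σ)
    (hq : q ∈ gateSide Γ s₀ δ τ) : Conn ((range c)ᶜ ∪ gateBox Γ s₀ δ) p q :=
  Conn.of_preconnected G.isPreconnected_box subset_union_right (IsGate.side_subset_box _ _ _ _ hp)
    (IsGate.side_subset_box _ _ _ _ hq)

/-- If `0` can be connected to infinity through two gates, but not through one of them, then these
gates separate a chain of regions, in one order or the other. -/
lemma crossesRayTwice_of_gates {c : UnitAddCircle → ℂ} (hc : Continuous c) {r R : ℝ} (hr : 0 < r)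
    (hrR : r < R) (hcR : ∀ t, ‖c t‖ < R) (hwrap : 1 < curveWrappingNumber r R c)
    (h0K : (0 : ℂ) ∉ range c)
    {s₁ δ₁ s₂ δ₂ : ℝ} {Γ₁ Γ₂ : OpenPartialHomeomorph (ℝ × ℝ) ℂ}
    (G₁ : IsGate c s₁ δ₁ Γ₁) (G₂ : IsGate c s₂ δ₂ Γ₂)
    (hdisj : Disjoint (gateBox Γ₁ s₁ δ₁) (gateBox Γ₂ s₂ δ₂))
    (h01 : (0 : ℂ) ∉ gateBox Γ₁ s₁ δ₁) (h02 : (0 : ℂ) ∉ gateBox Γ₂ s₂ δ₂)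
    (h : Conn ((range c)ᶜ ∪ gateBox Γ₁ s₁ δ₁ ∪ gateBox Γ₂ s₂ δ₂) 0 R) : CrossesRayTwice c := by
  have hKo : IsOpen (range c)ᶜ := (isCompact_range hc).isClosed.isOpen_compl
  have hR0 : 0 < R := hr.trans hrR
  have hRK : (R : ℂ) ∉ range c := by
    rintro ⟨t, ht⟩
    have := hcR t
    rw [ht, Complex.norm_real, Real.norm_eq_abs, abs_of_pos hR0] at this
    exact lt_irrefl _ this
  have E₁ := G₁.not_conn hc hr hrR hwrap h0K hRK
  have E₂ := G₂.not_conn hc hr hrR hwrap h0K hRK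
  have E := not_conn_of_one_lt hc hr hrR hwrap
  have up : ∀ {Q : Set ℂ} {a b : ℂ}, Conn (range c)ᶜ a b → Conn ((range c)ᶜ ∪ Q) a b :=
    fun h => h.mono subset_union_left
  -- the chain from `0` through `(s, Γ)` and `(s', Γ')` to infinity
  have chain : ∀ {s δ s' δ' : ℝ} {Γ Γ' : OpenPartialHomeomorph (ℝ × ℝ) ℂ} (_ : IsGate c s δ Γ)
      (_ : IsGate c s' δ' Γ') (_ : Disjoint (gateBox Γ s δ) (gateBox Γ' s' δ'))
      (_ : (0 : ℂ) ∉ gateBox Γ s δ) (_ : (0 : ℂ) ∉ gateBox Γ' s' δ')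
      (_ : ¬ Conn ((range c)ᶜ ∪ gateBox Γ s δ) 0 R)
      (_ : ¬ Conn ((range c)ᶜ ∪ gateBox Γ' s' δ') 0 R)
      (σ : ℝ) (_ : σ = 1 ∨ σ = -1) (τ : ℝ) (_ : τ = 1 ∨ τ = -1) (q₂ p₂ q₁ p₁ : ℂ)
      (_ : Conn (range c)ᶜ 0 q₂) (_ : q₂ ∈ gateSide Γ s δ (-σ)) (_ : p₂ ∈ gateSide Γ s δ σ)
      (_ : Conn (range c)ᶜ p₂ q₁) (_ : q₁ ∈ gateSide Γ' s' δ' (-τ)) (_ : p₁ ∈ gateSide Γ' s' δ' τ)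
      (_ : Conn (range c)ᶜ p₁ R), CrossesRayTwice c := by
    intro s δ s' δ' Γ Γ' G G' hd h0 h0' e e' σ hσ τ hτ q₂ p₂ q₁ p₁ k1 k2 k3 k4 k5 k6 k7
    refine crossesRayTwice_of_chain hc hcR G' G hd.symm h0' h0 hτ hσ k6 k5 k3 k2 k7 k4.symm k1.symm
      ?_ ?_ E
    · exact fun h => e ((up k1).trans ((G.conn_box k2 k3).trans (up (k4.trans h))))
    · exact fun h => e' ((up (k1.trans (h.trans k4))).trans ((G'.conn_box k5 k6).trans (up k7)))
  -- the second gate splits the path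
  have split₂ : ∃ σ : ℝ, (σ = 1 ∨ σ = -1) ∧ ∃ p ∈ gateSide Γ₂ s₂ δ₂ (-σ), ∃ q ∈ gateSide Γ₂ s₂ δ₂ σ,
      Conn ((range c)ᶜ ∪ gateBox Γ₁ s₁ δ₁) 0 p ∧ Conn ((range c)ᶜ ∪ gateBox Γ₁ s₁ δ₁) q R := by
    rcases conn_or_split (hKo.union G₁.isOpen_box) G₂.isOpen_box (G₂.isPreconnected_side 1)
      ((G₂.side_disjoint 1).trans subset_union_left) (G₂.isPreconnected_side (-1))
      ((G₂.side_disjoint (-1)).trans subset_union_left)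
      (by
        intro z hz
        rcases G₂.box_subset hz with h | h
        · exact Or.inl h
        · refine Or.inr ?_
          rintro (h' | h')
          · exact h' h
          · exact Set.disjoint_left.1 hdisj h' hz) (Or.inl h0K) (Or.inl hRK) h with
      h | ⟨p, hp, q, hq, h1, h2⟩ | ⟨p, hp, q, hq, h1, h2⟩
    · exact absurd h E₁
    · exact ⟨-1, Or.inr rfl, p, by simpa using hp, q, hq, h1, h2⟩
    · exact ⟨1, Or.inl rfl, p, hp, q, hq, h1, h2⟩
  -- the first gate splits the two parts
  have split₁ : ∀ a b : ℂ, a ∉ range c → b ∉ range c → Conn ((range c)ᶜ ∪ gateBox Γ₁ s₁ δ₁) a b →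
      Conn (range c)ᶜ a b ∨ ∃ σ : ℝ, (σ = 1 ∨ σ = -1) ∧ ∃ p ∈ gateSide Γ₁ s₁ δ₁ (-σ),
        ∃ q ∈ gateSide Γ₁ s₁ δ₁ σ, Conn (range c)ᶜ a p ∧ Conn (range c)ᶜ q b := by
    intro a b ha hb hab
    rcases conn_or_split hKo G₁.isOpen_box (G₁.isPreconnected_side 1) (G₁.side_disjoint 1)
      (G₁.isPreconnected_side (-1)) (G₁.side_disjoint (-1))
      (by rw [compl_compl]; exact G₁.box_subset) ha hb hab with
      h | ⟨p, hp, q, hq, h1, h2⟩ | ⟨p, hp, q, hq, h1, h2⟩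
    · exact Or.inl h
    · exact Or.inr ⟨-1, Or.inr rfl, p, by simpa using hp, q, hq, h1, h2⟩
    · exact Or.inr ⟨1, Or.inl rfl, p, hp, q, hq, h1, h2⟩
  obtain ⟨σ, hσ, p, hp, q, hq, hpc, hqc⟩ := split₂
  rcases split₁ 0 p h0K (G₂.side_disjoint _ hp) hpc with h1 | ⟨τ, hτ, p₁, hp₁, q₁, hq₁, h1, h1'⟩ <;>
  rcases split₁ q R (G₂.side_disjoint _ hq) hRK hqc with h2 | ⟨τ', hτ', p₂, hp₂, q₂, hq₂, h2, h2'⟩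
  · exact absurd ((up h1).trans ((G₂.conn_box hp hq).trans (up h2))) E₂
  · exact chain G₂ G₁ hdisj.symm h02 h01 E₂ E₁ σ hσ τ' hτ' p q p₂ q₂ h1 hp hq h2 hp₂ hq₂ h2'
  · exact chain G₁ G₂ hdisj h01 h02 E₁ E₂ τ hτ σ hσ p₁ q₁ p q h1 hp₁ hq₁ h1' hp hq h2
  · exact absurd ((up h1).trans ((G₁.conn_box hp₁ hq₂).trans (up h2'))) E₁

/-- A function on a compact set that is constant on the fibers of a continuous map factors
continuously through this map. -/
lemma exists_continuousOn_factor {α β γ : Type*} [TopologicalSpace α] [TopologicalSpace β]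
    [T2Space β] [TopologicalSpace γ] [Nonempty γ] {S : Set α} (hS : IsCompact S) {g : α → β}
    (hg : ContinuousOn g S) {L : α → γ} (hL : ContinuousOn L S)
    (h : ∀ u ∈ S, ∀ v ∈ S, g u = g v → L u = L v) :
    ∃ l : β → γ, ContinuousOn l (g '' S) ∧ ∀ u ∈ S, l (g u) = L u := by
  classical
  let l : β → γ := fun z => if hz : ∃ u ∈ S, g u = z then L hz.choose else Classical.arbitrary γ
  have hl : ∀ u ∈ S, l (g u) = L u := by
    intro u hu
    have hz : ∃ v ∈ S, g v = g u := ⟨u, hu, rfl⟩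
    simp only [l, dif_pos hz]
    exact h _ hz.choose_spec.1 _ hu hz.choose_spec.2
  refine ⟨l, ?_, hl⟩
  rw [continuousOn_iff_isClosed]
  intro F hF
  obtain ⟨u, hu, hSu⟩ := continuousOn_iff_isClosed.1 hL F hF
  refine ⟨g '' (S ∩ u), ((hS.inter_right hu).image_of_continuousOn
    (hg.mono inter_subset_left)).isClosed, ?_⟩
  ext z
  constructor
  · rintro ⟨hz1, v, hv, rfl⟩
    refine ⟨⟨v, ⟨hv, ?_⟩, rfl⟩, v, hv, rfl⟩
    have h1 : v ∈ L ⁻¹' F ∩ S := ⟨by rw [mem_preimage, ← hl v hv]; exact hz1, hv⟩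
    rw [hSu] at h1
    exact h1.1
  · rintro ⟨⟨v, ⟨hv, hvu⟩, rfl⟩, -⟩
    have h1 : v ∈ u ∩ S := ⟨hvu, hv⟩
    rw [← hSu] at h1
    exact ⟨by rw [mem_preimage, hl v hv]; exact h1.1, v, hv, rfl⟩

/-- A piecewise smooth closed curve is smooth at almost all parameters. -/
lemma IsPiecewiseSmooth.exists_countable {E : Type*} [NormedAddCommGroup E] [NormedSpace ℝ E]
    {c : UnitAddCircle → E} (hc : IsPiecewiseSmooth c) :
    ∃ B : Set ℝ, B.Countable ∧ ∀ u ∉ B, ContDiffAt ℝ ∞ (fun u : ℝ => c u) u := by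
  obtain ⟨-, n, t, hmono, ht0, ht1, hsm⟩ := hc
  refine ⟨⋃ p : Fin (n + 1) × ℤ, {t p.1 + p.2}, countable_iUnion fun _ => countable_singleton _, ?_⟩
  intro u hu
  simp only [mem_iUnion, mem_singleton_iff, not_exists] at hu
  set v := Int.fract u with hv
  have huv : u = v + ⌊u⌋ := (Int.fract_add_floor u).symm
  have hvt : ∀ i, v ≠ t i := fun i hi => hu (i, ⌊u⌋) (by rw [← hi]; exact huv)
  have h0 : t 0 < v := by
    rw [ht0]
    exact lt_of_le_of_ne (Int.fract_nonneg u) (fun h => hvt 0 (by rw [ht0]; exact h.symm))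
  have h1 : v < t (Fin.last n) := by rw [ht1]; exact Int.fract_lt_one u
  obtain ⟨i, hi1, hi2⟩ : ∃ i : Fin n, t i.castSucc < v ∧ v < t i.succ := by
    by_contra hno
    push Not at hno
    have : ∀ i : Fin (n + 1), t i < v := by
      intro i
      induction i using Fin.induction with
      | zero => exact h0
      | succ i ih => exact lt_of_le_of_ne (hno i ih) (hvt _).symm
    exact absurd (this (Fin.last n)) (not_lt.2 h1.le)
  have h2 : ContDiffAt ℝ ∞ (fun u : ℝ => c u) v :=
    (hsm i).contDiffAt (Icc_mem_nhds hi1 hi2)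
  obtain ⟨k, hk⟩ : ∃ k : ℤ, k = ⌊u⌋ := ⟨_, rfl⟩
  have h3 : (fun u : ℝ => c (u : UnitAddCircle)) =
      (fun u : ℝ => c (u : UnitAddCircle)) ∘ fun u : ℝ => u - (k : ℝ) := by
    funext y
    simp only [Function.comp]
    congr 1
    rw [AddCircle.coe_sub]
    have : ((k : ℝ) : UnitAddCircle) = 0 := by
      rw [AddCircle.coe_eq_zero_iff]; exact ⟨k, by simp⟩
    rw [this, sub_zero]
  rw [h3]
  refine ContDiffAt.comp u ?_ (by fun_prop)
  have : u - (k : ℝ) = v := by rw [hk]; rfl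
  rw [this]
  exact h2

/-- Near a parameter around which the curve has no multiple points, there are parameters at which
it is smooth with nonzero velocity. -/
lemma IsPiecewiseSmooth.exists_regular {c : UnitAddCircle → ℂ} (hc : IsPiecewiseSmooth c) {a b : ℝ}
    (hab : a < b) (hs : ∀ u ∈ Ioo a b, c u ∉ multiplePoints c) :
    ∃ s ∈ Ioo a b, ContDiffAt ℝ 1 (fun u : ℝ => c u) s ∧ deriv (fun u : ℝ => c u) s ≠ 0 := by
  obtain ⟨B, hB, hsm⟩ := hc.exists_countable
  obtain ⟨s₀, hs₀B, hs₀⟩ := (hB.dense_compl ℝ).exists_mem_open isOpen_Ioo (nonempty_Ioo.2 hab)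
  have h1 : ContDiffAt ℝ 1 (fun u : ℝ => c u) s₀ := (hsm s₀ hs₀B).of_le (by exact_mod_cast le_top)
  obtain ⟨ε, hε, hb⟩ := Metric.eventually_nhds_iff_ball.1
    ((h1.eventually (by simp)).and (isOpen_Ioo.mem_nhds hs₀))
  by_contra hno
  push Not at hno
  set ε' := min ε (1 / 2) with hε'
  have hε'0 : 0 < ε' := lt_min hε (by norm_num)
  have hb' : ∀ u ∈ ball s₀ ε', _ := fun u hu => hb u (ball_subset_ball (min_le_left _ _) hu)
  have hmem : s₀ + ε' / 2 ∈ ball s₀ ε' := by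
    rw [Real.ball_eq_Ioo]; constructor <;> linarith
  have hconst := isOpen_ball.is_const_of_deriv_eq_zero (s := ball s₀ ε')
    (f := fun u : ℝ => c (u : UnitAddCircle))
    (convex_ball s₀ ε').isPreconnected
    (fun u hu => ((hb' u hu).1.differentiableAt one_ne_zero).differentiableWithinAt)
    (fun u hu => hno u (hb' u hu).2 (hb' u hu).1) (mem_ball_self hε'0) hmem
  refine hs s₀ hs₀ ⟨(s₀ : ℝ), ((s₀ + ε' / 2 : ℝ) : UnitAddCircle), ?_, rfl, hconst.symm⟩
  intro h
  have := (AddCircle.coe_eq_coe_iff_of_mem_Ico (p := (1 : ℝ)) (a := s₀) ⟨le_rfl, by linarith⟩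
    ⟨by linarith, by linarith [min_le_right ε (1 / 2)]⟩).1 h
  linarith

lemma exists_rep (t : UnitAddCircle) (a : ℝ) : ∃ u ∈ Ico a (a + 1), (u : UnitAddCircle) = t := by
  have := AddCircle.coe_image_Ico_eq (1 : ℝ) a
  have h : t ∈ (QuotientAddGroup.mk '' Ico a (a + 1) : Set UnitAddCircle) := by
    rw [this]; exact mem_univ t
  exact h

lemma coe_inj {a u v : ℝ} (hu : u ∈ Ico a (a + 1)) (hv : v ∈ Ico a (a + 1))
    (h : (u : UnitAddCircle) = v) : u = v :=
  (AddCircle.coe_eq_coe_iff_of_mem_Ico hu hv).1 h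

lemma coe_add_one (u : ℝ) : ((u + 1 : ℝ) : UnitAddCircle) = u := by
  rw [AddCircle.coe_add, AddCircle.coe_period, add_zero]

/-- A curve of wrapping number two admits an arc that joins `0` to infinity and meets the curve
exactly twice. -/
lemma exists_conn_of_curveWrappingNumber {c : UnitAddCircle → ℂ} {r R : ℝ} (hr : 0 < r)
    (hrR : r < R) (hcr : ∀ t, r < ‖c t‖) (hcR : ∀ t, ‖c t‖ < R)
    (hwrap : curveWrappingNumber r R c = 2) :
    ∃ x ∈ range c, ∃ y ∈ range c, x ≠ y ∧ x ∉ multiplePoints c ∧ y ∉ multiplePoints c ∧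
      Conn (range c \ {x, y})ᶜ 0 R := by
  have hR0 : 0 < R := hr.trans hrR
  have hne : {k | ∃ a : Set ℂ, IsSpanningArc r R a ∧ Disjoint a (multiplePoints c) ∧
    k = (a ∩ range c).encard}.Nonempty := by
    by_contra h
    rw [not_nonempty_iff_eq_empty] at h
    rw [curveWrappingNumber, h, sInf_empty] at hwrap
    exact absurd hwrap (by decide)
  obtain ⟨a, ha, hdisj, hk⟩ := csInf_mem hne
  have hk' : (a ∩ range c).encard = 2 := by rw [← hk]; exact hwrap
  obtain ⟨x, y, hxy, hset⟩ := encard_eq_two.1 hk'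
  have hx : x ∈ a ∩ range c := by rw [hset]; simp
  have hy : y ∈ a ∩ range c := by rw [hset]; simp
  refine ⟨x, hx.2, y, hy.2, hxy, Set.disjoint_left.1 hdisj hx.1, Set.disjoint_left.1 hdisj hy.1, ?_⟩
  obtain ⟨f, hf, -, hf0, hf1, rfl, -⟩ := ha
  have h1 : Conn (range c \ {x, y})ᶜ 0 (f 0) := by
    refine conn_segment fun z hz => ?_
    rintro ⟨⟨t, rfl⟩, -⟩
    have h2 : c t ∈ closedBall (0 : ℂ) r := (convex_closedBall (0 : ℂ) r).segment_subset
      (by simp [hr.le]) (by simp [hf0]) hz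
    rw [mem_closedBall_zero_iff] at h2
    exact absurd (hcr t) (not_lt.2 h2)
  have h2 : Conn (range c \ {x, y})ᶜ (f 0) (f 1) := by
    refine Conn.of_preconnected (isPreconnected_range hf) ?_ (mem_range_self 0) (mem_range_self 1)
    rintro z hz ⟨hzc, hzn⟩
    have h3 : z ∈ range f ∩ range c := ⟨hz, hzc⟩
    rw [hset] at h3
    exact hzn h3
  have h3 : Conn (range c \ {x, y})ᶜ (f 1) R := by
    refine Conn.of_preconnected (isPreconnected_outside R) ?_ hf1.ge (by simp [abs_of_pos hR0])
    rintro z hz ⟨⟨t, rfl⟩, -⟩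
    exact absurd (hcR t) (not_lt.2 hz)
  exact h1.trans (h2.trans h3)

/-- The gap through which `0` is connected to infinity can be moved along the curve within simple
arcs: a logarithm on a smaller part of the curve extends along simple arcs. -/
lemma conn_compl_of_arcs {c : UnitAddCircle → ℂ} (hc : Continuous c) {R : ℝ} (hR0 : 0 < R)
    (hcR : ∀ t, ‖c t‖ < R) (h0 : ∀ t, c t ≠ 0) {a₁ a₂ b₁ b₂ a₁' a₂' b₁' b₂' : ℝ}
    (ha1 : a₁ < a₁') (ha2 : a₂' < a₂) (hb1 : b₁ < b₁') (hb2 : b₂' < b₂)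
    (ha : a₁' < a₂') (hab : a₂' < b₁') (hb : b₁' < b₂')
    (hba : b₂' < a₁' + 1)
    (hsa : ∀ u ∈ Ioo a₁ a₂, c u ∉ multiplePoints c) (hsb : ∀ u ∈ Ioo b₁ b₂, c u ∉ multiplePoints c)
    (h : Conn ((fun u : ℝ => c u) '' (Icc a₂ b₁ ∪ Icc b₂ (a₁ + 1)))ᶜ 0 R) :
    Conn ((fun u : ℝ => c u) '' (Icc a₂' b₁' ∪ Icc b₂' (a₁' + 1)))ᶜ 0 R := by
  set γ : ℝ → ℂ := fun u => c u with hγ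
  have hγc : Continuous γ := hc.comp (AddCircle.continuous_mk' 1)
  have hnorm : ‖(R : ℂ)‖ = R := by simp [abs_of_pos hR0]
  obtain ⟨l, hl, hle⟩ := exists_log_of_conn_compl
    ((isCompact_Icc.union isCompact_Icc).image hγc) (by
      rintro _ ⟨u, -, rfl⟩; rw [hnorm]; exact hcR u) h
  obtain ⟨lam, hlam, hlame⟩ := exists_continuous_log hγc (fun u => h0 u)
  have hlγ : ContinuousOn (fun u => l (γ u)) (Icc a₂ b₁ ∪ Icc b₂ (a₁ + 1)) :=
    hl.comp hγc.continuousOn (mapsTo_image _ _)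
  obtain ⟨n, hn⟩ := exists_int_sub_eq isPreconnected_Icc (hlγ.mono subset_union_left)
    hlam.continuousOn (fun u hu => by
      rw [hle _ (mem_image_of_mem _ (Or.inl hu)), hlame])
  obtain ⟨m, hm⟩ := exists_int_sub_eq isPreconnected_Icc (hlγ.mono subset_union_right)
    hlam.continuousOn (fun u hu => by
      rw [hle _ (mem_image_of_mem _ (Or.inr hu)), hlame])
  set S := Icc a₂' b₁' ∪ Icc b₂' (a₁' + 1) with hS
  -- along the curve, `l` differs from the logarithm `lam` of the whole curve by constants on the
  -- two smaller arcs, and `L` keeps these constants on the two larger arcs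
  let L : ℝ → ℂ := fun u => lam u + (if u ≤ b₁' then (n : ℂ) else m) * (2 * Real.pi * Complex.I)
  have hLexp : ∀ u, Complex.exp (L u) = γ u := by
    intro u
    simp only [L]
    split_ifs
    · rw [Complex.exp_add, Complex.exp_int_mul_two_pi_mul_I, mul_one, hlame]
    · rw [Complex.exp_add, Complex.exp_int_mul_two_pi_mul_I, mul_one, hlame]
  have hLc : ContinuousOn L S := by
    refine ContinuousOn.union_of_isClosed ?_ ?_ isClosed_Icc isClosed_Icc
    · refine ContinuousOn.congr (f := fun u => lam u + (n : ℂ) * (2 * Real.pi * Complex.I))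
        (by fun_prop) fun u hu => ?_
      simp only [L, if_pos hu.2]
    · refine ContinuousOn.congr (f := fun u => lam u + (m : ℂ) * (2 * Real.pi * Complex.I))
        (by fun_prop) fun u hu => ?_
      simp only [L, if_neg (not_le.2 (hb.trans_le hu.1))]
  -- at multiple points, `L` is given by the logarithm `l`
  have hLl : ∀ u ∈ S, γ u ∈ multiplePoints c → L u = l (γ u) := by
    rintro u (hu | hu) hmul
    · have h1 : a₂ ≤ u := by
        by_contra hlt
        exact hsa u ⟨(ha1.trans ha).trans_le hu.1, not_le.1 hlt⟩ hmul
      have h2 : u ≤ b₁ := by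
        by_contra hlt
        exact hsb u ⟨not_le.1 hlt, (hu.2.trans_lt hb).trans hb2⟩ hmul
      simp only [L, if_pos hu.2]
      exact (hn u ⟨h1, h2⟩).symm
    · have h1 : b₂ ≤ u := by
        by_contra hlt
        exact hsb u ⟨(hb1.trans hb).trans_le hu.1, not_le.1 hlt⟩ hmul
      have h2 : u ≤ a₁ + 1 := by
        by_contra hlt
        have h3 : c ((u - 1 : ℝ) : UnitAddCircle) = γ u := by
          rw [← coe_add_one, sub_add_cancel]
        refine hsa (u - 1) ⟨by linarith, by linarith [hu.2]⟩ ?_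
        rw [h3]; exact hmul
      simp only [L, if_neg (not_le.2 (hb.trans_le hu.1))]
      exact (hm u ⟨h1, h2⟩).symm
  have hSsub : S ⊆ Ico a₂' (a₂' + 1) := by
    rintro u (hu | hu)
    · exact ⟨hu.1, by linarith [hu.2]⟩
    · exact ⟨by linarith [hu.1], by linarith [hu.2]⟩
  obtain ⟨f, hf, hfL⟩ := exists_continuousOn_factor (isCompact_Icc.union isCompact_Icc)
    hγc.continuousOn hLc (by
      intro u hu v hv huv
      by_cases he : u = v
      · rw [he]
      have hne : (u : UnitAddCircle) ≠ v := fun h => he (coe_inj (hSsub hu) (hSsub hv) h)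
      rw [hLl u hu ⟨u, v, hne, rfl, huv.symm⟩, hLl v hv ⟨u, v, hne, huv, rfl⟩, huv])
  refine conn_compl_of_log ((isCompact_Icc.union isCompact_Icc).image hγc) hf ?_ ?_ ?_
  · rintro _ ⟨u, hu, rfl⟩
    rw [hfL u hu, hLexp]
  · rintro _ ⟨u, -, rfl⟩
    rw [hnorm]; exact hcR u
  · exact_mod_cast hR0.ne'

/-- A curve of wrapping number two can be moved so that some ray crosses it twice: the points in
which an arc meets the curve are exchanged for nearby smooth points, and gates around these points
separate a chain of regions from `0` to infinity. -/
theorem crossesRayTwice_of_curveWrappingNumber {c : UnitAddCircle → ℂ} (hreg : IsRegularCurve c)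
    {r R : ℝ} (hr : 0 < r) (hrR : r < R) (hcr : ∀ t, r < ‖c t‖) (hcR : ∀ t, ‖c t‖ < R)
    (hwrap : curveWrappingNumber r R c = 2) : CrossesRayTwice c := by
  have hc : Continuous c := hreg.piecewiseSmooth.1
  have hR0 : 0 < R := hr.trans hrR
  have h0 : ∀ t, c t ≠ 0 := fun t h => by
    have := hcr t
    rw [h, norm_zero] at this
    linarith
  set γ : ℝ → ℂ := fun u => c u with hγ
  have hγc : Continuous γ := hc.comp (AddCircle.continuous_mk' 1)
  obtain ⟨x, ⟨s, hs⟩, y, ⟨t, ht⟩, hxy, hx, hy, hconn⟩ :=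
    exists_conn_of_curveWrappingNumber hr hrR hcr hcR hwrap
  obtain ⟨s, -, rfl⟩ := exists_rep s 0
  obtain ⟨t, hst, rfl⟩ := exists_rep t s
  have hst' : s < t := lt_of_le_of_ne hst.1 (fun h => hxy (by rw [← hs, ← ht, h]))
  -- disjoint neighbourhoods of the two points
  obtain ⟨U₁, U₂, hU₁, hU₂, hxU, hyU, hUd⟩ := t2_separation hxy
  have hO : ∀ {z : ℂ} {U : Set ℂ} {v : ℝ}, IsOpen U → z ∈ U → z ∉ multiplePoints c → c v = z →
      ∃ η > 0, ∀ u ∈ Ioo (v - η) (v + η), γ u ∈ U ∩ {0}ᶜ ∧ γ u ∉ multiplePoints c := by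
    intro z U v hU hz hzm hv
    have hopen : IsOpen (U ∩ (multiplePoints c)ᶜ) :=
      hU.inter hreg.finite_multiplePoints.isClosed.isOpen_compl
    obtain ⟨η, hη, hb⟩ := Metric.mem_nhds_iff.1 (hγc.continuousAt.preimage_mem_nhds
      (hopen.mem_nhds (show γ v ∈ _ by rw [hγ]; simp only [hv]; exact ⟨hz, hzm⟩)))
    rw [Real.ball_eq_Ioo] at hb
    exact ⟨η, hη, fun u hu => ⟨⟨(hb hu).1, h0 u⟩, (hb hu).2⟩⟩
  obtain ⟨η₁, hη₁, hI₁⟩ := hO hU₁ hxU hx hs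
  obtain ⟨η₂, hη₂, hI₂⟩ := hO hU₂ hyU hy ht
  set η := min (min η₁ η₂) (min ((t - s) / 2) ((s + 1 - t) / 2)) with hηd
  have hη : 0 < η := by
    refine lt_min (lt_min hη₁ hη₂) (lt_min ?_ ?_)
    · linarith
    · linarith [hst.2]
  have hηa : η ≤ η₁ := (min_le_left _ _).trans (min_le_left _ _)
  have hηb : η ≤ η₂ := (min_le_left _ _).trans (min_le_right _ _)
  have hηc : η ≤ (t - s) / 2 := (min_le_right _ _).trans (min_le_left _ _)
  have hηd : η ≤ (s + 1 - t) / 2 := (min_le_right _ _).trans (min_le_right _ _)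
  have hJ₁ : ∀ u ∈ Ioo (s - η) (s + η), γ u ∈ U₁ ∩ {0}ᶜ ∧ γ u ∉ multiplePoints c := fun u hu =>
    hI₁ u ⟨by linarith [hu.1], by linarith [hu.2]⟩
  have hJ₂ : ∀ u ∈ Ioo (t - η) (t + η), γ u ∈ U₂ ∩ {0}ᶜ ∧ γ u ∉ multiplePoints c := fun u hu =>
    hI₂ u ⟨by linarith [hu.1], by linarith [hu.2]⟩
  obtain ⟨s', hs', hs'c, hs'd⟩ := hreg.piecewiseSmooth.exists_regular
    (show s - η < s + η by linarith) (fun u hu => (hJ₁ u hu).2)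
  obtain ⟨t', ht', ht'c, ht'd⟩ := hreg.piecewiseSmooth.exists_regular
    (show t - η < t + η by linarith) (fun u hu => (hJ₂ u hu).2)
  obtain ⟨δ₁, Γ₁, hδ₁, G₁, hG₁⟩ := exists_gate hc hs'c hs'd hreg.finite_multiplePoints
    (hJ₁ s' hs').2 ((hU₁.inter isOpen_compl_singleton).mem_nhds (hJ₁ s' hs').1)
    (η := min (s' - (s - η)) (s + η - s') / 2)
    (half_pos (lt_min (by linarith [hs'.1]) (by linarith [hs'.2])))
  obtain ⟨δ₂, Γ₂, hδ₂, G₂, hG₂⟩ := exists_gate hc ht'c ht'd hreg.finite_multiplePoints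
    (hJ₂ t' ht').2 ((hU₂.inter isOpen_compl_singleton).mem_nhds (hJ₂ t' ht').1)
    (η := min (t' - (t - η)) (t + η - t') / 2)
    (half_pos (lt_min (by linarith [ht'.1]) (by linarith [ht'.2])))
  have hd1 := G₁.pos
  have hd2 := G₂.pos
  have l1 := min_le_left (s' - (s - η)) (s + η - s')
  have l2 := min_le_right (s' - (s - η)) (s + η - s')
  have l3 := min_le_left (t' - (t - η)) (t + η - t')
  have l4 := min_le_right (t' - (t - η)) (t + η - t')
  have hs1 := hs'.1
  have hs2 := hs'.2
  have ht1 := ht'.1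
  have ht2 := ht'.2
  have hcore : Conn (γ '' (Icc (s + η) (t - η) ∪ Icc (t + η) (s - η + 1)))ᶜ 0 R := by
    refine hconn.mono (compl_subset_compl.2 ?_)
    rintro _ ⟨u, hu, rfl⟩
    have hu' : u ∈ Ico s (s + 1) ∧ u ≠ s ∧ u ≠ t := by
      rcases hu with hu | hu
      · exact ⟨⟨by linarith [hu.1], by linarith [hu.2]⟩, by linarith [hu.1],
          by linarith [hu.2]⟩
      · exact ⟨⟨by linarith [hu.1], by linarith [hu.2]⟩, by linarith [hu.1],
          by linarith [hu.1]⟩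
    refine ⟨⟨u, rfl⟩, ?_⟩
    rintro (h | h)
    · exact hx ⟨u, s, fun h' => hu'.2.1 (coe_inj hu'.1 ⟨le_rfl, by linarith⟩ h'), h, hs⟩
    · exact hy ⟨u, t, fun h' => hu'.2.2 (coe_inj hu'.1 ⟨hst.1, hst.2⟩ h'), h, ht⟩
  have hcore' := conn_compl_of_arcs hc hR0 hcR h0 (a₁' := s' - δ₁) (a₂' := s' + δ₁)
    (b₁' := t' - δ₂) (b₂' := t' + δ₂) (by linarith) (by linarith) (by linarith) (by linarith)
    (by linarith) (by linarith) (by linarith) (by linarith) (fun u hu => (hJ₁ u hu).2)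
    (fun u hu => (hJ₂ u hu).2) hcore
  refine crossesRayTwice_of_gates hc hr hrR hcR (by rw [hwrap]; decide)
    (by rintro ⟨t, ht⟩; exact h0 t ht)
    G₁ G₂ (hUd.mono (hG₁.trans inter_subset_left) (hG₂.trans inter_subset_left))
    (fun h => (hG₁ h).2 rfl) (fun h => (hG₂ h).2 rfl) (hcore'.mono ?_)
  intro z hz
  by_cases hzc : z ∈ range c
  · obtain ⟨v, rfl⟩ := hzc
    obtain ⟨u, hu, rfl⟩ := exists_rep v (s' - δ₁)
    by_cases h1 : u < s' + δ₁
    · rcases eq_or_lt_of_le hu.1 with h2 | h2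
      · refine absurd ⟨s' - δ₁ + 1, Or.inr ⟨by linarith, le_rfl⟩, ?_⟩ hz
        change c ((s' - δ₁ + 1 : ℝ) : UnitAddCircle) = _
        rw [coe_add_one, h2]
      · exact Or.inl (Or.inr (G₁.curve_mem_box ⟨h2, h1⟩))
    · by_cases h3 : u ≤ t' - δ₂
      · exact absurd ⟨u, Or.inl ⟨not_lt.1 h1, h3⟩, rfl⟩ hz
      · by_cases h4 : u < t' + δ₂
        · exact Or.inr (G₂.curve_mem_box ⟨not_le.1 h3, h4⟩)
        · exact absurd ⟨u, Or.inr ⟨not_lt.1 h4, hu.2.le⟩, rfl⟩ hz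
  · exact Or.inl (Or.inl hzc)

/-! ### A parametrization of the solid torus -/

/-- The direction of a nonzero complex number. -/
noncomputable def toCircle (z : ℂ) (hz : z ≠ 0) : Circle :=
  ⟨z / ‖z‖, mem_sphere_zero_iff_norm.2 (by simp [hz])⟩

lemma coe_toCircle (z : ℂ) (hz : z ≠ 0) : (toCircle z hz : ℂ) = z / ‖z‖ := rfl

lemma norm_mul_toCircle (z : ℂ) (hz : z ≠ 0) : (‖z‖ : ℂ) * toCircle z hz = z := by
  rw [coe_toCircle]
  have : (‖z‖ : ℂ) ≠ 0 := by simpa using hz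
  field_simp

lemma ne_zero_of_mem_annulus {a b : ℝ} (ha : 0 < a) {z : ℂ} (hz : z ∈ annulus a b) : z ≠ 0 :=
  norm_pos_iff.1 (ha.trans_le hz.1)

/-- Polar coordinates on an annulus. -/
noncomputable def polarHomeomorph {a b : ℝ} (ha : 0 < a) : annulus a b ≃ₜ Circle × Icc a b where
  toFun z := (toCircle z (ne_zero_of_mem_annulus ha z.2), ⟨‖(z : ℂ)‖, z.2⟩)
  invFun p := ⟨(p.2 : ℝ) * p.1, by
    have h : 0 ≤ (p.2 : ℝ) := ha.le.trans p.2.2.1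
    have h2 : ‖((p.2 : ℝ) : ℂ) * p.1‖ = p.2 := by
      rw [norm_mul, Circle.norm_coe, mul_one, Complex.norm_real, Real.norm_of_nonneg h]
    exact ⟨h2.symm ▸ p.2.2.1, h2.symm ▸ p.2.2.2⟩⟩
  left_inv z := Subtype.ext (norm_mul_toCircle _ (ne_zero_of_mem_annulus ha z.2))
  right_inv p := by
    have h : 0 < (p.2 : ℝ) := ha.trans_le p.2.2.1
    have h2 : ‖((p.2 : ℝ) : ℂ) * p.1‖ = p.2 := by
      rw [norm_mul, Circle.norm_coe, mul_one, Complex.norm_real, Real.norm_of_nonneg h.le]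
    refine Prod.ext (Circle.ext ?_) (Subtype.ext h2)
    rw [coe_toCircle, h2]
    have : ((p.2 : ℝ) : ℂ) ≠ 0 := by exact_mod_cast h.ne'
    field_simp
  continuous_toFun := by
    refine Continuous.prodMk ?_ (by fun_prop)
    refine Continuous.subtype_mk ?_ _
    refine Continuous.div (by fun_prop) (by fun_prop) fun z => ?_
    simpa using ne_zero_of_mem_annulus ha z.2
  continuous_invFun := by fun_prop

/-- A strictly increasing continuous function restricts to a homeomorphism of intervals. -/
lemma exists_homeomorph_Icc {f : ℝ → ℝ} (hf : Continuous f) (hm : StrictMono f) {a b : ℝ}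
    (hab : a ≤ b) : ∃ m : Icc a b ≃ₜ Icc (f a) (f b), ∀ x, (m x : ℝ) = f x := by
  let F : Icc a b → Icc (f a) (f b) := fun x => ⟨f x, hm.monotone x.2.1, hm.monotone x.2.2⟩
  have hb : Function.Bijective F := by
    refine ⟨fun x y h => Subtype.ext (hm.injective (congrArg Subtype.val h)), fun y => ?_⟩
    obtain ⟨x, hx, hxy⟩ := intermediate_value_Icc hab hf.continuousOn y.2
    exact ⟨⟨x, hx⟩, Subtype.ext hxy⟩
  have hc : Continuous (Equiv.ofBijective F hb) := by
    change Continuous F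
    fun_prop
  exact ⟨hc.homeoOfEquivCompactToT2, fun x => rfl⟩

lemma nonempty_homeomorph_disk {a b : ℝ} (hab : a < b) :
    Nonempty (closedBall (0 : ℂ) 1 ≃ₜ Icc a b × Icc (0 : ℝ) 1) := by
  set s : Set ℂ := Complex.equivRealProdCLM ⁻¹' (Icc a b ×ˢ Icc (0 : ℝ) 1) with hs
  have hconv : Convex ℝ s :=
    ((convex_Icc a b).prod (convex_Icc 0 1)).linear_preimage
      (Complex.equivRealProdCLM : ℂ →ₗ[ℝ] ℝ × ℝ)
  have hcl : IsClosed s :=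
    (isClosed_Icc.prod isClosed_Icc).preimage Complex.equivRealProdCLM.continuous
  have hbd : Bornology.IsBounded s := by
    have : s = Complex.equivRealProdCLM.symm '' (Icc a b ×ˢ Icc (0 : ℝ) 1) := by
      rw [hs]
      exact (Complex.equivRealProdCLM.symm.toEquiv.image_eq_preimage_symm _).symm
    rw [this]
    exact ((isCompact_Icc.prod isCompact_Icc).image
      Complex.equivRealProdCLM.symm.continuous).isBounded
  have hint : (interior s).Nonempty := by
    refine ⟨Complex.equivRealProdCLM.symm ((a + b) / 2, 1 / 2), ?_⟩
    refine interior_mono (preimage_mono (Set.prod_mono Ioo_subset_Icc_self Ioo_subset_Icc_self)) ?_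
    rw [((isOpen_Ioo.prod isOpen_Ioo).preimage Complex.equivRealProdCLM.continuous).interior_eq]
    rw [mem_preimage, ContinuousLinearEquiv.apply_symm_apply]
    refine ⟨⟨?_, ?_⟩, ⟨?_, ?_⟩⟩ <;> norm_num <;> linarith
  obtain ⟨e, -, he, -⟩ :=
    exists_homeomorph_image_interior_closure_frontier_eq_unitBall hconv hint hbd
  rw [hcl.closure_eq] at he
  have e1 : s ≃ₜ closedBall (0 : ℂ) 1 := e.sets (by rw [← he, e.injective.preimage_image])
  have e2 : s ≃ₜ ↑(Icc a b ×ˢ Icc (0 : ℝ) 1) := Complex.equivRealProdCLM.toHomeomorph.sets rfl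
  exact ⟨e1.symm.trans (e2.trans (Homeomorph.Set.prod _ _))⟩

/-- A plane homeomorphism that is the identity near `0` and near infinity can be made the angular
coordinate of a parametrization of the solid torus, on the part of the solid torus over a given
compact subset of the annulus. -/
lemma exists_parametrization {r R r₁ R₁ δ M : ℝ} (hδ : 0 < δ) (hδr : δ ≤ r) (hr₁ : r < r₁)
    (hR₁ : r₁ ≤ R₁) (hR : R₁ < R) (hRM : R ≤ M) (Ω : ℂ ≃ₜ ℂ) (hΩ0 : ∀ z, ‖z‖ ≤ δ → Ω z = z)
    (hΩM : ∀ z, M ≤ ‖z‖ → Ω z = z) :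
    ∃ h : (Circle × closedBall (0 : ℂ) 1) ≃ₜ solidTorus r R, ∀ x : solidTorus r R,
      r₁ ≤ ‖x.1.1‖ → ‖x.1.1‖ ≤ R₁ → Ω x.1.1 ≠ 0 ∧
        ((h.symm x).1 : ℂ) = Ω x.1.1 / ‖Ω x.1.1‖ := by
  have hr : 0 < r := hδ.trans_le hδr
  -- a radial map that is the identity between the radii `r₁` and `R₁`
  let f : ℝ → ℝ := fun x =>
    x + (r - δ) / (r₁ - r) * min (x - r₁) 0 + (M - R) / (R - R₁) * max (x - R₁) 0
  have hf : Continuous f := by fun_prop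
  have hfm : StrictMono f := by
    intro x y hxy
    have k1 : 0 ≤ (r - δ) / (r₁ - r) := div_nonneg (by linarith) (by linarith)
    have k2 : 0 ≤ (M - R) / (R - R₁) := div_nonneg (by linarith) (by linarith)
    have k3 : min (x - r₁) 0 ≤ min (y - r₁) 0 := min_le_min_right _ (by linarith)
    have k4 : max (x - R₁) 0 ≤ max (y - R₁) 0 := max_le_max_right _ (by linarith)
    have k5 := mul_le_mul_of_nonneg_left k3 k1
    have k6 := mul_le_mul_of_nonneg_left k4 k2
    simp only [f]
    linarith
  have hfr : f r = δ := by
    simp only [f]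
    rw [min_eq_left (by linarith), max_eq_right (by linarith)]
    have : r₁ - r ≠ 0 := by linarith
    field_simp
    ring
  have hfR : f R = M := by
    simp only [f]
    rw [min_eq_right (by linarith), max_eq_left (by linarith)]
    have : R - R₁ ≠ 0 := by linarith
    field_simp
    ring
  have hfid : ∀ x, r₁ ≤ x → x ≤ R₁ → f x = x := by
    intro x h1 h2
    simp only [f]
    rw [min_eq_right (by linarith), max_eq_right (by linarith)]
    ring
  obtain ⟨m, hm⟩ := exists_homeomorph_Icc hf hfm (show r ≤ R by linarith)
  have hinv0 : ∀ z, ‖Ω z‖ ≤ δ → Ω z = z := fun z hz => Ω.injective (hΩ0 _ hz)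
  have hinvM : ∀ z, M ≤ ‖Ω z‖ → Ω z = z := fun z hz => Ω.injective (hΩM _ hz)
  have hbij : ∀ z : ℂ, z ∈ annulus (f r) (f R) ↔ Ω z ∈ annulus (f r) (f R) := by
    rw [hfr, hfR]
    intro z
    constructor
    · rintro ⟨h1, h2⟩
      constructor
      · by_contra h
        have := hinv0 z (not_le.1 h).le
        rw [this] at h; exact h h1
      · by_contra h
        have := hinvM z (not_le.1 h).le
        rw [this] at h; exact h h2
    · rintro ⟨h1, h2⟩
      constructor
      · by_contra h
        have := hΩ0 z (not_le.1 h).le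
        rw [this] at h1; exact h h1
      · by_contra h
        have := hΩM z (not_le.1 h).le
        rw [this] at h2; exact h h2
  have hfr0 : 0 < f r := by rw [hfr]; exact hδ
  let P₁ : annulus r R ≃ₜ Circle × Icc r R := polarHomeomorph hr
  let P₂ : annulus (f r) (f R) ≃ₜ Circle × Icc (f r) (f R) := polarHomeomorph hfr0
  let Ω' : annulus (f r) (f R) ≃ₜ annulus (f r) (f R) := Ω.sets (by ext z; exact hbij z)
  let H : annulus r R ≃ₜ Circle × Icc (f r) (f R) :=
    P₁.trans (((Homeomorph.refl Circle).prodCongr m).trans (P₂.symm.trans (Ω'.trans P₂)))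
  obtain ⟨d⟩ := nonempty_homeomorph_disk (hfm (show r < R by linarith))
  let h' : solidTorus r R ≃ₜ Circle × closedBall (0 : ℂ) 1 :=
    (Homeomorph.Set.prod (annulus r R) (Icc (0 : ℝ) 1)).trans
      ((H.prodCongr (Homeomorph.refl (Icc (0 : ℝ) 1))).trans
        ((Homeomorph.prodAssoc _ _ _).trans ((Homeomorph.refl Circle).prodCongr d.symm)))
  refine ⟨h'.symm, ?_⟩
  intro x h1 h2
  have hx : x.1.1 ∈ annulus r R := x.2.1
  have hkey : ((P₂.symm (((Homeomorph.refl Circle).prodCongr m) (P₁ ⟨x.1.1, hx⟩)) :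
      annulus (f r) (f R)) : ℂ) = x.1.1 := by
    change ((m ⟨‖x.1.1‖, hx⟩ : ℝ) : ℂ) * toCircle x.1.1 (ne_zero_of_mem_annulus hr hx) = x.1.1
    rw [hm, hfid _ h1 h2, norm_mul_toCircle]
  have hmem : x.1.1 ∈ annulus (f r) (f R) := hkey ▸ Subtype.property _
  refine ⟨ne_zero_of_mem_annulus hfr0 ((hbij _).1 hmem), ?_⟩
  change ((H ⟨x.1.1, hx⟩).1 : ℂ) = _
  have hkey' : P₂.symm (((Homeomorph.refl Circle).prodCongr m) (P₁ ⟨x.1.1, hx⟩)) =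
    ⟨x.1.1, hmem⟩ := Subtype.ext hkey
  change ((P₂ (Ω' (P₂.symm (((Homeomorph.refl Circle).prodCongr m) (P₁ ⟨x.1.1, hx⟩))))).1 : ℂ) = _
  rw [hkey']
  rfl

/-- The function `g` changes its sign at `s`, and is nonzero nearby. -/
def ChangesSign (g : ℝ → ℝ) (s : ℝ) : Prop :=
  ∃ ε > 0, ∃ σ : ℝ, (σ = 1 ∨ σ = -1) ∧
    ∀ u ∈ Ioo (s - ε) (s + ε), (u < s → σ * g u < 0) ∧ (s < u → 0 < σ * g u)

lemma MonotoneNear.changesSign {g g' : ℝ → ℝ} {s a ε : ℝ} (hε : 0 < ε)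
    (h : MonotoneNear g (Ioo (s - ε) (s + ε))) (ha : g s = a) {k : ℝ → ℝ} (hk : ∀ u, 0 < k u)
    (hg : ∀ u, g' u = k u * (g u - a)) : ChangesSign g' s := by
  have hs : s ∈ Ioo (s - ε) (s + ε) := ⟨by linarith, by linarith⟩
  rcases h with h | h
  · refine ⟨ε, hε, 1, Or.inl rfl, fun u hu => ⟨fun hus => ?_, fun hus => ?_⟩⟩
    · have := h hu hs hus
      rw [hg, one_mul]
      exact mul_neg_of_pos_of_neg (hk u) (by linarith)
    · have := h hs hu hus
      rw [hg, one_mul]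
      exact mul_pos (hk u) (by linarith)
  · refine ⟨ε, hε, -1, Or.inr rfl, fun u hu => ⟨fun hus => ?_, fun hus => ?_⟩⟩
    · have h1 := h hu hs hus
      have := mul_pos (hk u) (show 0 < g u - a by linarith)
      rw [hg]; linarith
    · have h1 := h hs hu hus
      have := mul_neg_of_pos_of_neg (hk u) (show g u - a < 0 by linarith)
      rw [hg]; linarith

/-- Homeomorphisms that translate a large ball and are the identity far away. -/
lemma exists_translation (e : ℂ) {L : ℝ} (hL : ‖e‖ < L) :
    ∃ τ : ℂ ≃ₜ ℂ, (∀ z, ‖z‖ ≤ L → τ z = z - e) ∧ ∀ z, 2 * L ≤ ‖z‖ → τ z = z := by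
  have hL0 : 0 < L := (norm_nonneg e).trans_lt hL
  have h1 : LipschitzWith (Real.toNNReal (1 / L)) fun z : ℂ => 2 - ‖z‖ / L := by
    refine LipschitzWith.of_dist_le_mul fun x y => ?_
    rw [Real.coe_toNNReal _ (by positivity), Real.dist_eq, dist_eq_norm]
    have : 2 - ‖x‖ / L - (2 - ‖y‖ / L) = (1 / L) * (‖y‖ - ‖x‖) := by ring
    rw [this, abs_mul, abs_of_pos (show 0 < 1 / L by positivity), abs_sub_comm]
    exact mul_le_mul_of_nonneg_left (abs_norm_sub_norm_le x y) (by positivity)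
  have h2 := (h1.const_min 1).const_max 0
  obtain ⟨τ, hτ⟩ := exists_homeomorph_add_smul h2 (v := -e) (by
    rw [Real.coe_toNNReal _ (by positivity), norm_neg, one_div, inv_mul_lt_iff₀ hL0, mul_one]
    exact hL)
  refine ⟨τ, fun z hz => ?_, fun z hz => ?_⟩
  · have : 1 ≤ 2 - ‖z‖ / L := by
      have := (div_le_one hL0).2 hz
      linarith
    rw [hτ, min_eq_left this, max_eq_right zero_le_one, one_smul, sub_eq_add_neg]
  · have : 2 - ‖z‖ / L ≤ 0 := by
      have := (le_div_iff₀ hL0).2 hz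
      linarith
    rw [hτ, min_eq_right (by linarith), max_eq_left this, zero_smul, add_zero]

lemma ArcIn.image {α β : Type*} [TopologicalSpace α] [TopologicalSpace β] {X : Set α} {a b : α}
    (h : ArcIn X a b) {f : α → β} (hf : Continuous f) (hi : Function.Injective f) :
    ArcIn (f '' X) (f a) (f b) := by
  rcases h with ⟨rfl, h⟩ | ⟨g, hg, hgi, rfl, rfl, hX⟩
  · exact Or.inl ⟨rfl, mem_image_of_mem f h⟩
  · refine Or.inr ⟨f ∘ g, hf.comp hg, hi.comp hgi, rfl, rfl, ?_⟩
    rw [range_comp]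
    exact image_mono hX

/-- The preimage of a ray under a compactly supported motion is an arc to infinity, so that the
number of its intersections with the curve is bounded below by the wrapping number. -/
lemma two_le_encard_ray {c : UnitAddCircle → ℂ} {r R : ℝ} (hr : 0 < r) (hrR : r < R)
    (h0 : ∀ t, c t ≠ 0) (hwrap : curveWrappingNumber r R c = 2) {Ω : ℂ ≃ₜ ℂ} {e : ℂ}
    (hΩ0 : Ω 0 = e) (hΩ : IsSupportedIn Ω univ) :
    2 ≤ {t | (Ω (c t)).im = e.im ∧ e.re < (Ω (c t)).re}.encard := by
  set S := {t | (Ω (c t)).im = e.im ∧ e.re < (Ω (c t)).re} with hS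
  by_contra hlt
  have hle : S.encard ≤ 1 := by
    rw [not_le] at hlt
    exact Order.le_of_lt_add_one (by rw [one_add_one_eq_two]; exact hlt)
  obtain ⟨C, hC, -, hid⟩ := hΩ
  obtain ⟨B, hB⟩ := hC.isBounded.exists_norm_le
  set x := max e.re (max R (B + 1)) with hx
  set w : ℂ := ⟨x, e.im⟩ with hw
  have hxw : x ≤ ‖w‖ := (le_abs_self _).trans (Complex.abs_re_le_norm w)
  have hxR : R ≤ x := (le_max_left _ _).trans (le_max_right _ _)
  have hxB : B + 1 ≤ x := (le_max_right _ _).trans (le_max_right _ _)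
  have hΩw : Ω w = w := hid w fun h => by have := hB w h; linarith
  set X : Set ℂ := Ω.symm '' {z | z.im = e.im ∧ e.re ≤ z.re} with hX
  have harc : ArcIn X 0 w := by
    have h1 : ArcIn {z : ℂ | z.im = e.im ∧ e.re ≤ z.re} e w := by
      refine ArcIn.of_segment ?_
      have hconv : Convex ℝ {z : ℂ | z.im = e.im ∧ e.re ≤ z.re} := by
        have h2 : {z : ℂ | z.im = e.im ∧ e.re ≤ z.re} =
            Complex.imLm ⁻¹' {e.im} ∩ Complex.reLm ⁻¹' Ici e.re := by ext z; rfl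
        rw [h2]
        exact ((convex_singleton _).linear_preimage _).inter ((convex_Ici _).linear_preimage _)
      exact hconv.segment_subset ⟨rfl, le_rfl⟩ ⟨rfl, le_max_left _ _⟩
    have h2 := h1.image Ω.symm.continuous Ω.symm.injective
    have h3 : Ω.symm e = 0 := Ω.symm_apply_eq.2 hΩ0.symm
    have h4 : Ω.symm w = w := Ω.symm_apply_eq.2 hΩw.symm
    rwa [h3, h4] at h2
  have hXS : ∀ t, c t ∈ X → t ∈ S := by
    rintro t ⟨z, hz, hzt⟩
    rw [Ω.symm_apply_eq] at hzt
    subst hzt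
    refine ⟨hz.1, lt_of_le_of_ne hz.2 fun h => h0 t (Ω.injective ?_)⟩
    rw [hΩ0]
    exact Complex.ext h.symm hz.1
  have h1 := curveWrappingNumber_le (c := c) hr hrR (hxR.trans hxw) harc (by
    rw [Set.disjoint_left]
    rintro z hz ⟨s, t, hst, rfl, ht⟩
    exact hst (encard_le_one_iff.1 hle s t (hXS s hz) (hXS t (ht.symm ▸ hz))))
  have h2 : X ∩ range c ⊆ c '' S := by
    rintro _ ⟨hz, t, rfl⟩
    exact ⟨t, hXS t hz, rfl⟩
  have h3 := h1.trans ((encard_le_encard h2).trans ((encard_image_le _ _).trans hle))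
  rw [hwrap] at h3
  exact absurd h3 (by decide)

/-- A motion of the plane after which a ray meets the projection of `N` at most twice gives a
parametrization of the solid torus in which the meridional disk `{1} × D²` meets `N` exactly twice,
transversally. -/
theorem CrossesRayTwice.exists_parametrization {r R : ℝ} (hr : 0 < r) (hrR : r < R)
    {N : UnitAddCircle → ℂ × ℝ}
    (hN : ∀ t, N t ∈ solidTorus r R) (hc : Continuous (proj N)) (hcr : ∀ t, r < ‖proj N t‖)
    (hcR : ∀ t, ‖proj N t‖ < R) (hwrap : curveWrappingNumber r R (proj N) = 2)
    (hray : CrossesRayTwice (proj N)) :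
    ∃ h : (Circle × closedBall (0 : ℂ) 1) ≃ₜ solidTorus r R,
      {t | (h.symm ⟨N t, hN t⟩).1 = 1}.encard = 2 ∧
      ∀ t, (h.symm ⟨N t, hN t⟩).1 = 1 → ∃ s : ℝ, (s : UnitAddCircle) = t ∧
        ChangesSign (fun u : ℝ => ((h.symm ⟨N u, hN u⟩).1 : ℂ).im) s := by
  obtain ⟨Ω, e, ρ, hρ, hΩ0, ⟨C, hC, -, hΩC⟩, hcard, hcross⟩ := hray
  have hcn : Continuous fun t => ‖proj N t‖ := hc.norm
  obtain ⟨t₁, -, ht₁⟩ := isCompact_univ.exists_isMinOn univ_nonempty hcn.continuousOn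
  obtain ⟨t₂, -, ht₂⟩ := isCompact_univ.exists_isMaxOn univ_nonempty hcn.continuousOn
  obtain ⟨B, hB⟩ := hC.isBounded.exists_norm_le
  obtain ⟨L₀, hL₀⟩ := ((isCompact_closedBall (0 : ℂ) R).image Ω.continuous).isBounded.exists_norm_le
  set L := max (max B L₀) (‖e‖ + ρ) with hL
  have hLB : B ≤ L := (le_max_left _ _).trans (le_max_left _ _)
  have hLL : L₀ ≤ L := (le_max_right _ _).trans (le_max_left _ _)
  have hLe : ‖e‖ + ρ ≤ L := le_max_right _ _
  have hLpos : 0 < L := by have := norm_nonneg e; linarith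
  obtain ⟨τ, hτ1, hτ2⟩ := exists_translation e (L := L) (by linarith)
  obtain ⟨h, hh⟩ := KnotAnnulus.exists_parametrization (r := r) (R := R) (δ := min (ρ / 2) r)
    (M := max R (2 * L + 1)) (r₁ := ‖proj N t₁‖) (R₁ := ‖proj N t₂‖)
    (lt_min (half_pos hρ) hr) (min_le_right _ _) (hcr t₁) (ht₁ (mem_univ t₂)) (hcR t₂)
    (le_max_left _ _) (Ω.trans τ)
    (by
      intro z hz
      have hz' : ‖z‖ < ρ := (hz.trans (min_le_left _ _)).trans_lt (half_lt_self hρ)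
      rw [Homeomorph.trans_apply, hΩ0 z hz', hτ1 _ ((norm_add_le _ _).trans (by linarith))]
      ring)
    (by
      intro z hz
      have hz' : 2 * L + 1 ≤ ‖z‖ := (le_max_right _ _).trans hz
      rw [Homeomorph.trans_apply, hΩC z fun h => by have := hB z h; linarith]
      exact hτ2 z (by linarith))
  have hval : ∀ t, Ω (proj N t) - e ≠ 0 ∧
      ((h.symm ⟨N t, hN t⟩).1 : ℂ) = (Ω (proj N t) - e) / ‖Ω (proj N t) - e‖ := by
    intro t
    have h1 := hh ⟨N t, hN t⟩ (ht₁ (mem_univ t)) (ht₂ (mem_univ t))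
    have h2 : τ (Ω (proj N t)) = Ω (proj N t) - e := by
      apply hτ1
      exact (hL₀ _ (mem_image_of_mem _ (by simpa using (hcR t).le))).trans hLL
    have h3 : (Ω.trans τ) (N t).1 = Ω (proj N t) - e := h2
    rwa [h3] at h1
  have hone : ∀ t, (h.symm ⟨N t, hN t⟩).1 = 1 ↔
      ((Ω (proj N t)).im = e.im ∧ e.re < (Ω (proj N t)).re) := by
    intro t
    obtain ⟨h1, h2⟩ := hval t
    have h3 : 0 < ‖Ω (proj N t) - e‖ := norm_pos_iff.2 h1
    have h3' : (‖Ω (proj N t) - e‖ : ℂ) ≠ 0 := by exact_mod_cast h3.ne'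
    rw [← Circle.coe_eq_one, h2, div_eq_one_iff_eq h3']
    constructor
    · intro h4
      have h5 := congrArg Complex.im h4
      have h6 := congrArg Complex.re h4
      simp only [Complex.sub_im, Complex.sub_re, Complex.ofReal_im, Complex.ofReal_re] at h5 h6
      constructor <;> linarith
    · rintro ⟨h4, h5⟩
      have h6 : Ω (proj N t) - e = (((Ω (proj N t)).re - e.re : ℝ) : ℂ) := by
        apply Complex.ext <;> simp [h4]
      rw [h6, Complex.norm_real, Real.norm_of_nonneg (by linarith)]
  refine ⟨h, ?_, fun t ht => ?_⟩
  · simp only [hone]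
    refine le_antisymm hcard (two_le_encard_ray hr hrR (fun t h => ?_) hwrap ?_
      ⟨C, hC, subset_univ C, hΩC⟩)
    · have := hcr t
      rw [h, norm_zero] at this
      linarith
    · simpa using hΩ0 0 (by simpa using hρ)
  · obtain ⟨h1, h2⟩ := (hone t).1 ht
    obtain ⟨s, rfl, ε, hε, hmono⟩ := hcross t h1 h2
    refine ⟨s, rfl, hmono.changesSign hε h1 (k := fun u : ℝ => ‖Ω (proj N u) - e‖⁻¹)
      (fun u => inv_pos.2 (norm_pos_iff.2 (hval u).1)) fun u => ?_⟩
    rw [(hval u).2, div_eq_inv_mul, ← Complex.ofReal_inv, Complex.im_ofReal_mul, Complex.sub_im]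

lemma wrappingNumber_le {M : Type*} [TopologicalSpace M] {U X : Set M}
    (h : (Circle × closedBall (0 : ℂ) 1) ≃ₜ U) :
    wrappingNumber U X ≤ (range (fun d => (h (1, d) : M)) ∩ X).encard :=
  sInf_le ⟨_, ⟨h, rfl⟩, rfl⟩

lemma meridian_inter_range {α M : Type*} [TopologicalSpace M] {U : Set M} {N : α → M}
    (hN : ∀ t, N t ∈ U) (h : (Circle × closedBall (0 : ℂ) 1) ≃ₜ U) :
    range (fun d => (h (1, d) : M)) ∩ range N = N '' {t | (h.symm ⟨N t, hN t⟩).1 = 1} := by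
  ext x
  constructor
  · rintro ⟨⟨d, rfl⟩, t, ht⟩
    refine ⟨t, ?_, ht⟩
    have h1 : (⟨N t, hN t⟩ : U) = h (1, d) := Subtype.ext ht
    rw [mem_ofPred_eq, h1, h.symm_apply_apply]
  · rintro ⟨t, ht, rfl⟩
    refine ⟨⟨(h.symm ⟨N t, hN t⟩).2, ?_⟩, t, rfl⟩
    have h1 : ((1 : Circle), (h.symm ⟨N t, hN t⟩).2) = h.symm ⟨N t, hN t⟩ := Prod.ext ht.symm rfl
    change ((h (1, (h.symm ⟨N t, hN t⟩).2) : U) : M) = N t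
    rw [h1, h.apply_symm_apply]

/-! ### Degrees of maps to the circle -/

lemma circle_exp_eq_iff {a b : ℝ} :
    Circle.exp (2 * Real.pi * a) = Circle.exp (2 * Real.pi * b) ↔ ∃ n : ℤ, a = b + n := by
  have hpi : (2 * Real.pi) ≠ 0 := by positivity
  rw [Circle.exp_eq_exp]
  constructor
  · rintro ⟨n, hn⟩
    refine ⟨n, mul_left_cancel₀ hpi ?_⟩
    rw [hn]; ring
  · rintro ⟨n, rfl⟩
    exact ⟨n, by ring⟩

lemma circle_exp_eq_one_iff {a : ℝ} : Circle.exp (2 * Real.pi * a) = 1 ↔ ∃ n : ℤ, a = n := by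
  have := circle_exp_eq_iff (a := a) (b := 0)
  simpa using this

/-- Continuous maps from simply connected spaces to the circle lift to the line. -/
lemma exists_circle_lift {A : Type*} [TopologicalSpace A] [SimplyConnectedSpace A]
    [LocallyPathConnectedSpace A] {f : A → Circle} (hf : Continuous f) :
    ∃ g : A → ℝ, Continuous g ∧ ∀ x, Circle.exp (2 * Real.pi * g x) = f x := by
  obtain ⟨g, hg, hgf⟩ := exists_continuous_log (f := fun x => (f x : ℂ)) (by fun_prop)
    (fun x => Circle.coe_ne_zero _)
  refine ⟨fun x => (g x).im / (2 * Real.pi), by fun_prop, fun x => Circle.ext ?_⟩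
  have h1 : (g x).re = 0 := by
    have h2 := congrArg norm (hgf x)
    rw [Complex.norm_exp, Circle.norm_coe, Real.exp_eq_one_iff] at h2
    exact h2
  have h2 : 2 * Real.pi * ((g x).im / (2 * Real.pi)) = (g x).im := by
    have := Real.pi_pos
    field_simp
  rw [h2, Circle.coe_exp, ← hgf x]
  congr 1
  apply Complex.ext <;> simp [h1]

/-- A closed curve in the circle has degree `n` if its lifts increase by `n` in one turn. -/
def HasDegree (u : UnitAddCircle → Circle) (n : ℤ) : Prop :=
  ∃ θ : ℝ → ℝ, Continuous θ ∧ (∀ s, Circle.exp (2 * Real.pi * θ s) = u s) ∧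
    ∀ s, θ (s + 1) = θ s + n

lemma exists_int_add {A : Type*} [TopologicalSpace A] [PreconnectedSpace A] [Nonempty A]
    {f g : A → ℝ} (hf : Continuous f) (hg : Continuous g)
    (h : ∀ x, Circle.exp (2 * Real.pi * f x) = Circle.exp (2 * Real.pi * g x)) :
    ∃ n : ℤ, ∀ x, f x = g x + n := by
  obtain ⟨x₀⟩ := (inferInstance : Nonempty A)
  obtain ⟨n, hn⟩ := circle_exp_eq_iff.1 (h x₀)
  refine ⟨n, fun x => ?_⟩
  have := eq_of_forall_int isPreconnected_univ (f := fun x => f x - g x) (by fun_prop)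
    (fun x _ => by
      obtain ⟨n, hn⟩ := circle_exp_eq_iff.1 (h x)
      exact ⟨n, by rw [hn]; ring⟩) (mem_univ x) (mem_univ x₀)
  linarith

lemma exists_hasDegree {u : UnitAddCircle → Circle} (hu : Continuous u) : ∃ n, HasDegree u n := by
  obtain ⟨θ, hθ, hθu⟩ := exists_circle_lift (hu.comp (AddCircle.continuous_mk' 1))
  obtain ⟨n, hn⟩ := exists_int_add (f := fun s => θ (s + 1)) (g := θ) (by fun_prop) hθ (by
    intro s
    rw [hθu, hθu]
    exact congrArg u (coe_add_one s))
  exact ⟨n, θ, hθ, hθu, hn⟩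

/-- The floor of a continuous function is constant on intervals without integer values. -/
lemma floor_eq_of_forall_ne {θ : ℝ → ℝ} (hθ : Continuous θ) {x y : ℝ} (hxy : x ≤ y)
    (h : ∀ s ∈ Icc x y, ∀ n : ℤ, θ s ≠ n) : ⌊θ x⌋ = ⌊θ y⌋ := by
  by_contra hne
  rcases lt_or_gt_of_ne hne with hlt | hlt
  · have h1 : θ x ≤ (⌊θ y⌋ : ℤ) := (Int.floor_lt.1 hlt).le
    have h2 : ((⌊θ y⌋ : ℤ) : ℝ) ≤ θ y := Int.floor_le _
    obtain ⟨s, hs, hs'⟩ := intermediate_value_Icc hxy hθ.continuousOn ⟨h1, h2⟩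
    exact h s hs _ hs'
  · have h1 : θ y ≤ (⌊θ x⌋ : ℤ) := (Int.floor_lt.1 hlt).le
    have h2 : ((⌊θ x⌋ : ℤ) : ℝ) ≤ θ x := Int.floor_le _
    obtain ⟨s, hs, hs'⟩ := intermediate_value_Icc' hxy hθ.continuousOn ⟨h1, h2⟩
    exact h s hs _ hs'

/-- At a sign change of `sin (2πθ)`, the floor of `θ` jumps by one. -/
lemma ChangesSign.floor_jump {θ : ℝ → ℝ} (hθ : Continuous θ) {s : ℝ}
    (h : ChangesSign (fun u => Real.sin (2 * Real.pi * θ u)) s) {m : ℤ} (hm : θ s = m) :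
    ∃ ε > 0, ∃ σ : ℤ, (σ = 1 ∨ σ = -1) ∧
      ∀ x ∈ Ioo (s - ε) s, ∀ y ∈ Ioo s (s + ε), ⌊θ y⌋ = ⌊θ x⌋ + σ := by
  obtain ⟨ε, hε, σ, hσ, hsign⟩ := h
  have h1 : ∀ᶠ u in 𝓝 s, θ u ∈ Ioo ((m : ℝ) - 1 / 2) (m + 1 / 2) := by
    refine hθ.continuousAt.eventually_mem (isOpen_Ioo.mem_nhds ?_)
    rw [hm]; constructor <;> linarith
  obtain ⟨η, hη, hb⟩ := Metric.eventually_nhds_iff_ball.1 h1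
  rw [Real.ball_eq_Ioo] at hb
  have hpi := Real.pi_pos
  have hsin : ∀ u, Real.sin (2 * Real.pi * θ u) = Real.sin (2 * Real.pi * (θ u - m)) := by
    intro u
    have : 2 * Real.pi * (θ u - m) = 2 * Real.pi * θ u - m * (2 * Real.pi) := by ring
    rw [this, Real.sin_sub_int_mul_two_pi]
  have hpos : ∀ u ∈ Ioo (s - η) (s + η), 0 < Real.sin (2 * Real.pi * θ u) → ⌊θ u⌋ = m := by
    intro u hu h
    have h2 := hb u hu
    rw [Int.floor_eq_iff]
    refine ⟨?_, by linarith [h2.2]⟩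
    by_contra hlt
    push Not at hlt
    have h3 := Real.sin_nonpos_of_nonpos_of_neg_pi_le
      (x := 2 * Real.pi * (θ u - m)) (by nlinarith) (by nlinarith [h2.1])
    rw [hsin] at h
    linarith
  have hneg : ∀ u ∈ Ioo (s - η) (s + η), Real.sin (2 * Real.pi * θ u) < 0 → ⌊θ u⌋ = m - 1 := by
    intro u hu h
    have h2 := hb u hu
    rw [Int.floor_eq_iff]
    push_cast
    refine ⟨by linarith [h2.1], ?_⟩
    by_contra hlt
    push Not at hlt
    have h3 := Real.sin_nonneg_of_nonneg_of_le_pi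
      (x := 2 * Real.pi * (θ u - m)) (by nlinarith) (by nlinarith [h2.2])
    rw [hsin] at h
    linarith
  have hε1 := min_le_left ε η
  have hε2 := min_le_right ε η
  refine ⟨min ε η, lt_min hε hη, ?_⟩
  rcases hσ with rfl | rfl
  · refine ⟨1, Or.inl rfl, fun x hx y hy => ?_⟩
    have k1 := (hsign x ⟨by linarith [hx.1], by linarith [hx.2]⟩).1 hx.2
    have k2 := (hsign y ⟨by linarith [hy.1], by linarith [hy.2]⟩).2 hy.1
    rw [hneg x ⟨by linarith [hx.1], by linarith [hx.2]⟩ (by linarith),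
      hpos y ⟨by linarith [hy.1], by linarith [hy.2]⟩ (by linarith)]
    ring
  · refine ⟨-1, Or.inr rfl, fun x hx y hy => ?_⟩
    have k1 := (hsign x ⟨by linarith [hx.1], by linarith [hx.2]⟩).1 hx.2
    have k2 := (hsign y ⟨by linarith [hy.1], by linarith [hy.2]⟩).2 hy.1
    rw [hpos x ⟨by linarith [hx.1], by linarith [hx.2]⟩ (by linarith),
      hneg y ⟨by linarith [hy.1], by linarith [hy.2]⟩ (by linarith)]
    ring

/-- A closed curve in the circle that crosses `1` exactly twice, transversally, has even degree. -/
theorem HasDegree.even {u : UnitAddCircle → Circle} {n : ℤ} (hu : HasDegree u n)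
    (h2 : {t | u t = 1}.encard = 2)
    (hs : ∀ t, u t = 1 → ∃ s : ℝ, (s : UnitAddCircle) = t ∧
      ChangesSign (fun x : ℝ => (u x : ℂ).im) s) : Even n := by
  obtain ⟨θ, hθ, hθu, hθn⟩ := hu
  obtain ⟨t₁, t₂, hne, hset⟩ := encard_eq_two.1 h2
  have hmem : ∀ t, u t = 1 ↔ t = t₁ ∨ t = t₂ := fun t => by
    have : t ∈ {t | u t = 1} ↔ t ∈ ({t₁, t₂} : Set UnitAddCircle) := by rw [hset]
    simpa using this
  have hsin : ∀ x : ℝ, (u x : ℂ).im = Real.sin (2 * Real.pi * θ x) := by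
    intro x
    rw [← hθu, Circle.coe_exp, Complex.exp_ofReal_mul_I_im]
  have hint : ∀ x : ℝ, u x = 1 ↔ ∃ m : ℤ, θ x = m := by
    intro x
    rw [← hθu, circle_exp_eq_one_iff]
  -- sign changes can be moved by periods
  have hjump : ∀ s : ℝ, u s = 1 → ∃ ε > 0, ∃ σ : ℤ, (σ = 1 ∨ σ = -1) ∧
      ∀ x ∈ Ioo (s - ε) s, ∀ y ∈ Ioo s (s + ε), ⌊θ y⌋ = ⌊θ x⌋ + σ := by
    intro s hus
    obtain ⟨s', hs', hch⟩ := hs s hus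
    obtain ⟨k, hk⟩ : ∃ k : ℤ, s' = s + k := by
      rw [← sub_eq_zero, ← AddCircle.coe_sub, AddCircle.coe_eq_zero_iff] at hs'
      obtain ⟨k, hk⟩ := hs'
      exact ⟨k, by simp only [zsmul_eq_mul, mul_one] at hk; linarith⟩
    have hch' : ChangesSign (fun x => Real.sin (2 * Real.pi * θ x)) s := by
      obtain ⟨ε, hε, σ, hσ, hsg⟩ := hch
      refine ⟨ε, hε, σ, hσ, fun x hx => ?_⟩
      have h1 := hsg (x + k) ⟨by linarith [hx.1], by linarith [hx.2]⟩
      have h3 : (((x + k : ℝ)) : UnitAddCircle) = x := by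
        rw [AddCircle.coe_add]
        have : ((k : ℝ) : UnitAddCircle) = 0 := by
          rw [AddCircle.coe_eq_zero_iff]; exact ⟨k, by simp⟩
        rw [this, add_zero]
      simp only [h3, hsin] at h1
      exact ⟨fun h => h1.1 (by linarith), fun h => h1.2 (by linarith)⟩
    obtain ⟨m, hm⟩ := (hint s).1 hus
    exact hch'.floor_jump hθ hm
  obtain ⟨s₁, -, rfl⟩ := exists_rep t₁ 0
  obtain ⟨s₂, hs₂, rfl⟩ := exists_rep t₂ s₁
  have hlt : s₁ < s₂ := lt_of_le_of_ne hs₂.1 (fun h => hne (by rw [h]))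
  have hno : ∀ x ∈ Ioo s₁ (s₁ + 1), x ≠ s₂ → ∀ m : ℤ, θ x ≠ m := by
    intro x hx hx2 m hm
    rcases (hmem x).1 ((hint x).2 ⟨m, hm⟩) with h | h
    · have := coe_inj (a := s₁) ⟨hx.1.le, hx.2⟩ ⟨le_rfl, by linarith⟩ h
      linarith [hx.1]
    · exact hx2 (coe_inj (a := s₁) ⟨hx.1.le, hx.2⟩ hs₂ h)
  -- the floor of `θ` jumps by `σ₁` at `s₁` and by `σ₂` at `s₂`, is constant otherwise, and grows by
  -- `n` in one period
  obtain ⟨ε₁, hε₁, σ₁, hσ₁, hj₁⟩ := hjump s₁ ((hmem _).2 (Or.inl rfl))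
  obtain ⟨ε₂, hε₂, σ₂, hσ₂, hj₂⟩ := hjump s₂ ((hmem _).2 (Or.inr rfl))
  have hs₂' := hs₂.2
  obtain ⟨x₁, hx₁, hx₁'⟩ : ∃ x₁, s₁ < x₁ ∧ x₁ < min (s₁ + ε₁) s₂ :=
    exists_between (lt_min (by linarith) hlt)
  obtain ⟨x₂, hx₂, hx₂'⟩ : ∃ x₂, max (s₂ - ε₂) x₁ < x₂ ∧ x₂ < s₂ :=
    exists_between (max_lt (by linarith) (hx₁'.trans_le (min_le_right _ _)))
  obtain ⟨x₃, hx₃, hx₃'⟩ : ∃ x₃, s₂ < x₃ ∧ x₃ < min (s₂ + ε₂) (s₁ + 1) :=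
    exists_between (lt_min (by linarith) hs₂')
  obtain ⟨x₄, hx₄, hx₄'⟩ : ∃ x₄, max (s₁ + 1 - ε₁) x₃ < x₄ ∧ x₄ < s₁ + 1 :=
    exists_between (max_lt (by linarith) (hx₃'.trans_le (min_le_right _ _)))
  rw [lt_min_iff] at hx₁' hx₃'
  rw [max_lt_iff] at hx₂ hx₄
  have e1 : ⌊θ x₁⌋ = ⌊θ x₂⌋ := floor_eq_of_forall_ne hθ hx₂.2.le fun x hx =>
    hno x ⟨by linarith [hx.1], by linarith [hx.2]⟩ (by linarith [hx.2])
  have e2 : ⌊θ x₃⌋ = ⌊θ x₂⌋ + σ₂ := hj₂ x₂ ⟨hx₂.1, hx₂'⟩ x₃ ⟨hx₃, hx₃'.1⟩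
  have e3 : ⌊θ x₃⌋ = ⌊θ x₄⌋ := floor_eq_of_forall_ne hθ hx₄.2.le fun x hx =>
    hno x ⟨by linarith [hx.1], by linarith [hx.2]⟩ (by linarith [hx.1])
  have e4 : ⌊θ x₁⌋ = ⌊θ (x₄ - 1)⌋ + σ₁ :=
    hj₁ (x₄ - 1) ⟨by linarith [hx₄.1], by linarith⟩ x₁ ⟨hx₁, hx₁'.1⟩
  have e5 : ⌊θ x₄⌋ = ⌊θ (x₄ - 1)⌋ + n := by
    have := hθn (x₄ - 1)
    rw [sub_add_cancel] at this
    rw [this, Int.floor_add_intCast]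
  have e6 : n = σ₁ + σ₂ := by linarith
  rw [e6]
  rcases hσ₁ with rfl | rfl <;> rcases hσ₂ with rfl | rfl <;> decide

/-- A closed curve in the circle that passes exactly once through `1` either has odd degree or
misses some point. -/
theorem HasDegree.odd_or_exists_ne {u : UnitAddCircle → Circle} {n : ℤ} (hu : HasDegree u n)
    {t₀ : UnitAddCircle} (h1 : ∀ t, u t = 1 ↔ t = t₀) : Odd n ∨ ∃ ζ, ∀ t, u t ≠ ζ := by
  obtain ⟨θ, hθ, hθu, hθn⟩ := hu
  have hint : ∀ x : ℝ, u x = 1 ↔ ∃ m : ℤ, θ x = m := by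
    intro x
    rw [← hθu, circle_exp_eq_one_iff]
  obtain ⟨s, -, rfl⟩ := exists_rep t₀ 0
  obtain ⟨k, hk⟩ := (hint s).1 ((h1 s).2 rfl)
  have hno : ∀ x ∈ Ioo s (s + 1), ∀ m : ℤ, θ x ≠ m := by
    intro x hx m hm
    have := coe_inj (a := s) ⟨hx.1.le, hx.2⟩ ⟨le_rfl, by linarith⟩
      ((h1 x).1 ((hint x).2 ⟨m, hm⟩))
    linarith [hx.1]
  set a := ⌊θ (s + 1 / 2)⌋ with ha
  have hfl : ∀ x ∈ Ioo s (s + 1), ⌊θ x⌋ = a := by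
    intro x hx
    rcases le_total x (s + 1 / 2) with h | h
    · exact floor_eq_of_forall_ne hθ h fun y hy =>
        hno y ⟨by linarith [hx.1, hy.1], by linarith [hy.2]⟩
    · exact (floor_eq_of_forall_ne hθ h fun y hy =>
        hno y ⟨by linarith [hy.1], by linarith [hx.2, hy.2]⟩).symm
  -- over one period, `θ` goes from `k` to `k + n` within `[a, a + 1]`
  have hIcc : ∀ x ∈ Icc s (s + 1), θ x ∈ Icc (a : ℝ) (a + 1) := by
    have hcl : closure (Ioo s (s + 1)) ⊆ θ ⁻¹' Icc (a : ℝ) (a + 1) := by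
      refine closure_minimal (fun x hx => ?_) (isClosed_Icc.preimage hθ)
      rw [mem_preimage, ← hfl x hx]
      exact ⟨Int.floor_le _, (Int.lt_floor_add_one _).le⟩
    rw [closure_Ioo (by linarith)] at hcl
    exact hcl
  have hend : ∀ m : ℤ, (m : ℝ) ∈ Icc (a : ℝ) (a + 1) → m = a ∨ m = a + 1 := by
    rintro m ⟨h2, h3⟩
    have h2' : a ≤ m := by exact_mod_cast h2
    have h3' : m ≤ a + 1 := by exact_mod_cast h3
    omega
  have hk0 : k = a ∨ k = a + 1 := hend k (hk ▸ hIcc s ⟨le_rfl, by linarith⟩)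
  have hk1 : k + n = a ∨ k + n = a + 1 := by
    refine hend (k + n) ?_
    have := hIcc (s + 1) ⟨by linarith, le_rfl⟩
    rw [hθn, hk] at this
    exact_mod_cast this
  by_cases hn : n = 0
  · right
    -- the integer among `a`, `a + 1` that is not attained leaves a gap next to it
    obtain ⟨k', hk', hkne⟩ : ∃ k' : ℤ, (k' : ℝ) ∈ Icc (a : ℝ) (a + 1) ∧ k' ≠ k := by
      rcases hk0 with h | h
      · exact ⟨a + 1, by push_cast; exact ⟨by linarith, le_rfl⟩, by omega⟩
      · exact ⟨a, ⟨le_rfl, by linarith⟩, by omega⟩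
    have hnot : (k' : ℝ) ∉ θ '' Icc s (s + 1) := by
      rintro ⟨x, hx, hxk⟩
      rcases eq_or_lt_of_le hx.1 with h | h
      · rw [← h, hk] at hxk
        exact hkne (by exact_mod_cast hxk.symm)
      · rcases eq_or_lt_of_le hx.2 with h' | h'
        · rw [h', hθn, hk, hn] at hxk
          exact hkne (by exact_mod_cast (by simpa using hxk.symm))
        · exact hno x ⟨h, h'⟩ k' hxk
    have hclosed : IsClosed (θ '' Icc s (s + 1)) := (isCompact_Icc.image hθ).isClosed
    obtain ⟨μ, hμ, hμn⟩ : ∃ μ ∈ Ioo (a : ℝ) (a + 1), μ ∉ θ '' Icc s (s + 1) := by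
      by_contra hcon
      push Not at hcon
      have := closure_minimal hcon hclosed
      rw [closure_Ioo (by linarith)] at this
      exact hnot (this hk')
    refine ⟨Circle.exp (2 * Real.pi * μ), fun t ht => ?_⟩
    obtain ⟨x, hx, rfl⟩ := exists_rep t s
    rw [← hθu, circle_exp_eq_iff] at ht
    obtain ⟨j, hj⟩ := ht
    have hx' : x ∈ Icc s (s + 1) := ⟨hx.1, hx.2.le⟩
    have h2 := hIcc x hx'
    have hj1 : j < 1 := by
      have : (j : ℝ) < 1 := by linarith [h2.2, hμ.1]
      exact_mod_cast this
    have hj2 : -1 < j := by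
      have : (-1 : ℝ) < j := by linarith [h2.1, hμ.2]
      exact_mod_cast this
    have hj0 : j = 0 := by omega
    rw [hj0, Int.cast_zero, add_zero] at hj
    exact hμn ⟨x, hx', hj⟩
  · left
    have : n = 1 ∨ n = -1 := by omega
    rcases this with rfl | rfl <;> decide

lemma exists_retraction_closedBall {E : Type*} [NormedAddCommGroup E] [NormedSpace ℝ E] (z : E)
    {η : ℝ} (hη : 0 < η) :
    ∃ ρ : E → E, Continuous ρ ∧ (∀ x, ρ x ∈ closedBall z η) ∧ ∀ x ∈ closedBall z η, ρ x = x := by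
  have hpos : ∀ x : E, 0 < max η ‖x - z‖ := fun x => hη.trans_le (le_max_left _ _)
  refine ⟨fun x => z + (η / max η ‖x - z‖) • (x - z), ?_, ?_, ?_⟩
  · have : Continuous fun x : E => η / max η ‖x - z‖ :=
      Continuous.div (by fun_prop) (by fun_prop) fun x => (hpos x).ne'
    fun_prop
  · intro x
    rw [mem_closedBall, dist_eq_norm, add_sub_cancel_left, norm_smul,
      Real.norm_of_nonneg (div_nonneg hη.le (hpos x).le), div_mul_eq_mul_div, div_le_iff₀ (hpos x)]
    exact mul_le_mul_of_nonneg_left (le_max_right _ _) hη.le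
  · intro x hx
    rw [mem_closedBall, dist_eq_norm] at hx
    simp [max_eq_left hx, div_self hη.ne']

/-- Another parametrization of the solid torus multiplies the degree of closed curves by a
constant `m`, the degree of the change of coordinates. -/
lemma HasDegree.exists_mul {M : Type*} [TopologicalSpace M] {U : Set M}
    (h h' : (Circle × closedBall (0 : ℂ) 1) ≃ₜ U) :
    ∃ m : ℤ, ∀ (N : UnitAddCircle → U) (_ : Continuous N) (n : ℤ),
      HasDegree (fun t => (h.symm (N t)).1) n → HasDegree (fun t => (h'.symm (N t)).1) (m * n) := by
  -- retract the plane to the disk, in order to lift on a vector space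
  obtain ⟨ρ, hρ, hρmem, hρid⟩ := exists_retraction_closedBall (0 : ℂ) one_pos
  let ret : ℂ → closedBall (0 : ℂ) 1 := fun d => ⟨ρ d, hρmem d⟩
  have hret : Continuous ret := hρ.subtype_mk _
  have hretid : ∀ d : closedBall (0 : ℂ) 1, ret d = d := fun d => Subtype.ext (hρid d d.2)
  obtain ⟨F, hF, hFe⟩ := exists_circle_lift (A := ℝ × ℂ)
    (f := fun p => (h'.symm (h (Circle.exp (2 * Real.pi * p.1), ret p.2))).1) (by fun_prop)
  obtain ⟨m, hm⟩ := exists_int_add (A := ℝ × ℂ) (f := fun p => F (p.1 + 1, p.2)) (g := F)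
    (by fun_prop) hF (by
      rintro ⟨x, d⟩
      rw [hFe, hFe]
      have : Circle.exp (2 * Real.pi * (x + 1)) = Circle.exp (2 * Real.pi * x) :=
        circle_exp_eq_iff.2 ⟨1, by simp⟩
      simp only [this])
  have hmk : ∀ (n : ℤ) (x : ℝ) (d : ℂ), F (x + n, d) = F (x, d) + m * n := by
    intro n x d
    induction n using Int.induction_on with
    | zero => simp
    | succ i ih =>
      have := hm (x + i, d)
      simp only at this
      push_cast at ih ⊢
      rw [← add_assoc, this, ih]; ring
    | pred i ih =>
      have := hm (x + (-i - 1), d)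
      simp only at this
      push_cast at ih ⊢
      have h2 : x + (-(i : ℝ) - 1) + 1 = x + -i := by ring
      rw [h2, ih] at this
      linarith
  refine ⟨m, fun N hN n => ?_⟩
  rintro ⟨θ, hθ, hθu, hθn⟩
  refine ⟨fun s => F (θ s, (h.symm (N s)).2), ?_, fun s => ?_, fun s => ?_⟩
  · have : Continuous fun s : ℝ => N s := hN.comp (AddCircle.continuous_mk' 1)
    fun_prop
  · rw [hFe]
    simp only [hretid, hθu]
    rw [Prod.mk.eta, h.apply_symm_apply]
  · simp only [hθn, coe_add_one, hmk]
    push_cast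
    ring

/-- If a curve in a solid torus meets one meridional disk exactly twice, transversally, and another
one at most once, then it misses some meridional disk. -/
theorem exists_disjoint_meridian {M : Type*} [TopologicalSpace M] {U : Set M}
    {N : UnitAddCircle → M} (hNc : Continuous N) (hNi : Function.Injective N) (hN : ∀ t, N t ∈ U)
    {h : (Circle × closedBall (0 : ℂ) 1) ≃ₜ U} (h2 : {t | (h.symm ⟨N t, hN t⟩).1 = 1}.encard = 2)
    (hs : ∀ t, (h.symm ⟨N t, hN t⟩).1 = 1 → ∃ s : ℝ, (s : UnitAddCircle) = t ∧
      ChangesSign (fun u : ℝ => ((h.symm ⟨N u, hN u⟩).1 : ℂ).im) s)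
    (hlt : wrappingNumber U (range N) < 2) :
    ∃ h' : (Circle × closedBall (0 : ℂ) 1) ≃ₜ U, ∀ t, (h'.symm ⟨N t, hN t⟩).1 ≠ 1 := by
  obtain ⟨k, ⟨D, ⟨h', rfl⟩, rfl⟩, hk⟩ := sInf_lt_iff.1 hlt
  rw [meridian_inter_range hN h', hNi.encard_image] at hk
  have hk' : {t | (h'.symm ⟨N t, hN t⟩).1 = 1}.encard ≤ 1 :=
    Order.le_of_lt_add_one (by rw [one_add_one_eq_two]; exact hk)
  rw [encard_le_one_iff_eq] at hk'
  rcases hk' with he | ⟨t₀, ht₀⟩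
  · refine ⟨h', fun t ht => ?_⟩
    have : t ∈ {t | (h'.symm ⟨N t, hN t⟩).1 = 1} := ht
    rw [he] at this
    exact this
  have hcont : Continuous fun t => (⟨N t, hN t⟩ : U) := by fun_prop
  obtain ⟨n, hn⟩ := exists_hasDegree (u := fun t => (h.symm ⟨N t, hN t⟩).1) (by fun_prop)
  have hev := hn.even h2 hs
  obtain ⟨m, hm⟩ := HasDegree.exists_mul h h'
  have hn' := hm (fun t => ⟨N t, hN t⟩) hcont n hn
  rcases hn'.odd_or_exists_ne (t₀ := t₀) (fun t => by
    have : t ∈ {t | (h'.symm ⟨N t, hN t⟩).1 = 1} ↔ t ∈ ({t₀} : Set UnitAddCircle) := by rw [ht₀]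
    simpa using this) with hodd | ⟨ζ, hζ⟩
  · exact absurd (hev.mul_left m) (Int.not_even_iff_odd.2 hodd)
  · refine ⟨((Homeomorph.mulLeft ζ).prodCongr (Homeomorph.refl _)).trans h', fun t ht => hζ t ?_⟩
    change ζ⁻¹ * (h'.symm ⟨N t, hN t⟩).1 = 1 at ht
    exact (inv_mul_eq_one.1 ht).symm

/-! ### The space does not retract to the complement of a point -/

lemma exists_polynomial_det {E : Type*} [NormedAddCommGroup E] [NormedSpace ℝ E]
    [FiniteDimensional ℝ E] (A : E →L[ℝ] E) :
    ∃ p : Polynomial ℝ, p.natDegree ≤ Module.finrank ℝ E ∧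
      ∀ t : ℝ, p.eval t = (ContinuousLinearMap.id ℝ E + t • A).det := by
  let b := Module.finBasis ℝ E
  set M := LinearMap.toMatrix b b (A : E →ₗ[ℝ] E) with hM
  refine ⟨((Polynomial.X : Polynomial ℝ) • M.map Polynomial.C +
    (1 : Matrix (Fin (Module.finrank ℝ E)) (Fin (Module.finrank ℝ E)) ℝ).map Polynomial.C).det,
    ?_, ?_⟩
  · exact (Polynomial.natDegree_det_X_add_C_le M 1).trans (by simp)
  · intro t
    have h1 : (ContinuousLinearMap.id ℝ E + t • A).det =
        (LinearMap.toMatrix b b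
          ((ContinuousLinearMap.id ℝ E + t • A : E →L[ℝ] E) : E →ₗ[ℝ] E)).det :=
      (LinearMap.det_toMatrix b _).symm
    have h2 : LinearMap.toMatrix b b
        ((ContinuousLinearMap.id ℝ E + t • A : E →L[ℝ] E) : E →ₗ[ℝ] E) = 1 + t • M := by
      have : ((ContinuousLinearMap.id ℝ E + t • A : E →L[ℝ] E) : E →ₗ[ℝ] E) =
        LinearMap.id + t • (A : E →ₗ[ℝ] E) := rfl
      rw [this, map_add, map_smul, LinearMap.toMatrix_id, hM]
    rw [h1, h2, ← Polynomial.coe_evalRingHom, RingHom.map_det]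
    congr 1
    ext i j
    by_cases hij : i = j
    · subst hij
      simp [Matrix.map_apply]
      ring
    · simp [Matrix.map_apply, Matrix.one_apply_ne hij]
      ring

lemma det_id_add_pos {E : Type*} [NormedAddCommGroup E] [NormedSpace ℝ E]
    [FiniteDimensional ℝ E] {A : E →L[ℝ] E} (hA : ‖A‖ < 1) :
    0 < (ContinuousLinearMap.id ℝ E + A).det := by
  have hne : ∀ t ∈ Icc (0 : ℝ) 1, (ContinuousLinearMap.id ℝ E + t • A).det ≠ 0 := by
    intro t ht h0
    obtain ⟨x, hx, hx0⟩ := Submodule.exists_mem_ne_zero_of_ne_bot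
      (LinearMap.bot_lt_ker_of_det_eq_zero h0).ne'
    have h1 : x + t • A x = 0 := by simpa using hx
    have h2 : ‖x‖ = t * ‖A x‖ := by
      have := congrArg norm (eq_neg_of_add_eq_zero_left h1)
      rwa [norm_neg, norm_smul, Real.norm_of_nonneg ht.1] at this
    have h3 : ‖A x‖ ≤ ‖A‖ * ‖x‖ := A.le_opNorm x
    have h4 : 0 < ‖x‖ := norm_pos_iff.2 hx0
    nlinarith [ht.1, ht.2, norm_nonneg (A x)]
  have hc : Continuous fun t : ℝ => (ContinuousLinearMap.id ℝ E + t • A).det :=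
    ContinuousLinearMap.continuous_det.comp (by fun_prop)
  by_contra hle
  push Not at hle
  have h0 : (ContinuousLinearMap.id ℝ E + (0 : ℝ) • A).det = 1 := by
    rw [zero_smul, add_zero]
    exact LinearMap.det_id
  obtain ⟨t, ht, ht0⟩ := intermediate_value_Icc' (zero_le_one (α := ℝ)) hc.continuousOn
    (show (0 : ℝ) ∈ Icc _ _ from ⟨by simpa using hle, by simp only [h0]; exact zero_le_one⟩)
  exact hne t ht ht0

/-- The Jacobian determinant of a map that is the identity outside a ball has the mean value one
on this ball: for maps close to the identity this is the change of variables formula, and in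
general the determinant depends polynomially on the parameter of the affine homotopy to the
identity. -/
theorem integral_det_id_add {E : Type*} [NormedAddCommGroup E] [NormedSpace ℝ E]
    [FiniteDimensional ℝ E] [MeasurableSpace E] [BorelSpace E] (μ : MeasureTheory.Measure E)
    [μ.IsAddHaarMeasure] {G : E → E} (hG : ContDiff ℝ 1 G) {M : ℝ} (hM : ∀ x, M ≤ ‖x‖ → G x = 0) :
    ∫ x in ball 0 M, (ContinuousLinearMap.id ℝ E + fderiv ℝ G x).det ∂μ = μ.real (ball 0 M) := by
  have hsupp : HasCompactSupport G := by
    refine HasCompactSupport.intro (isCompact_closedBall (0 : E) M) fun x hx => hM x ?_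
    simpa using (not_le.1 (fun h => hx (mem_closedBall_zero_iff.2 h))).le
  obtain ⟨C, hC⟩ := hG.lipschitzWith_of_hasCompactSupport hsupp one_ne_zero
  have hd : ∀ x, ‖fderiv ℝ G x‖ ≤ C := fun x => norm_fderiv_le_of_lipschitz ℝ hC
  have hdc : Continuous (fderiv ℝ G) := hG.continuous_fderiv one_ne_zero
  set ε : ℝ := 1 / (C + 1) with hε
  have hC0 : (0 : ℝ) ≤ C := C.2
  have hε0 : 0 < ε := by positivity
  have hεC : ε * C < 1 := by
    rw [hε, div_mul_eq_mul_div, one_mul, div_lt_one (by positivity)]; linarith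
  -- the case of maps close to the identity
  have hsmall : ∀ t ∈ Icc 0 ε,
      ∫ x in ball 0 M, (ContinuousLinearMap.id ℝ E + t • fderiv ℝ G x).det ∂μ =
        μ.real (ball 0 M) := by
    intro t ht
    have htC : t * C < 1 := (mul_le_mul_of_nonneg_right ht.2 hC0).trans_lt hεC
    let f : E → E := fun x => x + t • G x
    have hf' : ∀ x, HasFDerivAt f (ContinuousLinearMap.id ℝ E + t • fderiv ℝ G x) x := fun x =>
      (hasFDerivAt_id x).add (((hG.differentiable one_ne_zero) x).hasFDerivAt.const_smul t)
    have happ : ApproximatesLinearOn f ((ContinuousLinearEquiv.refl ℝ E : E ≃L[ℝ] E) : E →L[ℝ] E)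
        univ (Real.toNNReal t * C) := by
      intro x _ y _
      have h1 : f x - f y - ((ContinuousLinearEquiv.refl ℝ E : E ≃L[ℝ] E) : E →L[ℝ] E) (x - y) =
          t • (G x - G y) := by
        simp [f, smul_sub]; abel
      rw [h1, norm_smul, Real.norm_of_nonneg ht.1, NNReal.coe_mul, Real.coe_toNNReal _ ht.1,
        mul_assoc]
      have h2 := hC.dist_le_mul x y
      rw [dist_eq_norm, dist_eq_norm] at h2
      exact mul_le_mul_of_nonneg_left h2 ht.1
    have hinv : Subsingleton E ∨ Real.toNNReal t * C <
        ‖((ContinuousLinearEquiv.refl ℝ E : E ≃L[ℝ] E).symm : E →L[ℝ] E)‖₊⁻¹ := by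
      rcases subsingleton_or_nontrivial E with h | h
      · exact Or.inl h
      · right
        have h1 : ‖((ContinuousLinearEquiv.refl ℝ E : E ≃L[ℝ] E).symm : E →L[ℝ] E)‖₊ = 1 := by
          apply NNReal.eq
          simp
        rw [h1, inv_one, ← NNReal.coe_lt_coe, NNReal.coe_mul, Real.coe_toNNReal _ ht.1]
        exact htC
    let φ := happ.toHomeomorph f hinv
    have hφ : ∀ x, φ x = f x := fun x => rfl
    have hfix : ∀ x, M ≤ ‖x‖ → φ x = x := fun x hx => by
      rw [hφ]; simp [f, hM x hx]
    have himage : f '' ball 0 M = ball 0 M := by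
      have h1 : f '' ball 0 M = φ '' ball 0 M := rfl
      rw [h1]
      ext y
      constructor
      · rintro ⟨x, hx, rfl⟩
        by_contra h
        have h2 : φ x = x := φ.injective (hfix _ (by simpa using h))
        rw [h2] at h; exact h hx
      · intro hy
        refine ⟨φ.symm y, ?_, φ.apply_symm_apply y⟩
        by_contra h
        have h2 := hfix (φ.symm y) (by simpa using h)
        rw [φ.apply_symm_apply] at h2
        rw [← h2] at h; exact h hy
    have hcv := MeasureTheory.integral_image_eq_integral_abs_det_fderiv_smul μ
      (measurableSet_ball (x := (0 : E)) (ε := M))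
      (fun x _ => (hf' x).hasFDerivWithinAt) (φ.injective.injOn) (fun _ => (1 : ℝ))
    have hl : ∫ _ in f '' ball 0 M, (1 : ℝ) ∂μ = μ.real (ball 0 M) := by
      rw [himage]; simp
    have hcv' : μ.real (ball 0 M) = ∫ x in ball 0 M,
        |(ContinuousLinearMap.id ℝ E + t • fderiv ℝ G x).det| • (1 : ℝ) ∂μ := hl.symm.trans hcv
    rw [hcv']
    refine MeasureTheory.integral_congr_ae (Eventually.of_forall fun x => ?_)
    have hpos : 0 < (ContinuousLinearMap.id ℝ E + t • fderiv ℝ G x).det := by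
      refine det_id_add_pos ?_
      rw [norm_smul, Real.norm_of_nonneg ht.1]
      exact (mul_le_mul_of_nonneg_left (hd x) ht.1).trans_lt htC
    simp only [smul_eq_mul, mul_one, abs_of_pos hpos]
  -- the determinant is interpolated from parameters in `[0, ε]`
  set n := Module.finrank ℝ E
  let v : ℕ → ℝ := fun i => ε * (i / (n + 1))
  have hv : InjOn v (Finset.range (n + 1) : Set ℕ) := by
    intro i _ j _ hij
    have h1 : (i : ℝ) / (n + 1) = j / (n + 1) := mul_left_cancel₀ hε0.ne' hij
    have h2 : (i : ℝ) = j := by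
      have h3 : ((n : ℝ) + 1) ≠ 0 := by positivity
      field_simp at h1
      exact h1
    exact_mod_cast h2
  have hvmem : ∀ i ∈ Finset.range (n + 1), v i ∈ Icc 0 ε := by
    intro i hi
    have h1 : (i : ℝ) ≤ n + 1 := by
      have := Finset.mem_range.1 hi
      exact_mod_cast this.le
    refine ⟨by positivity, ?_⟩
    have h2 : (i : ℝ) / (n + 1) ≤ 1 := (div_le_one (by positivity)).2 h1
    exact mul_le_of_le_one_right hε0.le h2
  let w : ℕ → ℝ := fun i => (Lagrange.basis (Finset.range (n + 1)) v i).eval 1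
  have hw : ∑ i ∈ Finset.range (n + 1), w i = 1 := by
    have := Lagrange.sum_basis hv ⟨0, Finset.mem_range.2 (Nat.succ_pos n)⟩
    have h2 := congrArg (Polynomial.eval 1) this
    rw [Polynomial.eval_finsetSum, Polynomial.eval_one] at h2
    exact h2
  have hint : ∀ x, (ContinuousLinearMap.id ℝ E + fderiv ℝ G x).det =
      ∑ i ∈ Finset.range (n + 1), w i * (ContinuousLinearMap.id ℝ E + v i • fderiv ℝ G x).det := by
    intro x
    obtain ⟨p, hp, hpe⟩ := exists_polynomial_det (fderiv ℝ G x)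
    have h1 : p.degree < ((Finset.range (n + 1)).card : ℕ) := by
      rw [Finset.card_range]
      refine lt_of_le_of_lt Polynomial.degree_le_natDegree ?_
      exact_mod_cast Nat.lt_succ_of_le hp
    have h2 := Lagrange.eq_interpolate hv h1
    have h3 := congrArg (Polynomial.eval 1) h2
    rw [hpe, one_smul, Lagrange.interpolate_apply, Polynomial.eval_finsetSum] at h3
    rw [h3]
    refine Finset.sum_congr rfl fun i _ => ?_
    rw [Polynomial.eval_mul, Polynomial.eval_C, hpe, mul_comm]
  have hintegrable : ∀ t : ℝ, MeasureTheory.IntegrableOn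
      (fun x => (ContinuousLinearMap.id ℝ E + t • fderiv ℝ G x).det) (ball 0 M) μ := by
    intro t
    have hc : Continuous fun x => (ContinuousLinearMap.id ℝ E + t • fderiv ℝ G x).det :=
      ContinuousLinearMap.continuous_det.comp (by fun_prop)
    exact (hc.continuousOn.integrableOn_compact (isCompact_closedBall 0 M)).mono_set
      ball_subset_closedBall
  simp_rw [hint]
  rw [MeasureTheory.integral_finsetSum _ fun i _ => (hintegrable (v i)).const_mul (w i)]
  simp_rw [MeasureTheory.integral_const_mul]
  rw [Finset.sum_congr rfl fun i hi => by rw [hsmall (v i) (hvmem i hi)], ← Finset.sum_mul, hw,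
    one_mul]

/-- A continuous self map of a Euclidean space that is the identity far away takes the value `0`.
Otherwise a smooth approximation can be pushed outwards, to a map whose Jacobian determinant
vanishes on a ball; this contradicts the mean value of the determinant. -/
theorem exists_zero_of_eq_id {E : Type*} [NormedAddCommGroup E] [InnerProductSpace ℝ E]
    [FiniteDimensional ℝ E] [MeasurableSpace E] [BorelSpace E] {q : E → E} (hq : Continuous q)
    {R₀ : ℝ} (hid : ∀ x, R₀ ≤ ‖x‖ → q x = x) : ∃ x, q x = 0 := by
  by_contra hno
  push Not at hno
  have hR₀ : 0 < R₀ := by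
    by_contra h
    exact hno 0 (hid 0 (by simpa using h))
  -- a positive lower bound of the norm
  obtain ⟨c, hc, hcq⟩ : ∃ c > 0, ∀ x, c ≤ ‖q x‖ := by
    obtain ⟨x₀, hx₀, hmin⟩ := (isCompact_closedBall (0 : E) R₀).exists_isMinOn
      ⟨0, by simpa using hR₀.le⟩ (f := fun x => ‖q x‖) (by fun_prop)
    refine ⟨min ‖q x₀‖ R₀, lt_min (norm_pos_iff.2 (hno x₀)) hR₀, fun x => ?_⟩
    by_cases h : ‖x‖ ≤ R₀
    · exact (min_le_left _ _).trans (hmin (mem_closedBall_zero_iff.2 h))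
    · have h' := (not_le.1 h).le
      rw [hid x h']
      exact (min_le_right _ _).trans h'
  -- a smooth approximation
  have hgs : HasCompactSupport fun x => q x - x :=
    HasCompactSupport.intro (isCompact_closedBall (0 : E) R₀) fun x hx => by
      have : R₀ ≤ ‖x‖ := by simpa using (not_le.1 (fun h => hx (mem_closedBall_zero_iff.2 h))).le
      rw [hid x this, sub_self]
  have hgc : Continuous fun x => q x - x := by fun_prop
  obtain ⟨ε, hε, huc⟩ := Metric.uniformContinuous_iff.1
    (hgs.uniformContinuous_of_continuous hgc) (c / 2) (half_pos hc)
  obtain ⟨g, hg, hgd⟩ := hgc.exists_contDiff_dist_le_of_forall_mem_ball_dist_le hε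
  set R₁ := R₀ + ε with hR₁
  have hgfar : ∀ x, R₁ ≤ ‖x‖ → g x = 0 := by
    intro x hx
    have h1 : q x - x = 0 := by rw [hid x (by linarith), sub_self]
    have h2 := hgd x 0 (by
      intro y hy
      have h3 : R₀ ≤ ‖y‖ := by
        have h4 := norm_sub_norm_le x y
        rw [mem_ball, dist_comm, dist_eq_norm] at hy
        linarith
      rw [h1, hid y h3, sub_self, dist_self])
    rw [h1] at h2
    exact dist_le_zero.1 h2
  let q₁ : E → E := fun x => x + g x
  have hq₁ : ContDiff ℝ 1 q₁ := contDiff_id.add (hg.of_le (by exact_mod_cast le_top))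
  have hq₁id : ∀ x, R₁ ≤ ‖x‖ → q₁ x = x := fun x hx => by simp [q₁, hgfar x hx]
  have hq₁0 : ∀ x, q₁ x ≠ 0 := by
    intro x hx
    have h1 := hgd x (c / 2) (fun y hy => (huc hy).le)
    have h2 : g x - (q x - x) = -q x := by
      have : g x = -x := (neg_eq_of_add_eq_zero_right hx).symm
      rw [this]; abel
    rw [dist_eq_norm, h2, norm_neg] at h1
    linarith [hcq x]
  obtain ⟨B, hB⟩ :=
    ((isCompact_closedBall (0 : E) R₁).image hq₁.continuous).isBounded.exists_norm_le
  set R₂ := max R₁ B with hR₂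
  have hR₂0 : 0 < R₂ := lt_of_lt_of_le (by positivity) (le_max_left _ _)
  have hin : ∀ x, ‖x‖ ≤ R₂ → ‖q₁ x‖ ≤ R₂ := by
    intro x hx
    by_cases h : ‖x‖ ≤ R₁
    · exact (hB _ (mem_image_of_mem _ (mem_closedBall_zero_iff.2 h))).trans (le_max_right _ _)
    · rwa [hq₁id x (not_le.1 h).le]
  -- push outwards to the sphere of radius `R₂`
  let m : ℝ → ℝ := fun ρ => R₂ + (ρ - R₂) * Real.smoothTransition (ρ - R₂)
  have hm : ContDiff ℝ 1 m :=
    contDiff_const.add ((contDiff_id.sub contDiff_const).mul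
      ((Real.smoothTransition.contDiff (n := 1)).comp (contDiff_id.sub contDiff_const)))
  have hm1 : ∀ ρ ≤ R₂, m ρ = R₂ := fun ρ hρ => by
    simp [m, Real.smoothTransition.zero_of_nonpos (sub_nonpos.2 hρ)]
  have hm2 : ∀ ρ, R₂ + 1 ≤ ρ → m ρ = ρ := fun ρ hρ => by
    simp [m, Real.smoothTransition.one_of_one_le (show 1 ≤ ρ - R₂ by linarith)]
  have hm3 : ∀ ρ, R₂ ≤ ρ → R₂ ≤ m ρ := fun ρ hρ => by
    have := mul_nonneg (sub_nonneg.2 hρ) (Real.smoothTransition.nonneg (ρ - R₂))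
    simp only [m]; linarith
  have hm4 : ∀ ρ, R₂ ≤ ρ → m ρ ≤ ρ := fun ρ hρ => by
    have := mul_le_mul_of_nonneg_left (Real.smoothTransition.le_one (ρ - R₂)) (sub_nonneg.2 hρ)
    simp only [m]; linarith
  have hm5 : StrictMonoOn m (Ici R₂) := by
    intro a ha b hb hab
    have ha' : R₂ ≤ a := ha
    have h1 : 0 < Real.smoothTransition (b - R₂) :=
      Real.smoothTransition.pos_of_pos (by linarith)
    have h2 : Real.smoothTransition (a - R₂) ≤ Real.smoothTransition (b - R₂) :=
      Real.smoothTransition.monotone (by linarith)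
    have h3 := mul_le_mul_of_nonneg_left h2 (sub_nonneg.2 ha')
    have h4 := mul_lt_mul_of_pos_right (show a - R₂ < b - R₂ by linarith) h1
    simp only [m]; linarith
  let F : E → E := fun x => (m ‖q₁ x‖ / ‖q₁ x‖) • q₁ x
  have hnq : ContDiff ℝ 1 fun x => ‖q₁ x‖ := hq₁.norm ℝ hq₁0
  have hF : ContDiff ℝ 1 F :=
    ((hm.comp hnq).div hnq fun x => norm_ne_zero_iff.2 (hq₁0 x)).smul hq₁
  have hFn : ∀ x, 0 ≤ m ‖q₁ x‖ → ‖F x‖ = m ‖q₁ x‖ := by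
    intro x hx
    have h1 := norm_ne_zero_iff.2 (hq₁0 x)
    rw [norm_smul, norm_div, norm_norm, Real.norm_of_nonneg hx]
    field_simp
  have hFin : ∀ x, ‖x‖ ≤ R₂ → ‖F x‖ = R₂ := by
    intro x hx
    have := hm1 _ (hin x hx)
    rw [hFn x (by rw [this]; exact hR₂0.le), this]
  have hFout : ∀ x, R₂ ≤ ‖x‖ → F x = (m ‖x‖ / ‖x‖) • x := by
    intro x hx
    simp only [F]
    rw [hq₁id x ((le_max_left _ _).trans hx)]
  have hFoutn : ∀ x, R₂ ≤ ‖x‖ → ‖F x‖ = m ‖x‖ := by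
    intro x hx
    have h1 := hFn x
    rw [hq₁id x ((le_max_left _ _).trans hx)] at h1
    exact h1 (hR₂0.le.trans (hm3 _ hx))
  have hFid : ∀ x, R₂ + 1 ≤ ‖x‖ → F x = x := by
    intro x hx
    rw [hFout x (by linarith), hm2 _ hx, div_self (by linarith), one_smul]
  let μ : MeasureTheory.Measure E := MeasureTheory.Measure.addHaar
  have hmean := integral_det_id_add μ (G := fun x => F x - x) (hF.sub contDiff_id)
    (M := R₂ + 1) (fun x hx => by rw [hFid x hx, sub_self])
  have hFd : ∀ x, DifferentiableAt ℝ F x := fun x => hF.differentiable one_ne_zero x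
  have hderiv : ∀ x, ContinuousLinearMap.id ℝ E + fderiv ℝ (fun x => F x - x) x = fderiv ℝ F x := by
    intro x
    have h1 : fderiv ℝ (fun x => F x - x) x = fderiv ℝ F x - ContinuousLinearMap.id ℝ E := by
      rw [fderiv_fun_sub (hFd x) differentiableAt_fun_id, fderiv_fun_id]
    rw [h1, add_sub_cancel]
  simp_rw [hderiv] at hmean
  -- the determinant vanishes where the image lies in the sphere
  have hdet : ∀ x ∈ ball (0 : E) R₂, (fderiv ℝ F x).det = 0 := by
    intro x hx
    by_contra hne
    have hsurj : Function.Surjective (fderiv ℝ F x) := by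
      have h1 := LinearMap.isUnit_iff_isUnit_det (fderiv ℝ F x : E →ₗ[ℝ] E) |>.2
        (isUnit_iff_ne_zero.2 hne)
      exact ((Module.End.isUnit_iff _).1 h1).2
    obtain ⟨v, hv⟩ := hsurj (F x)
    have h1 : HasFDerivAt (fun y => inner ℝ (F y) (F y)) _ x :=
      (hFd x).hasFDerivAt.inner ℝ (hFd x).hasFDerivAt
    have h2 : (fun y => inner ℝ (F y) (F y)) =ᶠ[𝓝 x] fun _ => R₂ ^ 2 := by
      filter_upwards [isOpen_ball.mem_nhds hx] with y hy
      rw [real_inner_self_eq_norm_sq, hFin y (mem_ball_zero_iff.1 hy).le]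
    have h3 := h1.unique ((hasFDerivAt_const (R₂ ^ 2) x).congr_of_eventuallyEq h2)
    have h4 := congrArg (fun L : E →L[ℝ] ℝ => L v) h3
    simp only [ContinuousLinearMap.comp_apply, ContinuousLinearMap.prod_apply, fderivInnerCLM_apply,
      hv, zero_apply] at h4
    rw [real_inner_self_eq_norm_sq, hFin x (mem_ball_zero_iff.1 hx).le] at h4
    nlinarith
  set S : Set E := ball 0 (R₂ + 1) \ ball 0 R₂ with hS
  have hSm : MeasurableSet S := measurableSet_ball.diff measurableSet_ball
  have hSmem : ∀ x ∈ S, R₂ ≤ ‖x‖ ∧ ‖x‖ < R₂ + 1 := fun x hx =>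
    ⟨by simpa using hx.2, by simpa using hx.1⟩
  have hinj : InjOn F S := by
    intro x hx y hy hxy
    have hx1 := (hSmem x hx).1
    have hy1 := (hSmem y hy).1
    have h1 : m ‖x‖ = m ‖y‖ := by rw [← hFoutn x hx1, ← hFoutn y hy1, hxy]
    have h2 : ‖x‖ = ‖y‖ := hm5.injOn hx1 hy1 h1
    rw [hFout x hx1, hFout y hy1, h2] at hxy
    refine smul_right_injective E (r := m ‖y‖ / ‖y‖) ?_ hxy
    have h3 : 0 < m ‖y‖ := hR₂0.trans_le (hm3 _ hy1)
    have h4 : 0 < ‖y‖ := hR₂0.trans_le hy1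
    positivity
  have himg : F '' S ⊆ S := by
    rintro _ ⟨x, hx, rfl⟩
    obtain ⟨h1, h2⟩ := hSmem x hx
    have h3 := hFoutn x h1
    refine ⟨?_, ?_⟩
    · rw [mem_ball_zero_iff, h3]
      exact (hm4 _ h1).trans_lt h2
    · rw [mem_ball_zero_iff, h3, not_lt]
      exact hm3 _ h1
  have hcont : Continuous fun x => (fderiv ℝ F x).det :=
    ContinuousLinearMap.continuous_det.comp (hF.continuous_fderiv one_ne_zero)
  have hI : MeasureTheory.IntegrableOn (fun x => (fderiv ℝ F x).det) (ball 0 (R₂ + 1)) μ :=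
    (hcont.continuousOn.integrableOn_compact (isCompact_closedBall 0 (R₂ + 1))).mono_set
      ball_subset_closedBall
  have hsub : ball (0 : E) R₂ ⊆ ball 0 (R₂ + 1) := ball_subset_ball (by linarith)
  have hsplit : ∫ x in ball 0 (R₂ + 1), (fderiv ℝ F x).det ∂μ =
      ∫ x in S, (fderiv ℝ F x).det ∂μ := by
    have h1 := MeasureTheory.setIntegral_sdiff (measurableSet_ball (x := (0 : E)) (ε := R₂)) hI hsub
    rw [← hS] at h1
    rw [h1, MeasureTheory.setIntegral_eq_zero_of_forall_eq_zero hdet, sub_zero]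
  have hcv := MeasureTheory.integral_image_eq_integral_abs_det_fderiv_smul μ hSm
    (fun x _ => (hFd x).hasFDerivAt.hasFDerivWithinAt) hinj (fun _ => (1 : ℝ))
  have hcv1 : ∫ _ in F '' S, (1 : ℝ) ∂μ = μ.real (F '' S) := by simp
  have hfin : ∀ ρ, μ (ball (0 : E) ρ) ≠ ⊤ := fun ρ => MeasureTheory.measure_ball_lt_top.ne
  have hle : μ.real (ball (0 : E) (R₂ + 1)) ≤ μ.real S := by
    rw [← hmean, hsplit]
    have hSI : MeasureTheory.IntegrableOn (fun x => (fderiv ℝ F x).det) S μ :=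
      hI.mono_set sdiff_subset
    calc ∫ x in S, (fderiv ℝ F x).det ∂μ
        ≤ ∫ x in S, |(fderiv ℝ F x).det| ∂μ :=
          MeasureTheory.integral_mono hSI hSI.abs fun x => le_abs_self _
      _ = μ.real (F '' S) := by
          rw [← hcv1, hcv]
          simp
      _ ≤ μ.real S := MeasureTheory.measureReal_mono himg
          (ne_top_of_le_ne_top (hfin (R₂ + 1)) (MeasureTheory.measure_mono sdiff_subset))
  have hsum := MeasureTheory.measureReal_sdiff hsub measurableSet_ball (hfin (R₂ + 1))
  rw [← hS] at hsum
  have hpos : 0 < μ.real (ball (0 : E) R₂) :=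
    ENNReal.toReal_pos (Metric.measure_ball_pos μ 0 hR₂0).ne' (hfin R₂)
  linarith

/-- A continuous self map of a finite dimensional space that is the identity far away is
surjective. -/
theorem surjective_of_eq_id {E : Type*} [NormedAddCommGroup E] [NormedSpace ℝ E]
    [FiniteDimensional ℝ E] {q : E → E} (hq : Continuous q) {R₀ : ℝ}
    (hid : ∀ x, R₀ ≤ ‖x‖ → q x = x) : Function.Surjective q := by
  intro z
  let L := toEuclidean (E := E)
  obtain ⟨B, hB⟩ : ∃ B, ∀ y, B ≤ ‖y‖ → R₀ ≤ ‖L.symm y + z‖ := by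
    have h1 : IsCompact (L '' ((fun y => y - z) '' closedBall (0 : E) R₀)) :=
      ((isCompact_closedBall 0 R₀).image (by fun_prop)).image L.continuous
    obtain ⟨B, hB⟩ := h1.isBounded.exists_norm_le
    refine ⟨B + 1, fun y hy => ?_⟩
    by_contra h
    have := hB y ⟨L.symm y, ⟨L.symm y + z, by simpa using (not_le.1 h).le, by simp⟩, by simp⟩
    linarith
  obtain ⟨x, hx⟩ := exists_zero_of_eq_id (q := fun y => L (q (L.symm y + z) - z)) (by fun_prop)
    (R₀ := B) (fun y hy => by rw [hid _ (hB y hy)]; simp)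
  exact ⟨L.symm x + z, sub_eq_zero.1 (L.map_eq_zero_iff.1 hx)⟩

/-! ### Boundary points of a solid torus -/

/-- A parametrization of a set by a solid torus maps boundary points of the solid torus to boundary
points of the set: otherwise shrinking the meridional disks a little would give a map near the
identity that misses an interior point. -/
lemma norm_lt_one_of_mem_interior {E : Type*} [NormedAddCommGroup E] [NormedSpace ℝ E]
    [FiniteDimensional ℝ E] {V : Set E} (h : (Circle × closedBall (0 : ℂ) 1) ≃ₜ V)
    {x₀ : Circle × closedBall (0 : ℂ) 1} (hx₀ : (h x₀ : E) ∈ interior V) : ‖(x₀.2 : ℂ)‖ < 1 := by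
  by_contra hnot
  have h1 : ‖(x₀.2 : ℂ)‖ = 1 :=
    le_antisymm (mem_closedBall_zero_iff.1 x₀.2.2) (not_lt.1 hnot)
  set z : E := ((h x₀ : V) : E) with hz
  obtain ⟨η, hη, hball⟩ := Metric.nhds_basis_closedBall.mem_iff.1 (mem_interior_iff_mem_nhds.1 hx₀)
  have huc : UniformContinuous h := CompactSpace.uniformContinuous_of_continuous h.continuous
  obtain ⟨δ, hδ, hhδ⟩ := Metric.uniformContinuous_iff.1 huc (η / 2) (half_pos hη)
  obtain ⟨τ, hτ0, hτ⟩ : ∃ τ : ℝ, 0 < τ ∧ τ < δ ∧ τ ≤ 1 :=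
    ⟨min (δ / 2) 1, by positivity, (min_le_left _ _).trans_lt (by linarith), min_le_right _ _⟩
  have hle : ∀ d : closedBall (0 : ℂ) 1, ‖(d : ℂ)‖ ≤ 1 := fun d => mem_closedBall_zero_iff.1 d.2
  let T : Circle × closedBall (0 : ℂ) 1 → Circle × closedBall (0 : ℂ) 1 := fun x =>
    (x.1, ⟨(1 - τ) • (x.2 : ℂ), mem_closedBall_zero_iff.2 (by
      rw [norm_smul, Real.norm_of_nonneg (by linarith)]
      nlinarith [hle x.2, norm_nonneg (x.2 : ℂ)])⟩)
  have hT : Continuous T := by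
    refine continuous_fst.prodMk (Continuous.subtype_mk ?_ _)
    fun_prop
  have hTd : ∀ x, dist (T x) x < δ := by
    intro x
    rw [Prod.dist_eq, max_lt_iff]
    refine ⟨by simpa [T] using hδ, ?_⟩
    have : dist (T x).2 x.2 = ‖(1 - τ) • (x.2 : ℂ) - x.2‖ := by
      rw [Subtype.dist_eq, dist_eq_norm]
    have h2 : (1 - τ) • (x.2 : ℂ) - x.2 = (-τ) • (x.2 : ℂ) := by
      rw [sub_smul, one_smul, neg_smul]; ring
    rw [this, h2, norm_smul, norm_neg, Real.norm_of_nonneg hτ0.le]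
    nlinarith [hle x.2]
  have hTne : ∀ x, T x ≠ x₀ := by
    intro x hx
    have h2 : ‖((T x).2 : ℂ)‖ = 1 := by rw [hx, h1]
    have h3 : ((T x).2 : ℂ) = (1 - τ) • (x.2 : ℂ) := rfl
    rw [h3, norm_smul, Real.norm_of_nonneg (by linarith)] at h2
    nlinarith [hle x.2, norm_nonneg (x.2 : ℂ)]
  obtain ⟨ρ, hρ, hρmem, hρid⟩ := exists_retraction_closedBall z hη
  let g : E → E := fun x => h (T (h.symm ⟨ρ x, hball (hρmem x)⟩))
  have hg : Continuous g := continuous_subtype_val.comp <| h.continuous.comp <| hT.comp <|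
    h.symm.continuous.comp (hρ.subtype_mk _)
  have hgρ : ∀ x, ‖g x - ρ x‖ < η / 2 := by
    intro x
    have h2 := hhδ (hTd (h.symm ⟨ρ x, hball (hρmem x)⟩))
    rwa [h.apply_symm_apply, Subtype.dist_eq, dist_eq_norm] at h2
  have hgz : ∀ x, g x ≠ z := fun x hx => hTne _ (h.injective (Subtype.ext hx))
  let χ : E → ℝ := fun x => max 0 (min 1 (2 - 2 * ‖x - z‖ / η))
  have hχ : Continuous χ := by simp only [χ]; fun_prop
  have hχ0 : ∀ x, 0 ≤ χ x := fun x => le_max_left _ _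
  have hχ1 : ∀ x, χ x ≤ 1 := fun x => max_le zero_le_one (min_le_left _ _)
  have hfar : ∀ x, η ≤ ‖x - z‖ → χ x = 0 := by
    intro x hx
    refine max_eq_left ((min_le_right _ _).trans ?_)
    rw [sub_nonpos, le_div_iff₀ hη]
    linarith
  have hnear : ∀ x, ‖x - z‖ ≤ η / 2 → χ x = 1 := by
    intro x hx
    have h2 : 1 ≤ 2 - 2 * ‖x - z‖ / η := by
      have : 2 * ‖x - z‖ / η ≤ 1 := (div_le_one hη).2 (by linarith)
      linarith
    simp only [χ]
    rw [min_eq_left h2, max_eq_right zero_le_one]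
  obtain ⟨x, hx⟩ := surjective_of_eq_id (q := fun x => x + χ x • (g x - ρ x)) (by fun_prop)
    (R₀ := ‖z‖ + η) (fun x hx => by
      have := norm_le_norm_sub_add x z
      rw [hfar x (by linarith), zero_smul, add_zero]) z
  simp only at hx
  by_cases h2 : ‖x - z‖ ≤ η / 2
  · rw [hnear x h2, one_smul, hρid x (by rw [mem_closedBall, dist_eq_norm]; linarith),
      add_sub_cancel] at hx
    exact hgz x hx
  · have h3 : x - z = -(χ x • (g x - ρ x)) := by rw [← hx]; abel
    rw [h3, norm_neg, norm_smul, Real.norm_of_nonneg (hχ0 x)] at h2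
    nlinarith [hgρ x, hχ1 x, hχ0 x, norm_nonneg (g x - ρ x)]

/-! ### Ambient isotopies of subsets of a compact space -/

/-- An ambient isotopy of the space `X` moves `S` to `S'`. Homeomorphisms are encoded as
continuous bijections, which is equivalent in compact Hausdorff spaces. -/
def AmbientIsotopic {X : Type*} [TopologicalSpace X] (S S' : Set X) : Prop :=
  ∃ F : unitInterval × X → X, Continuous F ∧ (∀ t, Function.Bijective fun x => F (t, x)) ∧
    (∀ x, F (0, x) = x) ∧ (fun x => F (1, x)) '' S = S'

lemma AmbientIsotopic.of_isotopy {X : Type*} [TopologicalSpace X] {F : unitInterval × X → X}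
    (hF : Continuous F) (hb : ∀ t, Function.Bijective fun x => F (t, x)) (h0 : ∀ x, F (0, x) = x)
    {ι : Type*} {f g : ι → X} (h : ∀ i, F (1, f i) = g i) :
    AmbientIsotopic (range f) (range g) :=
  ⟨F, hF, hb, h0, by rw [← range_comp]; exact congrArg range (funext h)⟩

lemma AmbientIsotopic.trans {X : Type*} [TopologicalSpace X] {S₁ S₂ S₃ : Set X}
    (h : AmbientIsotopic S₁ S₂) (h' : AmbientIsotopic S₂ S₃) : AmbientIsotopic S₁ S₃ := by
  obtain ⟨F, hF, hFb, hF0, rfl⟩ := h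
  obtain ⟨G, hG, hGb, hG0, rfl⟩ := h'
  refine ⟨fun p => G (p.1, F p), by fun_prop, fun t => (hGb t).comp (hFb t), fun x => ?_, ?_⟩
  · simp only [hF0, hG0]
  · rw [image_image]

/-- In a compact Hausdorff space an isotopy can be inverted: its track on the product with the unit
interval is a homeomorphism, so that the inverses are jointly continuous. -/
lemma AmbientIsotopic.symm {X : Type*} [TopologicalSpace X] [CompactSpace X] [T2Space X]
    {S S' : Set X} (h : AmbientIsotopic S S') : AmbientIsotopic S' S := by
  obtain ⟨F, hF, hFb, hF0, rfl⟩ := h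
  let e : unitInterval × X → unitInterval × X := fun p => (p.1, F p)
  have he : Function.Bijective e := by
    refine ⟨?_, ?_⟩
    · rintro ⟨t, x⟩ ⟨t', x'⟩ h
      obtain rfl : t = t' := congrArg Prod.fst h
      exact Prod.ext rfl ((hFb t).1 (congrArg Prod.snd h))
    · rintro ⟨t, y⟩
      obtain ⟨x, hx⟩ := (hFb t).2 y
      exact ⟨(t, x), Prod.ext rfl hx⟩
  have hc : Continuous (Equiv.ofBijective e he) := by
    change Continuous e
    fun_prop
  let E : unitInterval × X ≃ₜ unitInterval × X := hc.homeoOfEquivCompactToT2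
  have hE : ∀ p, E p = (p.1, F p) := fun p => rfl
  have hE1 : ∀ p, (E.symm p).1 = p.1 := fun p => by
    conv_rhs => rw [← E.apply_symm_apply p, hE]
  have hE2 : ∀ t x, E.symm (t, F (t, x)) = (t, x) := fun t x => E.symm_apply_apply (t, x)
  refine ⟨fun p => (E.symm p).2, by fun_prop, fun t => ⟨fun x y h => ?_, fun x => ?_⟩, fun x => ?_,
    ?_⟩
  · have h1 : E.symm (t, x) = E.symm (t, y) :=
      Prod.ext ((hE1 (t, x)).trans (hE1 (t, y)).symm) h
    exact congrArg Prod.snd (E.symm.injective h1)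
  · exact ⟨F (t, x), by simp only [hE2]⟩
  · have := hE2 0 x
    rw [hF0] at this
    simp only [this]
  · rw [image_image]
    simp only [hE2, image_id']

lemma AmbientIsotopic.image {X Y : Type*} [TopologicalSpace X] [TopologicalSpace Y] (e : X ≃ₜ Y)
    {S S' : Set X} (h : AmbientIsotopic S S') : AmbientIsotopic (e '' S) (e '' S') := by
  obtain ⟨F, hF, hFb, hF0, rfl⟩ := h
  refine ⟨fun p => e (F (p.1, e.symm p.2)), by fun_prop,
    fun t => e.bijective.comp ((hFb t).comp e.symm.bijective), fun y => ?_, ?_⟩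
  · simp only [hF0, e.apply_symm_apply]
  · simp only [image_image, e.symm_apply_apply]

lemma AmbientIsotopic.equivalent {r R : ℝ} {N N' : UnitAddCircle → solidTorus r R}
    (h : AmbientIsotopic (range N) (range N')) :
    Equivalent r R (fun s => N s) (fun s => N' s) := by
  have : CompactSpace (solidTorus r R) := isCompact_iff_compactSpace.1 <| by
    refine IsCompact.prod ?_ isCompact_Icc
    refine (isCompact_closedBall (0 : ℂ) R).of_isClosed_subset ?_ fun z hz => by simpa using hz.2
    exact (isClosed_le continuous_const continuous_norm).inter
      (isClosed_le continuous_norm continuous_const)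
  obtain ⟨F, hF, hFb, hF0, hF1⟩ := h
  have hc : ∀ t, Continuous (Equiv.ofBijective _ (hFb t)) := fun t => by
    change Continuous fun x => F (t, x)
    fun_prop
  refine ⟨fun t => (hc t).homeoOfEquivCompactToT2, hF, Homeomorph.ext hF0, ?_⟩
  have h1 : {x : solidTorus r R | (x : ℂ × ℝ) ∈ range fun s => (N s : ℂ × ℝ)} = range N := by
    ext x
    exact ⟨fun ⟨s, hs⟩ => ⟨s, Subtype.ext hs⟩, fun ⟨s, hs⟩ => ⟨s, congrArg _ hs⟩⟩
  have h2 := congrArg (Set.image fun x : solidTorus r R => (x : ℂ × ℝ)) hF1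
  rw [image_image] at h2
  rw [h1]
  exact h2.trans (range_comp _ _).symm

/-! ### Dividing the angle of a curve with trivial winding -/

/-- A tent function on the circle that is the coordinate near `0`. -/
lemma quarter_sub_norm_eq {β : ℝ} (hβ : |β| ≤ 1 / 4) :
    1 / 4 - ‖(β : UnitAddCircle) - ((1 / 4 : ℝ) : UnitAddCircle)‖ = β := by
  rw [abs_le] at hβ
  have h1 : |β - 1 / 4| = 1 / 4 - β := by rw [abs_of_nonpos (by linarith)]; ring
  rw [← AddCircle.coe_sub, (AddCircle.norm_coe_eq_abs_iff 1 one_ne_zero).2 (by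
    rw [h1, abs_one]; linarith), h1]
  ring

/-- Adding a contraction to the identity of a circle gives a bijection. -/
lemma bijective_sub_smul {f : UnitAddCircle → ℝ} {c : ℝ} (hc : 0 ≤ c) (hc1 : c < 1)
    (hf : ∀ x y, |f x - f y| ≤ ‖x - y‖) (b : ℝ) :
    Function.Bijective fun x : UnitAddCircle => x - ((c * f x - b : ℝ) : UnitAddCircle) := by
  have hd : ∀ x y, ‖((c * f x - b : ℝ) : UnitAddCircle) - ((c * f y - b : ℝ) : UnitAddCircle)‖ ≤
      c * ‖x - y‖ := by
    intro x y
    rw [← AddCircle.coe_sub]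
    refine QuotientAddGroup.norm_mk_le_norm.trans ?_
    rw [Real.norm_eq_abs, show c * f x - b - (c * f y - b) = c * (f x - f y) by ring, abs_mul,
      abs_of_nonneg hc]
    exact mul_le_mul_of_nonneg_left (hf x y) hc
  refine ⟨fun x y hxy => ?_, fun y => ?_⟩
  · have h1 : x - y =
        ((c * f x - b : ℝ) : UnitAddCircle) - ((c * f y - b : ℝ) : UnitAddCircle) := by
      have h2 := sub_eq_zero.2 hxy
      simp only at h2
      rw [← sub_eq_zero, ← h2]; abel
    have h2 := hd x y
    rw [← h1] at h2
    have h3 : ‖x - y‖ = 0 := by nlinarith [norm_nonneg (x - y)]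
    exact sub_eq_zero.1 (norm_eq_zero.1 h3)
  · have hcon : ContractingWith ⟨c, hc⟩ fun x : UnitAddCircle =>
        y + ((c * f x - b : ℝ) : UnitAddCircle) := by
      refine ⟨by exact_mod_cast hc1, LipschitzWith.of_dist_le_mul fun x x' => ?_⟩
      rw [dist_add_left, dist_eq_norm, dist_eq_norm]
      exact hd x x'
    refine ⟨hcon.fixedPoint, ?_⟩
    have h1 := hcon.fixedPoint_isFixedPt
    have h2 : y + _ = hcon.fixedPoint := h1
    exact sub_eq_of_eq_add h2.symm

/-- Curves in a sector of the circle are contracted by a real factor by an ambient isotopy. -/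
lemma ambientIsotopic_div_of_sector {Q : Type*} [TopologicalSpace Q] {ι : Type*}
    {η : ι → ℝ} {q : ι → Q} {a : ℝ} (hη : ∀ i, |η i - a| ≤ 1 / 4) {k : ℝ} (hk : 1 ≤ k) :
    AmbientIsotopic (range fun i => ((η i : UnitAddCircle), q i))
      (range fun i => (((η i / k : ℝ) : UnitAddCircle), q i)) := by
  have hk0 : 0 < k := by linarith
  have hk1 : 0 ≤ 1 - 1 / k := by rw [sub_nonneg, div_le_one hk0]; exact hk
  have hk2 : 1 - 1 / k < 1 := by linarith [one_div_pos.2 hk0]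
  let f : UnitAddCircle → ℝ := fun x =>
    1 / 4 - ‖x - (a : UnitAddCircle) - ((1 / 4 : ℝ) : UnitAddCircle)‖
  have hf : ∀ x y, |f x - f y| ≤ ‖x - y‖ := by
    intro x y
    have h1 : f x - f y = ‖y - (a : UnitAddCircle) - ((1 / 4 : ℝ) : UnitAddCircle)‖ -
      ‖x - (a : UnitAddCircle) - ((1 / 4 : ℝ) : UnitAddCircle)‖ := by simp only [f]; ring
    rw [h1, ← norm_neg (x - y)]
    refine (abs_norm_sub_norm_le _ _).trans (le_of_eq ?_)
    congr 1
    abel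
  refine AmbientIsotopic.of_isotopy (F := fun p =>
    (p.2.1 - ((p.1 * (1 - 1 / k) * f p.2.1 - p.1 * (a / k - a) : ℝ) : UnitAddCircle), p.2.2))
    ?_ (fun t => ?_) (fun x => by simp) fun i => ?_
  · refine Continuous.prodMk ?_ (by fun_prop)
    refine Continuous.sub (by fun_prop) ((AddCircle.continuous_mk' 1).comp ?_)
    simp only [f]
    fun_prop
  · have hb := bijective_sub_smul (c := t * (1 - 1 / k)) (mul_nonneg t.2.1 hk1)
      ((mul_le_of_le_one_left hk1 t.2.2).trans_lt hk2) hf (t * (a / k - a))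
    exact (hb.prodMap Function.bijective_id :)
  · refine Prod.ext ?_ rfl
    have h1 : f (η i : UnitAddCircle) = η i - a := by
      simp only [f]
      rw [← AddCircle.coe_sub]
      exact quarter_sub_norm_eq (hη i)
    simp only [h1, Set.Icc.coe_one]
    rw [← AddCircle.coe_sub]
    congr 1
    field_simp
    ring

/-- If an isotopy moves a curve with trivial winding around the circle factor into a sector, then
the curve is isotopic to its image under the division of the angles by `k`: the isotopy lifts to the
`k`-fold covering, where it moves the divided curve to a divided curve in a sector. -/
theorem ambientIsotopic_div {Q : Type*} [TopologicalSpace Q] [CompactSpace Q] [T2Space Q]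
    {ι : Type*} [TopologicalSpace ι] [PreconnectedSpace ι] [Nonempty ι]
    {θ : ι → ℝ} (hθ : Continuous θ) {q : ι → Q} (hq : Continuous q)
    {Φ : unitInterval × (UnitAddCircle × Q) → UnitAddCircle × Q} (hΦ : Continuous Φ)
    (hΦb : ∀ t, Function.Bijective fun x => Φ (t, x)) (hΦ0 : ∀ x, Φ (0, x) = x)
    {α : UnitAddCircle} (hα : ∀ i, ‖(Φ (1, ((θ i : UnitAddCircle), q i))).1 - α‖ < 1 / 4)
    {k : ℕ} (hk : 1 ≤ k) :
    AmbientIsotopic (range fun i => ((θ i : UnitAddCircle), q i))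
      (range fun i => (((θ i / k : ℝ) : UnitAddCircle), q i)) := by
  have hk0 : (k : ℝ) ≠ 0 := by positivity
  -- the lift of the displacement of the angle
  obtain ⟨Δ, hΔ, hΔ1, hΔ0⟩ : ∃ Δ : unitInterval × (UnitAddCircle × Q) → ℝ, Continuous Δ ∧
      (∀ p, (Δ p : UnitAddCircle) = (Φ p).1 - p.2.1) ∧ ∀ x, Δ (0, x) = 0 := by
    let H : C(unitInterval × (UnitAddCircle × Q), UnitAddCircle) :=
      ⟨fun p => (Φ p).1 - p.2.1, by fun_prop⟩
    have H0 : ∀ x, H (0, x) = ((0 : C(UnitAddCircle × Q, ℝ)) x : UnitAddCircle) := fun x => by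
      change (Φ (0, x)).1 - x.1 = ((0 : ℝ) : UnitAddCircle)
      rw [hΦ0, sub_self]; rfl
    have hcov : IsCoveringMap ((↑) : ℝ → UnitAddCircle) := AddCircle.isCoveringMap_coe 1
    exact ⟨hcov.liftHomotopy H 0 H0, map_continuous _,
      fun p => congrFun (hcov.liftHomotopy_lifts H 0 H0) p,
      fun x => hcov.liftHomotopy_zero H 0 H0 x⟩
  let P : UnitAddCircle × Q → UnitAddCircle × Q := fun v => (k • v.1, v.2)
  have hP : Continuous P := by
    have : Continuous fun x : UnitAddCircle => k • x := continuous_nsmul k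
    fun_prop
  have hkdiv : ∀ x : ℝ, k • ((x / k : ℝ) : UnitAddCircle) = x := fun x => by
    rw [← AddCircle.coe_nsmul, nsmul_eq_mul, mul_div_cancel₀ _ hk0]
  let Ψ : unitInterval × (UnitAddCircle × Q) → UnitAddCircle × Q := fun p =>
    (p.2.1 + ((Δ (p.1, P p.2) / k : ℝ) : UnitAddCircle), (Φ (p.1, P p.2)).2)
  have hΨ : Continuous Ψ := by
    have h1 : Continuous fun p : unitInterval × (UnitAddCircle × Q) => (p.1, P p.2) := by fun_prop
    refine Continuous.prodMk
      (Continuous.add (by fun_prop) ((AddCircle.continuous_mk' 1).comp ?_)) ?_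
    · fun_prop
    · exact continuous_snd.comp (hΦ.comp h1)
  have hPΨ : ∀ t v, P (Ψ (t, v)) = Φ (t, P v) := by
    intro t v
    refine Prod.ext ?_ rfl
    change k • (v.1 + ((Δ (t, P v) / k : ℝ) : UnitAddCircle)) = _
    rw [nsmul_add, hkdiv, hΔ1]
    change k • v.1 + (_ - k • v.1) = _
    abel
  have hΨb : ∀ t, Function.Bijective fun v => Ψ (t, v) := by
    refine fun t => ⟨fun v w hvw => ?_, fun w => ?_⟩
    · have h1 : P v = P w := (hΦb t).1 (by
        simp only [← hPΨ]; exact congrArg P hvw)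
      have h2 := congrArg Prod.fst hvw
      simp only [Ψ, h1] at h2
      exact Prod.ext (add_right_cancel h2) (congrArg Prod.snd h1 :)
    · obtain ⟨x, hx⟩ := (hΦb t).2 (P w)
      simp only at hx
      refine ⟨(w.1 - ((Δ (t, x) / k : ℝ) : UnitAddCircle), x.2), ?_⟩
      have h1 : P (w.1 - ((Δ (t, x) / k : ℝ) : UnitAddCircle), x.2) = x := by
        refine Prod.ext ?_ rfl
        change k • (w.1 - ((Δ (t, x) / k : ℝ) : UnitAddCircle)) = x.1
        rw [nsmul_sub, hkdiv, hΔ1, hx]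
        change k • w.1 - (k • w.1 - x.1) = x.1
        abel
      refine Prod.ext ?_ ?_
      · simp only [Ψ, h1]
        abel
      · simp only [Ψ, h1, hx]
        rfl
  let v : ι → UnitAddCircle × Q := fun i => ((θ i : UnitAddCircle), q i)
  have hv : Continuous v := ((AddCircle.continuous_mk' 1).comp hθ).prodMk hq
  have hPv : ∀ i, P (((θ i / k : ℝ) : UnitAddCircle), q i) = v i := fun i =>
    Prod.ext (hkdiv _) rfl
  let η : ι → ℝ := fun i => θ i + Δ (1, v i)
  have hη : Continuous η := by fun_prop
  have hηΦ : ∀ i, (Φ (1, v i)).1 = (η i : UnitAddCircle) := fun i => by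
    rw [AddCircle.coe_add, hΔ1]
    change _ = (θ i : UnitAddCircle) + (_ - (θ i : UnitAddCircle))
    abel
  obtain ⟨a, rfl⟩ := QuotientAddGroup.mk_surjective α
  have hα' : ∀ i, |η i - a - round (η i - a)| < 1 / 4 := fun i => by
    have h1 := hα i
    rw [hηΦ i] at h1
    rw [← UnitAddCircle.norm_eq, AddCircle.coe_sub]
    exact h1
  -- the sector is reached in the same turn along the whole curve
  obtain ⟨m, hm⟩ : ∃ m : ℤ, ∀ i, round (η i - a) = m := by
    have hloc : IsLocallyConstant fun i => round (η i - a) := by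
      refine (IsLocallyConstant.iff_eventually_eq _).2 fun i => ?_
      have h1 : Tendsto (fun j => |η j - a - round (η i - a)|) (𝓝 i)
        (𝓝 |η i - a - round (η i - a)|) := Continuous.tendsto (by fun_prop) i
      filter_upwards [h1.eventually (gt_mem_nhds (hα' i))] with j hj
      have h2 := hα' j
      rw [abs_lt] at hj h2
      have h3 : ((round (η j - a) : ℝ) - round (η i - a)) < 1 := by linarith
      have h4 : (-1 : ℝ) < ((round (η j - a) : ℝ) - round (η i - a)) := by linarith
      have h5 : round (η j - a) - round (η i - a) < 1 := by exact_mod_cast h3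
      have h6 : -1 < round (η j - a) - round (η i - a) := by exact_mod_cast h4
      lia
    let i₀ : ι := Classical.arbitrary ι
    exact ⟨_, fun i => hloc.apply_eq_of_preconnectedSpace i i₀⟩
  have hsec := ambientIsotopic_div_of_sector (η := η) (q := fun i => (Φ (1, v i)).2) (a := a + m)
    (fun i => by
      have := (hα' i).le
      rwa [hm i, sub_sub] at this) (show (1 : ℝ) ≤ k by exact_mod_cast hk)
  have h1 : AmbientIsotopic (range v) (range fun i => ((η i : UnitAddCircle), (Φ (1, v i)).2)) :=
    AmbientIsotopic.of_isotopy hΦ hΦb hΦ0 fun i => Prod.ext (hηΦ i) rfl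
  have h2 : AmbientIsotopic (range fun i => (((θ i / k : ℝ) : UnitAddCircle), q i))
      (range fun i => (((η i / k : ℝ) : UnitAddCircle), (Φ (1, v i)).2)) := by
    refine AmbientIsotopic.of_isotopy hΨ hΨb (fun w => ?_) fun i => ?_
    · refine Prod.ext ?_ ?_
      · simp [Ψ, hΔ0]
      · simp [Ψ, hΦ0, P]
    · refine Prod.ext ?_ ?_
      · simp only [Ψ, hPv]
        rw [← AddCircle.coe_add, ← add_div]
      · simp only [Ψ, hPv]
  exact (h1.trans hsec).trans h2.symm

/-! ### Squeezing the complement of a meridional disk -/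

/-- The hyperbolic transformation of the circle with the repelling fixed point `1` and the
attracting fixed point `-1` (for `s < 1`). -/
noncomputable def circleMobius (s : ℝ) (u : ℂ) : ℂ :=
  ((1 + s) * u - (1 - s)) / ((1 + s) - (1 - s) * u)

lemma circleMobius_denom_ne_zero {s : ℝ} (hs : 0 < s) {u : ℂ} (hu : ‖u‖ = 1) :
    ((1 + s) - (1 - s) * u : ℂ) ≠ 0 := by
  intro h
  have h1 := congrArg norm (sub_eq_zero.1 h)
  rw [norm_mul, hu, mul_one, ← Complex.ofReal_one, ← Complex.ofReal_add, ← Complex.ofReal_sub,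
    Complex.norm_real, Complex.norm_real, Real.norm_eq_abs, Real.norm_eq_abs,
    abs_eq_abs] at h1
  rcases h1 with h1 | h1 <;> linarith

lemma norm_circleMobius {s : ℝ} (hs : 0 < s) {u : ℂ} (hu : ‖u‖ = 1) : ‖circleMobius s u‖ = 1 := by
  have h0 := circleMobius_denom_ne_zero hs hu
  rw [circleMobius, norm_div, div_eq_one_iff_eq (norm_ne_zero_iff.2 h0)]
  have h2 : u.re ^ 2 + u.im ^ 2 = 1 := by
    have h3 := Complex.sq_norm u
    rw [hu, Complex.normSq_apply] at h3
    linarith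
  rw [← sq_eq_sq₀ (norm_nonneg _) (norm_nonneg _), Complex.sq_norm, Complex.sq_norm,
    Complex.normSq_apply, Complex.normSq_apply]
  simp
  linear_combination (4 * s) * h2

lemma circleMobius_inv {s : ℝ} (hs : 0 < s) {u : ℂ} (hu : ‖u‖ = 1) :
    circleMobius s (circleMobius s⁻¹ u) = u := by
  have h0 := circleMobius_denom_ne_zero hs (norm_circleMobius (inv_pos.2 hs) hu)
  have h1 := circleMobius_denom_ne_zero (inv_pos.2 hs) hu
  have hs' : (s : ℂ) ≠ 0 := by exact_mod_cast hs.ne'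
  have hD : ((s + 1) - (s - 1) * u : ℂ) = s * ((1 + (s⁻¹ : ℝ)) - (1 - (s⁻¹ : ℝ)) * u) := by
    push_cast
    field_simp
  have hD0 : ((s + 1) - (s - 1) * u : ℂ) ≠ 0 := hD ▸ mul_ne_zero hs' h1
  have h2 : circleMobius s⁻¹ u = ((s + 1) * u - (s - 1)) / ((s + 1) - (s - 1) * u) := by
    rw [circleMobius, div_eq_div_iff h1 hD0]
    push_cast
    field_simp
  have h3 : circleMobius s⁻¹ u * ((s + 1) - (s - 1) * u) = (s + 1) * u - (s - 1) := by
    rw [h2, div_mul_cancel₀ _ hD0]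
  rw [circleMobius, div_eq_iff h0]
  refine mul_right_cancel₀ hD0 ?_
  linear_combination ((1 + s) + u * (1 - s) : ℂ) * h3

/-- The radial homeomorphism of the unit disk that multiplies the ratio `‖d‖ / (1 - ‖d‖)` by
`s`. -/
noncomputable def radialScaling (s : ℝ) (d : ℂ) : ℂ := (s / (s * ‖d‖ + (1 - ‖d‖))) • d

lemma radialScaling_denom_pos {s : ℝ} (hs : 0 < s) {d : ℂ} (hd : ‖d‖ ≤ 1) :
    0 < s * ‖d‖ + (1 - ‖d‖) := by
  rcases (norm_nonneg d).eq_or_lt with h | h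
  · rw [← h]; norm_num
  · nlinarith

lemma norm_radialScaling {s : ℝ} (hs : 0 < s) {d : ℂ} (hd : ‖d‖ ≤ 1) :
    ‖radialScaling s d‖ = s * ‖d‖ / (s * ‖d‖ + (1 - ‖d‖)) := by
  rw [radialScaling, norm_smul, Real.norm_of_nonneg
    (div_nonneg hs.le (radialScaling_denom_pos hs hd).le), div_mul_eq_mul_div]

lemma norm_radialScaling_le {s : ℝ} (hs : 0 < s) {d : ℂ} (hd : ‖d‖ ≤ 1) :
    ‖radialScaling s d‖ ≤ 1 := by
  rw [norm_radialScaling hs hd, div_le_one (radialScaling_denom_pos hs hd)]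
  linarith

lemma radialScaling_inv {s : ℝ} (hs : 0 < s) {d : ℂ} (hd : ‖d‖ ≤ 1) :
    radialScaling s (radialScaling s⁻¹ d) = d := by
  have hs' := inv_pos.2 hs
  have h1 := radialScaling_denom_pos hs' hd
  have h2 := norm_radialScaling hs' hd
  have h3 := radialScaling_denom_pos hs (norm_radialScaling_le hs' hd)
  rw [radialScaling, radialScaling, smul_smul]
  rw [radialScaling] at h2 h3
  rw [h2] at h3 ⊢
  conv_rhs => rw [← one_smul ℝ d]
  congr 1
  have hD : s⁻¹ * ‖d‖ + (1 - ‖d‖) = (‖d‖ + s * (1 - ‖d‖)) / s := by field_simp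
  have hD0 : 0 < ‖d‖ + s * (1 - ‖d‖) := by
    rw [hD] at h1
    exact (div_pos_iff_of_pos_right hs).1 h1
  rw [hD]
  generalize hDD : ‖d‖ + s * (1 - ‖d‖) = D at hD0
  have h4 : s * (s⁻¹ * ‖d‖ / (D / s)) + (1 - s⁻¹ * ‖d‖ / (D / s)) = s / D := by
    field_simp
    linarith
  rw [h4]
  field_simp

/-- A compact subset of the open solid torus that misses a meridional disk is moved by isotopies
into arbitrarily small neighbourhoods of a point. -/
theorem exists_isotopy_squeezing {K : Set (Circle × closedBall (0 : ℂ) 1)} (hK : IsCompact K)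
    (hK1 : ∀ x ∈ K, x.1 ≠ 1) (hKd : ∀ x ∈ K, ‖(x.2 : ℂ)‖ < 1)
    {W : Set (Circle × closedBall (0 : ℂ) 1)} (hW : IsOpen W)
    (hxW : (Circle.exp Real.pi, ⟨0, mem_closedBall_self zero_le_one⟩) ∈ W) :
    ∃ Φ : unitInterval × (Circle × closedBall (0 : ℂ) 1) → Circle × closedBall (0 : ℂ) 1,
      Continuous Φ ∧ (∀ t, Function.Bijective fun x => Φ (t, x)) ∧ (∀ x, Φ (0, x) = x) ∧
      ∀ x ∈ K, Φ (1, x) ∈ W := by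
  have hball : ∀ d : closedBall (0 : ℂ) 1, ‖(d : ℂ)‖ ≤ 1 := fun d => mem_closedBall_zero_iff.1 d.2
  obtain ⟨W', hW', rfl⟩ : ∃ W' : Set (ℂ × ℂ), IsOpen W' ∧
      (fun x : Circle × closedBall (0 : ℂ) 1 => ((x.1 : ℂ), (x.2 : ℂ))) ⁻¹' W' = W := by
    have : IsInducing fun x : Circle × closedBall (0 : ℂ) 1 => ((x.1 : ℂ), (x.2 : ℂ)) :=
      IsInducing.prodMap (f := ((↑) : Circle → ℂ)) IsInducing.subtypeVal IsInducing.subtypeVal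
    exact this.isOpen_iff.1 hW
  have hxW' : ((-1 : ℂ), (0 : ℂ)) ∈ W' := by
    have : ((Circle.exp Real.pi : ℂ), (0 : ℂ)) ∈ W' := hxW
    rwa [Circle.coe_exp, Complex.exp_pi_mul_I] at this
  -- in the limit `s = 0` all points of `K` are moved to the same point
  let G : ℝ × (Circle × closedBall (0 : ℂ) 1) → ℂ × ℂ := fun p =>
    (circleMobius p.1 p.2.1, radialScaling p.1 p.2.2)
  have hG : ∀ (s : ℝ) (x : Circle × closedBall (0 : ℂ) 1),
      (((1 + s) - (1 - s) * x.1 : ℂ) ≠ 0) → (s * ‖(x.2 : ℂ)‖ + (1 - ‖(x.2 : ℂ)‖) ≠ 0) →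
      ContinuousAt G (s, x) := by
    intro s x h1 h2
    refine ContinuousAt.prodMk ?_ ?_
    · refine ContinuousAt.div (by fun_prop) (by fun_prop) h1
    · have h3 : ContinuousAt (fun p : ℝ × (Circle × closedBall (0 : ℂ) 1) =>
          p.1 / (p.1 * ‖(p.2.2 : ℂ)‖ + (1 - ‖(p.2.2 : ℂ)‖))) (s, x) :=
        ContinuousAt.div (by fun_prop) (by fun_prop) h2
      exact h3.smul (by fun_prop)
  obtain ⟨s₁, hs₁, hs₁1, hs₁W⟩ : ∃ s₁ : ℝ, 0 < s₁ ∧ s₁ ≤ 1 ∧ ∀ x ∈ K, G (s₁, x) ∈ W' := by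
    have h1 : ∀ᶠ s in 𝓝 (0 : ℝ), ∀ x ∈ K, G (s, x) ∈ W' := by
      refine hK.eventually_forall_of_forall_eventually fun x hx => ?_
      have hu : (1 - x.1 : ℂ) ≠ 0 :=
        sub_ne_zero.2 fun h => hK1 x hx (Circle.ext (by simpa using h.symm))
      have h0 : G (0, x) = (-1, 0) := by
        refine Prod.ext ?_ ?_
        · simp only [G, circleMobius, Complex.ofReal_zero, add_zero, sub_zero, one_mul]
          rw [div_eq_iff hu]; ring
        · simp [G, radialScaling]
      refine (hG 0 x (by simpa using hu) ?_).eventually (hW'.mem_nhds (h0 ▸ hxW'))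
      have := hKd x hx
      rw [zero_mul, zero_add]
      linarith
    have h2 : ∀ᶠ s in 𝓝[>] (0 : ℝ), s ∈ Ioo (0 : ℝ) 1 := Ioo_mem_nhdsGT one_pos
    obtain ⟨s, hs, hs'⟩ := ((h1.filter_mono nhdsWithin_le_nhds).and h2).exists
    exact ⟨s, hs'.1, hs'.2.le, hs⟩
  let σ : unitInterval → ℝ := fun t => 1 - t * (1 - s₁)
  have hσ : ∀ t, 0 < σ t := fun t => by
    have := mul_le_of_le_one_left (sub_nonneg.2 hs₁1) t.2.2
    simp only [σ]; linarith
  let T : ∀ s : ℝ, 0 < s → Circle × closedBall (0 : ℂ) 1 → Circle × closedBall (0 : ℂ) 1 :=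
    fun s hs x =>
      (⟨circleMobius s x.1, mem_sphere_zero_iff_norm.2 (norm_circleMobius hs x.1.norm_coe)⟩,
      ⟨radialScaling s x.2, mem_closedBall_zero_iff.2 (norm_radialScaling_le hs (hball _))⟩)
  have hT : ∀ s hs x, T s hs (T s⁻¹ (inv_pos.2 hs) x) = x := fun s hs x =>
    Prod.ext (Circle.ext (circleMobius_inv hs x.1.norm_coe))
      (Subtype.ext (radialScaling_inv hs (hball _)))
  have hT' : ∀ s hs x, T s⁻¹ (inv_pos.2 hs) (T s hs x) = x := fun s hs x => by
    have := hT s⁻¹ (inv_pos.2 hs) x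
    simpa only [inv_inv] using this
  have hGc : Continuous fun p : unitInterval × (Circle × closedBall (0 : ℂ) 1) =>
      G (σ p.1, p.2) := by
    refine continuous_iff_continuousAt.2 fun p => ?_
    have h1 : ContinuousAt
        (fun p : unitInterval × (Circle × closedBall (0 : ℂ) 1) => (σ p.1, p.2)) p := by
      simp only [σ]
      fun_prop
    exact ContinuousAt.comp
      (f := fun p : unitInterval × (Circle × closedBall (0 : ℂ) 1) => (σ p.1, p.2))
      (hG _ _ (circleMobius_denom_ne_zero (hσ _) p.2.1.norm_coe)
        (radialScaling_denom_pos (hσ _) (hball _)).ne') h1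
  refine ⟨fun p => T (σ p.1) (hσ _) p.2, ?_, fun t => ?_, fun x => ?_, fun x hx => ?_⟩
  · exact Continuous.prodMk (Continuous.subtype_mk (continuous_fst.comp hGc) _)
      (Continuous.subtype_mk (continuous_snd.comp hGc) _)
  · exact Function.bijective_iff_has_inverse.2 ⟨T (σ t)⁻¹ (inv_pos.2 (hσ t)),
      fun x => hT' (σ t) (hσ t) x, fun x => hT (σ t) (hσ t) x⟩
  · refine Prod.ext (Circle.ext ?_) (Subtype.ext ?_)
    · change circleMobius (σ 0) x.1 = x.1
      simp [σ, circleMobius]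
    · change radialScaling (σ 0) x.2 = x.2
      simp [σ, radialScaling]
  · have h1 : σ 1 = s₁ := by simp [σ]
    have h2 := hs₁W x hx
    rw [← h1] at h2
    exact h2

/-! ### Knots that miss a meridional disk -/

/-- Cylindrical coordinates on the solid torus. -/
noncomputable def cylindricalHomeomorph {r R : ℝ} (hr : 0 < r) :
    solidTorus r R ≃ₜ Circle × (Icc r R × Icc (0 : ℝ) 1) :=
  (Homeomorph.Set.prod (annulus r R) (Icc (0 : ℝ) 1)).trans
    (((polarHomeomorph hr).prodCongr (Homeomorph.refl _)).trans (Homeomorph.prodAssoc _ _ _))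

/-- A knot that misses a meridional disk has a continuous angle, and it is equivalent to the knots
that arise from dividing this angle by positive integers. -/
theorem exists_angle_equivalent {r R : ℝ} (hr : 0 < r) {N : UnitAddCircle → ℂ × ℝ}
    (hNc : Continuous N) (hN : ∀ s, N s ∈ interior (solidTorus r R))
    (h : (Circle × closedBall (0 : ℂ) 1) ≃ₜ solidTorus r R)
    (hmiss : ∀ s, (h.symm ⟨N s, interior_subset (hN s)⟩).1 ≠ 1) :
    ∃ θ : UnitAddCircle → ℝ, Continuous θ ∧
      (∀ s, (‖(N s).1‖ : ℂ) * Circle.exp (2 * Real.pi * θ s) = (N s).1) ∧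
      ∀ k : ℕ, 1 ≤ k → Equivalent r R N
        fun s => ((‖(N s).1‖ : ℂ) * Circle.exp (2 * Real.pi * (θ s / k)), (N s).2) := by
  let V := solidTorus r R
  let N₀ : UnitAddCircle → V := fun s => ⟨N s, interior_subset (hN s)⟩
  have hN₀ : Continuous N₀ := hNc.subtype_mk _
  let y : UnitAddCircle → Circle × closedBall (0 : ℂ) 1 := fun s => h.symm (N₀ s)
  have hy : Continuous y := by fun_prop
  have hyd : ∀ s, ‖((y s).2 : ℂ)‖ < 1 := fun s => norm_lt_one_of_mem_interior h (by
    simp only [y, h.apply_symm_apply]; exact hN s)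
  let e := cylindricalHomeomorph (R := R) hr
  -- the angle lifts over the universal covering of the complement of the disk
  obtain ⟨ρ, hρ, hρmem, hρid⟩ := exists_retraction_closedBall (0 : ℂ) one_pos
  obtain ⟨F, hF, hFe⟩ := exists_circle_lift (A := ℝ × ℂ)
    (f := fun p => (e (h (Circle.exp (2 * Real.pi * p.1), ⟨ρ p.2, hρmem p.2⟩))).1) (by fun_prop)
  let x : UnitAddCircle → ℝ := fun s => 1 / 2 + Complex.arg (-(y s).1) / (2 * Real.pi)
  have hx : Continuous x := by
    refine continuous_iff_continuousAt.2 fun s => ?_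
    have h1 : (-(y s).1 : ℂ) ∈ Complex.slitPlane := by
      rw [Complex.mem_slitPlane_iff_arg]
      refine ⟨fun h2 => hmiss s (Circle.ext ?_), neg_ne_zero.2 (Circle.coe_ne_zero _)⟩
      have h3 := Complex.norm_mul_exp_arg_mul_I (-(y s).1 : ℂ)
      rw [h2, Complex.exp_pi_mul_I, norm_neg, Circle.norm_coe] at h3
      have h4 : ((y s).1 : ℂ) = 1 := by
        rw [← neg_inj, ← h3]; simp
      exact h4
    have h2 : ContinuousAt (fun s => (-(y s).1 : ℂ)) s := by fun_prop
    have h3 : ContinuousAt (fun s => Complex.arg (-(y s).1)) s :=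
      ContinuousAt.comp (f := fun s => (-(y s).1 : ℂ)) (Complex.continuousAt_arg h1) h2
    exact continuousAt_const.add (h3.div_const _)
  have hxy : ∀ s, Circle.exp (2 * Real.pi * x s) = (y s).1 := by
    intro s
    refine Circle.ext ?_
    have h3 := Complex.norm_mul_exp_arg_mul_I (-(y s).1 : ℂ)
    rw [norm_neg, Circle.norm_coe, Complex.ofReal_one, one_mul] at h3
    have h4 : 2 * Real.pi * x s = Real.pi + Complex.arg (-(y s).1) := by
      have := Real.pi_pos
      simp only [x]
      field_simp
    rw [h4, Circle.coe_exp, Complex.ofReal_add, add_mul, Complex.exp_add, Complex.exp_pi_mul_I, h3]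
    ring
  let θ : UnitAddCircle → ℝ := fun s => F (x s, (y s).2)
  have hθ : Continuous θ := by fun_prop
  have hθN : ∀ s, Circle.exp (2 * Real.pi * θ s) = (e (N₀ s)).1 := by
    intro s
    simp only [θ]
    rw [hFe]
    simp only [hxy]
    have : (⟨ρ (y s).2, hρmem (y s).2⟩ : closedBall (0 : ℂ) 1) = (y s).2 :=
      Subtype.ext (hρid _ (y s).2.2)
    rw [this]
    simp only [Prod.mk.eta, y, h.apply_symm_apply]
  let c : UnitAddCircle ≃ₜ Circle := AddCircle.homeomorphCircle one_ne_zero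
  have hc : ∀ a : ℝ, c (a : UnitAddCircle) = Circle.exp (2 * Real.pi * a) := fun a => by
    simp [c, AddCircle.homeomorphCircle_apply, AddCircle.toCircle_apply_mk]
  let E : V ≃ₜ UnitAddCircle × (Icc r R × Icc (0 : ℝ) 1) :=
    e.trans (c.symm.prodCongr (Homeomorph.refl _))
  have hEs : ∀ (a : ℝ) q, (E.symm ((a : UnitAddCircle), q) : ℂ × ℝ) =
      (((q.1 : ℝ) : ℂ) * Circle.exp (2 * Real.pi * a), (q.2 : ℝ)) := fun a q => by
    rw [← hc]; rfl
  let q : UnitAddCircle → Icc r R × Icc (0 : ℝ) 1 := fun s => (e (N₀ s)).2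
  have hEN : ∀ s, E (N₀ s) = ((θ s : UnitAddCircle), q s) := fun s => by
    refine Prod.ext ?_ rfl
    change c.symm (e (N₀ s)).1 = _
    rw [← hθN, ← hc, c.symm_apply_apply]
  have hq1 : ∀ s, ((q s).1 : ℝ) = ‖(N s).1‖ := fun s => rfl
  have hq2 : ∀ s, ((q s).2 : ℝ) = (N s).2 := fun s => rfl
  have hNE : ∀ s, N₀ s = E.symm ((θ s : UnitAddCircle), q s) := fun s => by
    rw [← hEN, E.symm_apply_apply]
  refine ⟨θ, hθ, fun s => ?_, fun k hk => ?_⟩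
  · have := congrArg (fun v : V => (v : ℂ × ℝ).1) (hNE s)
    simp only [hEs] at this
    exact this.symm
  · let y₀ : Circle × closedBall (0 : ℂ) 1 :=
      (Circle.exp Real.pi, ⟨0, mem_closedBall_self zero_le_one⟩)
    obtain ⟨Φ, hΦ, hΦb, hΦ0, hΦ1⟩ := exists_isotopy_squeezing (K := range y) (isCompact_range hy)
      (by rintro _ ⟨s, rfl⟩; exact hmiss s) (by rintro _ ⟨s, rfl⟩; exact hyd s)
      (W := {v | ‖(E (h v)).1 - (E (h y₀)).1‖ < 1 / 4})
      (isOpen_lt (by fun_prop) continuous_const)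
      (by rw [mem_ofPred_eq, sub_self, norm_zero]; norm_num)
    let hE := h.trans E
    have hmain := ambientIsotopic_div hθ (q := q) (by fun_prop)
      (Φ := fun p => hE (Φ (p.1, hE.symm p.2))) (by fun_prop)
      (fun t => hE.bijective.comp ((hΦb t).comp hE.symm.bijective))
      (fun x => by simp only [hΦ0, hE.apply_symm_apply]) (α := (E (h y₀)).1)
      (fun s => by
        have h1 : hE.symm ((θ s : UnitAddCircle), q s) = y s := by
          rw [← hEN]
          exact congrArg h.symm (E.symm_apply_apply _)
        simp only [h1]
        exact hΦ1 _ ⟨s, rfl⟩) hk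
    have h2 := hmain.image E.symm
    rw [← range_comp, ← range_comp] at h2
    have h3 := h2.equivalent
    simp only [Function.comp_apply, hEs, ← hNE, hq1, hq2] at h3
    exact h3

/-! ### Dividing the angle of a knot -/

/-- The linear map that divides imaginary parts by `k`. In logarithmic coordinates it divides
angles. -/
noncomputable def divIm (k : ℕ) : ℂ →L[ℝ] ℂ :=
  Complex.reCLM.smulRight (1 : ℂ) + Complex.imCLM.smulRight ((k : ℝ)⁻¹ • Complex.I)

lemma divIm_apply (k : ℕ) (z : ℂ) : divIm k z = z.re + z.im * ((k : ℝ)⁻¹ • Complex.I) := by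
  simp [divIm]

lemma divIm_re (k : ℕ) (z : ℂ) : (divIm k z).re = z.re := by
  rw [divIm_apply]; simp

lemma divIm_im (k : ℕ) (z : ℂ) : (divIm k z).im = z.im / k := by
  rw [divIm_apply, Complex.add_im, Complex.ofReal_im, Complex.im_ofReal_mul, Complex.smul_im,
    Complex.I_im, smul_eq_mul, mul_one, zero_add, div_eq_mul_inv]

lemma divIm_injective {k : ℕ} (hk : 1 ≤ k) : Function.Injective (divIm k) := by
  intro z w h
  have hk0 : (k : ℝ) ≠ 0 := by positivity
  refine Complex.ext ?_ ?_
  · rw [← divIm_re k z, h, divIm_re]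
  · have := divIm_im k z
    rw [h, divIm_im] at this
    field_simp at this
    exact this.symm

lemma eventually_eq_add_log {X : Type*} [TopologicalSpace X] {l : X → ℂ} {x₀ : X}
    (hl : ContinuousAt l x₀) :
    ∀ᶠ x in 𝓝 x₀, l x = l x₀ + Complex.log (Complex.exp (l x) / Complex.exp (l x₀)) := by
  have h1 : Tendsto (fun x => |(l x - l x₀).im|) (𝓝 x₀) (𝓝 0) := by
    have : ContinuousAt (fun x => |(l x - l x₀).im|) x₀ := by fun_prop
    simpa [ContinuousAt] using this
  filter_upwards [h1.eventually (gt_mem_nhds Real.pi_pos)] with x hx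
  rw [← Complex.exp_sub, Complex.log_exp (abs_lt.1 hx).1 (abs_lt.1 hx).2.le]
  ring

/-- A continuous logarithm of a smooth curve is smooth, as it is locally a branch of the complex
logarithm. -/
lemma contDiffOn_of_exp {l : ℝ → ℂ} (hl : Continuous l) {S : Set ℝ} {n : WithTop ℕ∞}
    (h : ContDiffOn ℝ n (fun s => Complex.exp (l s)) S) : ContDiffOn ℝ n l S := by
  intro s hs
  have h1 : ContDiffWithinAt ℝ n
      (fun u => l s + Complex.log (Complex.exp (l u) / Complex.exp (l s))) S s := by
    refine contDiffWithinAt_const.add (ContDiffAt.comp_contDiffWithinAt (g := Complex.log)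
      (f := fun u => Complex.exp (l u) / Complex.exp (l s)) s ?_ ((h s hs).div_const _))
    rw [div_self (Complex.exp_ne_zero _)]
    exact (Complex.contDiffAt_log Complex.one_mem_slitPlane).restrict_scalars ℝ
  refine h1.congr_of_eventuallyEq (nhdsWithin_le_nhds (eventually_eq_add_log hl.continuousAt)) ?_
  simp

lemma hasDerivWithinAt_of_exp {l : ℝ → ℂ} (hl : Continuous l) {S : Set ℝ} {s : ℝ} {v : ℂ}
    (h : HasDerivWithinAt (fun s => Complex.exp (l s)) v S s) :
    HasDerivWithinAt l (v / Complex.exp (l s)) S s := by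
  have h1 : HasDerivWithinAt (fun u => l s + Complex.log (Complex.exp (l u) / Complex.exp (l s)))
      (v / Complex.exp (l s)) S s := by
    have h2 := ((h.div_const (Complex.exp (l s))).clog_real (by
      rw [div_self (Complex.exp_ne_zero _)]; exact Complex.one_mem_slitPlane)).const_add (l s)
    rwa [div_self (Complex.exp_ne_zero _), div_one] at h2
  refine h1.congr_of_eventuallyEq (nhdsWithin_le_nhds (eventually_eq_add_log hl.continuousAt)) ?_
  simp

lemma contDiffOn_exp_divIm {l : ℝ → ℂ} (hl : Continuous l) (k : ℕ) {S : Set ℝ} {n : WithTop ℕ∞}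
    (h : ContDiffOn ℝ n (fun s => Complex.exp (l s)) S) :
    ContDiffOn ℝ n (fun s => Complex.exp (divIm k (l s))) S :=
  ((divIm k).contDiff.comp_contDiffOn (contDiffOn_of_exp hl h)).cexp

lemma hasDerivWithinAt_exp_divIm {l : ℝ → ℂ} (hl : Continuous l) (k : ℕ) {S : Set ℝ} {s : ℝ} {v : ℂ}
    (h : HasDerivWithinAt (fun s => Complex.exp (l s)) v S s) :
    HasDerivWithinAt (fun s => Complex.exp (divIm k (l s)))
      (Complex.exp (divIm k (l s)) * divIm k (v / Complex.exp (l s))) S s :=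
  ((divIm k).hasFDerivAt.comp_hasDerivWithinAt s (hasDerivWithinAt_of_exp hl h)).cexp

lemma exp_eq_of_exp_divIm_eq {k : ℕ} (hk : 1 ≤ k) {z w : ℂ}
    (h : Complex.exp (divIm k z) = Complex.exp (divIm k w)) : Complex.exp z = Complex.exp w := by
  have hk0 : (k : ℝ) ≠ 0 := by positivity
  obtain ⟨n, hn⟩ := Complex.exp_eq_exp_iff_exists_int.1 h
  refine Complex.exp_eq_exp_iff_exists_int.2 ⟨k * n, ?_⟩
  have h1 := congrArg Complex.re hn
  have h2 := congrArg Complex.im hn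
  simp only [divIm_re, divIm_im, Complex.add_re, Complex.add_im] at h1 h2
  apply Complex.ext
  · simpa using h1
  · simp at h2 ⊢
    field_simp at h2
    linarith

lemma interior_annulus_subset {r R : ℝ} (hr : 0 < r) (hR : 0 < R) {z : ℂ}
    (hz : z ∈ interior (annulus r R)) : r < ‖z‖ ∧ ‖z‖ < R := by
  constructor
  · have h1 : annulus r R ⊆ (ball 0 r)ᶜ := fun z hz => by simpa using hz.1
    have h2 := interior_mono h1 hz
    rw [interior_compl, closure_ball _ hr.ne'] at h2
    simpa using h2
  · have h1 : annulus r R ⊆ closedBall 0 R := fun z hz => by simpa using hz.2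
    have h2 := interior_mono h1 hz
    rw [interior_closedBall _ hR.ne'] at h2
    simpa using h2

lemma mem_interior_solidTorus_iff {r R : ℝ} (hr : 0 < r) (hR : 0 < R) {p : ℂ × ℝ} :
    p ∈ interior (solidTorus r R) ↔ (r < ‖p.1‖ ∧ ‖p.1‖ < R) ∧ 0 < p.2 ∧ p.2 < 1 := by
  rw [solidTorus, interior_prod_eq, interior_Icc]
  refine ⟨fun h => ⟨interior_annulus_subset hr hR h.1, h.2⟩, fun h => ⟨?_, h.2⟩⟩
  have h1 : IsOpen {z : ℂ | r < ‖z‖ ∧ ‖z‖ < R} :=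
    (isOpen_lt continuous_const continuous_norm).inter
      (isOpen_lt continuous_norm continuous_const)
  exact interior_maximal
    (fun z (hz : r < ‖z‖ ∧ ‖z‖ < R) => (⟨hz.1.le, hz.2.le⟩ : z ∈ annulus r R)) h1 h.1

/-- Dividing a continuous angle of a knot gives a knot. -/
lemma IsKnot.exp_divIm {r R : ℝ} (hr : 0 < r) (hR : 0 < R) {N : UnitAddCircle → ℂ × ℝ}
    (hN : IsKnot r R N) {l : UnitAddCircle → ℂ} (hl : Continuous l)
    (hlN : ∀ s, Complex.exp (l s) = (N s).1) {k : ℕ} (hk : 1 ≤ k) :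
    IsKnot r R fun s => (Complex.exp (divIm k (l s)), (N s).2) := by
  have hl' : Continuous fun s : ℝ => l s := hl.comp (AddCircle.continuous_mk' 1)
  have hNc : Continuous N := hN.piecewiseSmooth.1
  have hfun : (fun s : ℝ => Complex.exp (l s)) = fun s : ℝ => (N s).1 := funext fun s => hlN s
  refine ⟨⟨?_, ?_⟩, fun s t hst => ?_, fun s => ?_⟩
  · have := (divIm k).continuous
    fun_prop
  · obtain ⟨n, t, ht, h0, h1, h⟩ := hN.piecewiseSmooth.2
    refine ⟨n, t, ht, h0, h1, fun i => ⟨?_, fun s hs hv => ?_⟩⟩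
    · have hw := contDiffOn_exp_divIm hl' k (hfun ▸ (h i).1.fst)
      exact hw.prodMk (h i).1.snd
    · have hu := uniqueDiffOn_Icc (ht (Fin.castSucc_lt_succ (i := i))) s hs
      have hd := ((h i).1.differentiableOn (by simp) s hs).hasDerivWithinAt
      refine (h i).2 s hs ?_
      set S := Icc (t i.castSucc) (t i.succ)
      set v := derivWithin (fun s : ℝ => N s) S s
      have hd1 : HasDerivWithinAt (fun s : ℝ => (N s).1) v.1 S s :=
        (ContinuousLinearMap.fst ℝ ℂ ℝ).hasFDerivAt.comp_hasDerivWithinAt s hd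
      have hd2 : HasDerivWithinAt (fun s : ℝ => (N s).2) v.2 S s :=
        (ContinuousLinearMap.snd ℝ ℂ ℝ).hasFDerivAt.comp_hasDerivWithinAt s hd
      have hw := (hasDerivWithinAt_exp_divIm hl' k (hfun ▸ hd1)).prodMk hd2
      have hv' := hw.derivWithin hu
      rw [hv] at hv'
      have e1 := congrArg Prod.fst hv'
      have e2 := congrArg Prod.snd hv'
      have e3 : divIm k (v.1 / Complex.exp (l s)) = divIm k 0 := by
        rw [map_zero]
        exact (mul_eq_zero.1 e1.symm).resolve_left (Complex.exp_ne_zero _)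
      have e4 := divIm_injective hk e3
      refine Prod.ext ?_ e2.symm
      exact (div_eq_zero_iff.1 e4).resolve_right (Complex.exp_ne_zero _)
  · refine hN.injective (Prod.ext ?_ (congrArg Prod.snd hst :))
    rw [← hlN, ← hlN]
    exact exp_eq_of_exp_divIm_eq hk (congrArg Prod.fst hst :)
  · have h1 := (mem_interior_solidTorus_iff hr hR).1 (hN.mem_interior s)
    refine (mem_interior_solidTorus_iff hr hR).2 ⟨?_, h1.2⟩
    simp only [Complex.norm_exp, divIm_re]
    rw [← Complex.norm_exp, hlN]
    exact h1.1

/-- A double point of a regular curve has only two parameters. -/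
lemma eq_or_eq_of_mem_multiplePoints {c : UnitAddCircle → ℂ} (hc : IsRegularCurve c)
    {s t u : UnitAddCircle} (hst : s ≠ t) (h : c s = c t) (hu : c u = c s) : u = s ∨ u = t := by
  have h2 := hc.double (c s) ⟨s, t, hst, rfl, h.symm⟩
  have hsub : ({s, t} : Set UnitAddCircle) ⊆ {x | c x = c s} := by
    rintro x (rfl | rfl)
    · rfl
    · exact h.symm
  have h3 : ({s, t} : Set UnitAddCircle) = {x | c x = c s} := by
    refine Finite.eq_of_subset_of_encard_le' (finite_of_encard_eq_coe h2) hsub ?_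
    rw [h2, encard_pair hst]
  have h4 : u ∈ ({s, t} : Set UnitAddCircle) := h3 ▸ hu
  simpa using h4

/-- Restoring the angle maps the double points of the divided curve injectively to double points of
the curve. -/
lemma exists_map_multiplePoints {l : UnitAddCircle → ℂ} {k : ℕ} (hk : 1 ≤ k)
    (hc : IsRegularCurve fun s => Complex.exp (l s)) :
    ∃ f : ℂ → ℂ, (∀ s, f (Complex.exp (divIm k (l s))) = Complex.exp (l s)) ∧
      MapsTo f (multiplePoints fun s => Complex.exp (divIm k (l s)))
        (multiplePoints fun s => Complex.exp (l s)) ∧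
      InjOn f (multiplePoints fun s => Complex.exp (divIm k (l s))) := by
  classical
  let f : ℂ → ℂ := fun z =>
    if h : ∃ s, Complex.exp (divIm k (l s)) = z then Complex.exp (l h.choose) else 0
  have hf : ∀ s, f (Complex.exp (divIm k (l s))) = Complex.exp (l s) := by
    intro s
    have h : ∃ u, Complex.exp (divIm k (l u)) = Complex.exp (divIm k (l s)) := ⟨s, rfl⟩
    simp only [f, dif_pos h]
    exact exp_eq_of_exp_divIm_eq hk h.choose_spec
  refine ⟨f, hf, ?_, ?_⟩
  · rintro _ ⟨s, t, hst, rfl, ht⟩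
    refine ⟨s, t, hst, (hf s).symm, ?_⟩
    simp only at ht ⊢
    rw [← hf t, ht]
  · rintro _ ⟨s, t, hst, rfl, ht⟩ _ ⟨u, v, -, rfl, -⟩ huv
    simp only at ht huv ⊢
    rw [hf, hf] at huv
    rcases eq_or_eq_of_mem_multiplePoints hc hst (exp_eq_of_exp_divIm_eq hk ht).symm huv.symm with
      rfl | rfl
    · rfl
    · exact ht.symm

/-- Dividing a continuous angle of a regular curve gives a regular curve: no new double points
arise, and they stay transverse. -/
lemma IsRegularCurve.exp_divIm {l : UnitAddCircle → ℂ} (hl : Continuous l) {k : ℕ} (hk : 1 ≤ k)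
    (hc : IsRegularCurve fun s => Complex.exp (l s)) :
    IsRegularCurve fun s => Complex.exp (divIm k (l s)) := by
  have hl' : Continuous fun s : ℝ => l s := hl.comp (AddCircle.continuous_mk' 1)
  obtain ⟨f, hf, hfm, hfi⟩ := exists_map_multiplePoints hk hc
  refine ⟨⟨?_, ?_⟩, ?_, ?_, ?_⟩
  · have := (divIm k).continuous
    fun_prop
  · obtain ⟨n, t, ht, h0, h1, h⟩ := hc.piecewiseSmooth.2
    exact ⟨n, t, ht, h0, h1, fun i => contDiffOn_exp_divIm hl' k (h i)⟩
  · exact Finite.of_injOn hfm hfi hc.finite_multiplePoints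
  · rintro _ ⟨s, t, hst, rfl, ht⟩
    have h1 : {u | Complex.exp (divIm k (l u)) = Complex.exp (divIm k (l s))} = {s, t} := by
      ext u
      refine ⟨fun hu => ?_, ?_⟩
      · exact eq_or_eq_of_mem_multiplePoints hc hst (exp_eq_of_exp_divIm_eq hk ht).symm
          (exp_eq_of_exp_divIm_eq hk hu)
      · rintro (rfl | rfl)
        · rfl
        · exact ht
    rw [h1, encard_pair hst]
  · intro s t hst h
    have hγ : Complex.exp (l s) = Complex.exp (l t) := exp_eq_of_exp_divIm_eq hk h
    have hind := hc.transverse s t hst hγ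
    have hd : ∀ u : ℝ, deriv (fun u : ℝ => Complex.exp (l u)) u ≠ 0 →
        deriv (fun u : ℝ => Complex.exp (divIm k (l u))) u = Complex.exp (divIm k (l u)) *
          divIm k (deriv (fun u : ℝ => Complex.exp (l u)) u / Complex.exp (l u)) := by
      intro u hu
      have h1 := (differentiableAt_of_deriv_ne_zero hu).hasDerivAt.hasDerivWithinAt (s := univ)
      have h2 := hasDerivWithinAt_exp_divIm hl' k h1
      exact (hasDerivWithinAt_univ.1 h2).deriv
    have hs : deriv (fun u : ℝ => Complex.exp (l u)) s ≠ 0 := hind.ne_zero 0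
    have ht : deriv (fun u : ℝ => Complex.exp (l u)) t ≠ 0 := hind.ne_zero 1
    -- at a double point both velocities are transformed by the same linear map
    let L : ℂ →ₗ[ℝ] ℂ := (LinearMap.mulLeft ℝ (Complex.exp (divIm k (l s)))).comp
      ((divIm k : ℂ →ₗ[ℝ] ℂ).comp (LinearMap.mulLeft ℝ (Complex.exp (l s))⁻¹))
    have hL : Function.Injective L := by
      refine (mul_right_injective₀ (Complex.exp_ne_zero _)).comp ((divIm_injective hk).comp
        (mul_right_injective₀ (inv_ne_zero (Complex.exp_ne_zero _))))
    have h3 := hind.map' L (LinearMap.ker_eq_bot.2 hL)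
    suffices h4 : ![deriv (fun u : ℝ => Complex.exp (divIm k (l u))) s,
        deriv (fun u : ℝ => Complex.exp (divIm k (l u))) t] =
        L ∘ ![deriv (fun u : ℝ => Complex.exp (l u)) s, deriv (fun u : ℝ => Complex.exp (l u)) t] by
      rw [h4]
      exact h3
    ext i
    fin_cases i
    · simp only [Fin.zero_eta, Matrix.cons_val_zero, Function.comp_apply]
      rw [hd s hs, div_eq_inv_mul]
      rfl
    · simp only [Fin.mk_one, Matrix.cons_val_one, Matrix.cons_val_fin_one, Function.comp_apply]
      rw [hd t ht, div_eq_inv_mul, ← h, ← hγ]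
      rfl

/-! ### Knots in minimal position that miss a meridional disk -/

/-- If a knot in minimal position misses a meridional disk, then its projection does not separate
the boundary components of the annulus. Dividing the angle of the knot by a large integer destroys
every double point at which the angle jumps; by minimality there are none, so the angle is a
continuous function on the projection. -/
theorem IsMinimalPosition.conn_compl {r R : ℝ} (hr : 0 < r) (hrR : r < R)
    {N : UnitAddCircle → ℂ × ℝ} (hN : IsKnot r R N) (hmin : IsMinimalPosition r R N)
    (h : (Circle × closedBall (0 : ℂ) 1) ≃ₜ solidTorus r R)
    (hmiss : ∀ s, (h.symm ⟨N s, interior_subset (hN.mem_interior s)⟩).1 ≠ 1) :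
    Conn (range (proj N))ᶜ 0 R := by
  have hR : 0 < R := hr.trans hrR
  have hNc : Continuous N := hN.piecewiseSmooth.1
  have hint : ∀ s, r < ‖(N s).1‖ ∧ ‖(N s).1‖ < R := fun s =>
    ((mem_interior_solidTorus_iff hr hR).1 (hN.mem_interior s)).1
  obtain ⟨θ, hθ, hθN, hequiv⟩ := exists_angle_equivalent hr hNc hN.mem_interior h hmiss
  have hpos : ∀ s, 0 < ‖(N s).1‖ := fun s => hr.trans (hint s).1
  let l : UnitAddCircle → ℂ := fun s =>
    (Real.log ‖(N s).1‖ : ℂ) + (2 * Real.pi * θ s : ℝ) * Complex.I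
  have hl : Continuous l := by
    have h1 : Continuous fun s => Real.log ‖(N s).1‖ :=
      Continuous.log (by fun_prop) fun s => (hpos s).ne'
    fun_prop
  have hre : ∀ s, (l s).re = Real.log ‖(N s).1‖ := fun s => by simp [l]
  have him : ∀ s, (l s).im = 2 * Real.pi * θ s := fun s => by simp [l]
  have hpolar : ∀ (z : ℂ) s, z.re = Real.log ‖(N s).1‖ →
      Complex.exp z = (‖(N s).1‖ : ℂ) * Circle.exp z.im := by
    intro z s hz
    conv_lhs => rw [← Complex.re_add_im z]
    rw [Complex.exp_add, hz, ← Complex.ofReal_exp, Real.exp_log (hpos s), Circle.coe_exp]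
  have hlN : ∀ s, Complex.exp (l s) = proj N s := fun s => by
    rw [hpolar _ s (hre s), him, hθN]; rfl
  -- divide by more than the oscillation of the angle
  obtain ⟨B, hB⟩ := (isCompact_range hθ).isBounded.exists_norm_le
  obtain ⟨k, hkB⟩ := exists_nat_gt (max 1 (2 * B))
  have hk : 1 ≤ k := by
    have : (1 : ℝ) < k := (le_max_left _ _).trans_lt hkB
    exact_mod_cast this.le
  have hk0 : (0 : ℝ) < k := by exact_mod_cast hk
  let N' : UnitAddCircle → ℂ × ℝ := fun s => (Complex.exp (divIm k (l s)), (N s).2)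
  have hN' : IsKnot r R N' := hN.exp_divIm hr hR hl hlN hk
  have hreg : IsRegularCurve fun s => Complex.exp (l s) := by
    simp only [hlN]; exact hmin.1
  have hreg' : IsRegularPosition N' := hreg.exp_divIm hl hk
  have hNN' : Equivalent r R N N' := by
    convert hequiv k hk using 1
    funext s
    refine Prod.ext ?_ rfl
    change Complex.exp (divIm k (l s)) = _
    rw [hpolar _ s (by rw [divIm_re, hre]), divIm_im, him, mul_div_assoc]
  have hle := hmin.2 N' hN' hreg' hNN'
  obtain ⟨f, hf, hfm, hfi⟩ := exists_map_multiplePoints hk hreg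
  have hproj : (fun s => Complex.exp (l s)) = proj N := funext hlN
  have hproj' : (fun s => Complex.exp (divIm k (l s))) = proj N' := rfl
  rw [hproj, hproj'] at hfm
  rw [hproj'] at hfi
  have himage : f '' multiplePoints (proj N') = multiplePoints (proj N) :=
    hmin.1.finite_multiplePoints.eq_of_subset_of_encard_le' hfm.image_subset
      (by rwa [hfi.encard_image])
  -- the angle does not jump at double points
  have hll : ∀ s t, proj N s = proj N t → l s = l t := by
    intro s t hst
    by_cases hne : s = t
    · rw [hne]
    have hmem : proj N s ∈ f '' multiplePoints (proj N') := himage ▸ ⟨s, t, hne, rfl, hst.symm⟩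
    obtain ⟨_, ⟨u, v, huv, rfl, hv⟩, hu⟩ := hmem
    have hu1 : proj N u = proj N s := by
      rw [← hu, ← hlN]; exact (hf u).symm
    have hv1 : proj N v = proj N s := by
      rw [← hu, ← hv, ← hlN]; exact (hf v).symm
    have hst' : proj N' s = proj N' t := by
      rcases eq_or_eq_of_mem_multiplePoints hmin.1 huv (hu1.trans hv1.symm) hu1.symm with rfl | rfl
      · rcases eq_or_eq_of_mem_multiplePoints hmin.1 huv (hu1.trans hv1.symm)
          (hst.symm) with rfl | rfl
        · rfl
        · exact hv.symm
      · rcases eq_or_eq_of_mem_multiplePoints hmin.1 huv (hu1.trans hv1.symm)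
          (hst.symm.trans hu1.symm) with rfl | rfl
        · exact hv
        · rfl
    obtain ⟨n, hn⟩ := Complex.exp_eq_exp_iff_exists_int.1
      (show Complex.exp (divIm k (l s)) = Complex.exp (divIm k (l t)) from hst')
    have e1 := congrArg Complex.re hn
    have e2 := congrArg Complex.im hn
    simp only [divIm_re, divIm_im, Complex.add_re, Complex.add_im, him] at e1 e2
    have e3 : θ s - θ t = n * k := by
      have := Real.pi_pos
      simp at e2
      field_simp at e2
      linarith
    have hn0 : n = 0 := by
      have b1 := hB _ ⟨s, rfl⟩
      have b2 := hB _ ⟨t, rfl⟩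
      rw [Real.norm_eq_abs, abs_le] at b1 b2
      have b3 : 2 * B < k := (le_max_right _ _).trans_lt hkB
      have b4 : (n : ℝ) * k < 1 * k := by linarith
      have b5 : (-1 : ℝ) * k < n * k := by linarith
      have b6 : (n : ℝ) < 1 := lt_of_mul_lt_mul_right b4 hk0.le
      have b7 : (-1 : ℝ) < n := lt_of_mul_lt_mul_right b5 hk0.le
      have b8 : n < 1 := by exact_mod_cast b6
      have b9 : -1 < n := by exact_mod_cast b7
      lia
    rw [hn0] at hn
    refine divIm_injective hk ?_
    simpa using hn
  have hpc : Continuous (proj N) := continuous_fst.comp hNc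
  obtain ⟨L, hL, hLl⟩ := exists_continuousOn_factor (S := (univ : Set UnitAddCircle)) isCompact_univ
    hpc.continuousOn hl.continuousOn fun s _ t _ hst => hll s t hst
  rw [image_univ] at hL
  refine conn_compl_of_log (isCompact_range hpc) hL ?_ ?_ (by exact_mod_cast hR.ne')
  · rintro _ ⟨s, rfl⟩
    rw [hLl s (mem_univ s), hlN]
  · rintro _ ⟨s, rfl⟩
    rw [Complex.norm_real, Real.norm_of_nonneg hR.le]
    exact (hint s).2

/-! ### The wrapping number of a knot in minimal position -/

/-- A ray that crosses the projection twice gives a meridional disk that meets the knot twice. If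
some meridional disk met the knot fewer times, then the knot would miss another one, and its
projection would not separate the boundary components of the annulus. -/
theorem IsMinimalPosition.wrappingNumber_eq_two {r R : ℝ} (hr : 0 < r) (hrR : r < R)
    {N : UnitAddCircle → ℂ × ℝ} (hN : IsKnot r R N) (hmin : IsMinimalPosition r R N)
    (hwrap : curveWrappingNumber r R (proj N) = 2) :
    wrappingNumber (solidTorus r R) (range N) = 2 := by
  have hNc : Continuous N := hN.piecewiseSmooth.1
  have hpc : Continuous (proj N) := continuous_fst.comp hNc
  have hmem : ∀ t, N t ∈ solidTorus r R := fun t => interior_subset (hN.mem_interior t)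
  have hint : ∀ t, r < ‖proj N t‖ ∧ ‖proj N t‖ < R := fun t =>
    ((mem_interior_solidTorus_iff hr (hr.trans hrR)).1 (hN.mem_interior t)).1
  have hray := crossesRayTwice_of_curveWrappingNumber hmin.1 hr hrR (fun t => (hint t).1)
    (fun t => (hint t).2) hwrap
  obtain ⟨h, h2, hs⟩ := hray.exists_parametrization hr hrR hmem hpc (fun t => (hint t).1)
    (fun t => (hint t).2) hwrap
  refine le_antisymm ?_ ?_
  · refine (wrappingNumber_le h).trans ?_
    rw [meridian_inter_range hmem h, hN.injective.encard_image, h2]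
  · by_contra hlt
    obtain ⟨h', hmiss⟩ := exists_disjoint_meridian hNc hN.injective hmem h2 hs (not_le.1 hlt)
    exact not_conn_of_one_lt hpc hr hrR (by rw [hwrap]; exact Nat.one_lt_ofNat)
      (hmin.conn_compl hr hrR hN h' hmiss)

end KnotAnnulus

theorem mainTheorem6 (r R : ℝ) (hr : 0 < r) (hrR : r < R)
    (N : UnitAddCircle → ℂ × ℝ)
    (hN : KnotAnnulus.IsKnot r R N)
    (hmin : KnotAnnulus.IsMinimalPosition r R N)
    (hwrap : KnotAnnulus.curveWrappingNumber r R (KnotAnnulus.proj N) = 2) :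
    KnotAnnulus.wrappingNumber (KnotAnnulus.solidTorus r R) (Set.range N) = 2 :=
  hmin.wrappingNumber_eq_two hr hrR hN hwrap
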